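/- Let $\mathcal{P}$ be an $m$-dimensional Euclidean polyhedral space, i.e. a simplicial complex whose simplices carry the metrics of Euclidean simplices (agreeing on common faces), equipped with the intrinsic metric (the infimum of lengths of broken lines, assumed finite and positive between distinct points). A point of $\mathcal{P}$ is \emph{regular} if it has a neighborhood isometric to an open subset of $\mathbb{R}^m$, and \emph{singular} otherwise; let $\mathcal{P}^\circ$ be the set of regular points and $\mathcal{P}^\star$ the set of singular points (the singular locus). Assume that $\mathcal{P}^\circ$ is connected and nonempty. The \emph{ramification} $\operatorname{Ram}\mathcal{P}$ is the metric completion of the universal cover of $\mathcal{P}^\circ$, equipped with the lifted length metric. Suppose that $\mathcal{P}$ admits a subdivision into closed sets $\{Q_i\}$, i.e. the $Q_i$ form a locally finite cover of $\mathcal{P}$ such that (a) each $Q_i$, with the length metric induced from $\mathcal{P}$ (this metric inducing the subspace topology), is isometric to an $m$-dimensional, possibly unbounded, convex polyhedron in $\mathbb{R}^m$, that is, to an intersection of finitely many closed half-spaces with nonempty interior (for example, this holds if $Q_i$ is isometric to such a polyhedron with respect to the restriction of the metric of $\mathcal{P}$); (b) for $i\neq j$ the intersection $Q_i\cap Q_j$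 is a (possibly empty) union of sets each of which is a proper face of both $Q_i$ and $Q_j$. Assume moreover that each face of dimension $m-2$ of each polyhedron $Q_i$ is contained in the singular locus $\mathcal{P}^\star$. Then $\operatorname{Ram}\mathcal{P}$ is a $\mathrm{CAT}(0)$ space (complete, geodesic, with the triangle comparison of $\mathrm{CAT}(0)$). -/

import Mathlib

open Set Filter Topology
open scoped ENNReal

/-! ### Curves and CAT(0) spaces -/

/-- The length of a curve: the supremum of the lengths of its inscribed broken lines. -/
noncomputable def pathLength {X : Type*} [PseudoEMetricSpace X] {x y : X} (γ : Path x y) : ℝ≥0∞ :=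
  eVariationOn γ Set.univ

/-- The length metric of a space: the infimum of the lengths of the curves joining two points. -/
noncomputable def intrinsicEDist {X : Type*} [PseudoEMetricSpace X] (x y : X) : ℝ≥0∞ :=
  ⨅ γ : Path x y, pathLength γ

/-- `γ`, restricted to `[0, 1]`, is a minimizing geodesic from `x` to `y` of constant speed. -/
structure IsGeodesic {X : Type*} [EMetricSpace X] (γ : ℝ → X) (x y : X) : Prop where
  source : γ 0 = x
  target : γ 1 = y
  edist_eq : ∀ s ∈ Icc (0 : ℝ) 1, ∀ t ∈ Icc (0 : ℝ) 1,
    edist (γ s) (γ t) = ENNReal.ofReal |s - t| * edist x y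

/-- CAT(0) spaces: complete geodesic metric spaces in which geodesic triangles are not thicker than
their comparison triangles in the Euclidean plane. Any two sides of a triangle have a common
vertex, so it suffices to compare points on two sides which start at the same vertex. -/
structure IsCAT0 (X : Type*) [EMetricSpace X] : Prop where
  complete : CompleteSpace X
  edist_ne_top : ∀ x y : X, edist x y ≠ ⊤
  exists_geodesic : ∀ x y : X, ∃ γ : ℝ → X, IsGeodesic γ x y
  comparison : ∀ (p q r : X) (γ η : ℝ → X), IsGeodesic γ p q → IsGeodesic η p r →
    ∀ p' q' r' : EuclideanSpace ℝ (Fin 2),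
      edist p' q' = edist p q → edist q' r' = edist q r → edist r' p' = edist r p →
        ∀ s ∈ Icc (0 : ℝ) 1, ∀ t ∈ Icc (0 : ℝ) 1,
          edist (γ s) (η t) ≤ edist (AffineMap.lineMap p' q' s) (AffineMap.lineMap p' r' t)

/-! ### The completion of a pseudometric space (with possibly infinite distances) -/

/-- Cauchy sequences; the distance between two of them is the limit of the distances between
their terms. -/
def CauchySequences (X : Type*) [PseudoEMetricSpace X] : Type _ :=
  {u : ℕ → X // CauchySeq u}

theorem limsup_add_le_add_limsup (a b : ℕ → ℝ≥0∞) :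
    limsup (fun n => a n + b n) atTop ≤ limsup a atTop + limsup b atTop := by
  refine ENNReal.le_of_forall_pos_le_add fun ε hε hfin => ?_
  have hε' : (ε : ℝ≥0∞) / 2 ≠ 0 := by simp [hε.ne']
  obtain ⟨ha, hb⟩ := ENNReal.add_ne_top.1 hfin.ne
  have h₁ := eventually_lt_of_limsup_lt (ENNReal.lt_add_right ha hε')
  have h₂ := eventually_lt_of_limsup_lt (ENNReal.lt_add_right hb hε')
  refine limsup_le_of_le (h := ?_)
  filter_upwards [h₁, h₂] with n h h'
  calc a n + b n ≤ (limsup a atTop + ε / 2) + (limsup b atTop + ε / 2) := add_le_add h.le h'.le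
    _ = limsup a atTop + limsup b atTop + (ε / 2 + ε / 2) := by abel
    _ = limsup a atTop + limsup b atTop + ε := by rw [ENNReal.add_halves]

noncomputable instance (X : Type*) [PseudoEMetricSpace X] :
    PseudoEMetricSpace (CauchySequences X) where
  edist u v := limsup (fun n => edist (u.1 n) (v.1 n)) atTop
  edist_self u := by simp
  edist_comm u v := by simp only [edist_comm]
  edist_triangle u v w :=
    (limsup_le_limsup (Eventually.of_forall fun n => edist_triangle (u.1 n) (v.1 n) (w.1 n))).trans
      (limsup_add_le_add_limsup _ _)

/-- The metric completion: Cauchy sequences modulo the pairs at distance zero. -/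
abbrev MetricCompletion (X : Type*) [PseudoEMetricSpace X] : Type _ :=
  SeparationQuotient (CauchySequences X)

/-! ### The universal cover, with the lifted length metric -/

/-- The universal cover of `Y` with respect to the base point `y₀`: its points are the homotopy
classes, relative to the end points, of the paths in `Y` which start at `y₀`. -/
structure UniversalCover {Y : Type*} [TopologicalSpace Y] (y₀ : Y) where
  endpoint : Y
  pathClass : Path.Homotopic.Quotient y₀ endpoint

/-- The distance between two points of the universal cover is the infimum of the lengths of the
curves in `Y` which lift to a curve from the first point to the second one. -/
noncomputable def UniversalCover.liftEDist {Y : Type*} [PseudoEMetricSpace Y] {y₀ : Y}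
    (a b : UniversalCover y₀) : ℝ≥0∞ :=
  ⨅ (γ : Path a.endpoint b.endpoint)
    (_ : a.pathClass.trans (Path.Homotopic.Quotient.mk γ) = b.pathClass), pathLength γ

theorem pathLength_refl {X : Type*} [PseudoEMetricSpace X] (x : X) :
    pathLength (Path.refl x) = 0 := by
  apply eVariationOn.constant_on
  rintro _ ⟨s, -, rfl⟩ _ ⟨t, -, rfl⟩
  simp

theorem pathLength_symm_le {X : Type*} [PseudoEMetricSpace X] {x y : X} (γ : Path x y) :
    pathLength γ.symm ≤ pathLength γ :=
  eVariationOn.comp_le_of_antitoneOn γ unitInterval.symm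
    (fun _ _ _ _ h => unitInterval.symm_le_symm.2 h) (fun _ _ => mem_univ _)

theorem pathLength_trans_le {X : Type*} [PseudoEMetricSpace X] {x y z : X} (γ : Path x y)
    (η : Path y z) : pathLength (γ.trans η) ≤ pathLength γ + pathLength η := by
  let h : unitInterval := ⟨1 / 2, by norm_num, by norm_num⟩
  have hsplit : (Set.univ : Set unitInterval) = Set.Iic h ∪ Set.Ici h := Set.Iic_union_Ici.symm
  unfold pathLength
  rw [hsplit, eVariationOn.union (x := h) _ isGreatest_Iic isLeast_Ici, ← hsplit]
  refine add_le_add ?_ ?_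
  · rw [eVariationOn.eq_of_eqOn (f' := γ ∘ fun t : unitInterval => Set.projIcc 0 1 zero_le_one
      (2 * (t : ℝ)))]
    · refine eVariationOn.comp_le_of_monotoneOn _ _ ?_ (fun _ _ => mem_univ _)
      intro s _ t _ hst
      exact Set.monotone_projIcc _ (by have : (s : ℝ) ≤ t := hst; linarith)
    · intro t ht
      have ht' : (t : ℝ) ≤ 1 / 2 := ht
      have hm : 2 * (t : ℝ) ∈ Set.Icc (0 : ℝ) 1 := ⟨by linarith [t.2.1], by linarith⟩
      simp only [Path.trans_apply, ht', dif_pos, Function.comp_apply, Set.projIcc_of_mem _ hm]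
  · rw [eVariationOn.eq_of_eqOn (f' := η ∘ fun t : unitInterval => Set.projIcc 0 1 zero_le_one
      (2 * (t : ℝ) - 1))]
    · refine eVariationOn.comp_le_of_monotoneOn _ _ ?_ (fun _ _ => mem_univ _)
      intro s _ t _ hst
      exact Set.monotone_projIcc _ (by have : (s : ℝ) ≤ t := hst; linarith)
    · intro t ht
      have ht' : 1 / 2 ≤ (t : ℝ) := ht
      have hm : 2 * (t : ℝ) - 1 ∈ Set.Icc (0 : ℝ) 1 := ⟨by linarith, by linarith [t.2.2]⟩
      simp only [Path.trans_apply, Function.comp_apply, Set.projIcc_of_mem _ hm]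
      split_ifs with hle
      · have he : (t : ℝ) = 1 / 2 := le_antisymm hle ht'
        simp [he]
      · rfl

theorem UniversalCover.liftEDist_comm_le {Y : Type*} [PseudoEMetricSpace Y] {y₀ : Y}
    (a b : UniversalCover y₀) : a.liftEDist b ≤ b.liftEDist a := by
  refine le_iInf₂ fun γ hγ => iInf₂_le_of_le γ.symm ?_ (pathLength_symm_le γ)
  rw [← hγ, Path.Homotopic.Quotient.mk_symm, Path.Homotopic.Quotient.trans_assoc,
    Path.Homotopic.Quotient.trans_symm, Path.Homotopic.Quotient.trans_refl]

noncomputable instance {Y : Type*} [PseudoEMetricSpace Y] (y₀ : Y) :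
    PseudoEMetricSpace (UniversalCover y₀) where
  edist a b := a.liftEDist b
  edist_self a :=
    le_antisymm (iInf₂_le_of_le (Path.refl _) (by simp) (pathLength_refl _).le) zero_le
  edist_comm a b := le_antisymm (a.liftEDist_comm_le b) (b.liftEDist_comm_le a)
  edist_triangle a b c := by
    refine ENNReal.le_iInf₂_add_iInf₂ fun γ hγ η hη =>
      iInf₂_le_of_le (γ.trans η) ?_ (pathLength_trans_le γ η)
    rw [← hη, ← hγ, Path.Homotopic.Quotient.mk_trans, Path.Homotopic.Quotient.trans_assoc]

/-! ### Polyhedral spaces -/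

/-- The geometric realization of a simplicial complex, in barycentric coordinates. -/
def AbstractSimplicialComplex.Realization {V : Type*} (K : AbstractSimplicialComplex V) : Type _ :=
  {w : V →₀ ℝ // w.support ∈ K.faces ∧ (∀ v, 0 ≤ w v) ∧ w.sum (fun _ a => a) = 1}

/-- A simplicial complex, of dimension `m`, whose simplices carry the metrics of nondegenerate
simplices in Euclidean spaces, in such a way that the metrics agree on common faces. -/
structure EuclideanComplex (V : Type*) (m : ℕ) extends AbstractSimplicialComplex V where
  /-- `position s` places the vertices of the simplex `s` in Euclidean space -/
  position : Finset V → V → EuclideanSpace ℝ (Fin m)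
  affineIndependent : ∀ s ∈ faces, AffineIndependent ℝ (fun v : s => position s v)
  dist_compatible : ∀ s ∈ faces, ∀ t ∈ faces, ∀ v ∈ s, v ∈ t → ∀ w ∈ s, w ∈ t →
    dist (position s v) (position s w) = dist (position t v) (position t w)
  exists_top_simplex : ∃ s ∈ faces, s.card = m + 1

namespace EuclideanComplex

variable {V : Type*} {m : ℕ} (K : EuclideanComplex V m)

/-- The point of the Euclidean simplex `s` with the given barycentric coordinates. -/
noncomputable def place (s : Finset V) (w : K.toAbstractSimplicialComplex.Realization) :
    EuclideanSpace ℝ (Fin m) :=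
  w.1.sum fun v a => a • K.position s v

/-- `K.HasChain x y L`: there is a broken line of length `L` from `x` to `y`, each segment of which
lies in one (closed) simplex and is measured there. -/
inductive HasChain : K.toAbstractSimplicialComplex.Realization →
    K.toAbstractSimplicialComplex.Realization → ℝ → Prop
  | refl (x) : HasChain x x 0
  | cons (x y z) (L : ℝ) (s : Finset V) (hs : s ∈ K.faces) (hx : x.1.support ⊆ s)
      (hy : y.1.support ⊆ s) (hyz : HasChain y z L) :
      HasChain x z (dist (K.place s x) (K.place s y) + L)

end EuclideanComplex

/-- An `m`-dimensional Euclidean polyhedral space: a simplicial complex built of Euclidean simplices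
with its intrinsic metric, the infimum of the lengths of broken lines. -/
def IsPolyhedralSpace.{u} (m : ℕ) (P : Type u) [MetricSpace P] : Prop :=
  ∃ (V : Type u) (K : EuclideanComplex V m) (e : P ≃ K.toAbstractSimplicialComplex.Realization),
    ∀ x y : P, IsGLB {L : ℝ | K.HasChain (e x) (e y) L} (dist x y)

/-- The points which have a neighborhood isometric to an open subset of Euclidean space. -/
def regularLocus (m : ℕ) (P : Type*) [MetricSpace P] : Set P :=
  {x | ∃ U ∈ 𝓝 x, ∃ W : Set (EuclideanSpace ℝ (Fin m)), IsOpen W ∧ Nonempty (U ≃ᵢ W)}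

/-- The points which do not have such a neighborhood. -/
def singularLocus (m : ℕ) (P : Type*) [MetricSpace P] : Set P :=
  (regularLocus m P)ᶜ

/-- The ramification of `P`: the completion of the universal cover of its regular locus. -/
abbrev Ram (m : ℕ) (P : Type*) [MetricSpace P] (x₀ : regularLocus m P) : Type _ :=
  MetricCompletion (UniversalCover x₀)

/-! ### Subdivisions into convex polyhedra -/

/-- Convex polyhedra (possibly unbounded): intersections of finitely many closed half-spaces. -/
def IsConvexPolyhedron {m : ℕ} (C : Set (EuclideanSpace ℝ (Fin m))) : Prop :=
  ∃ (n : ℕ) (a : Fin n → EuclideanSpace ℝ (Fin m)) (b : Fin n → ℝ),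
    C = {x | ∀ k, inner ℝ (a k) x ≤ b k}

/-- The (nonempty) faces of a polyhedron, the polyhedron itself included: the sets where a linear
functional attains its maximum. -/
def IsFace {m : ℕ} (C F : Set (EuclideanSpace ℝ (Fin m))) : Prop :=
  F.Nonempty ∧ IsExposed ℝ C F

/-- The dimension of a face. -/
noncomputable def faceDim {m : ℕ} (F : Set (EuclideanSpace ℝ (Fin m))) : ℕ :=
  Module.finrank ℝ (vectorSpan ℝ F)

/-- The subset of `P` which corresponds to the subset `F` of a polyhedron `C`, where `C` is
identified with a subset `Q` of `P`. -/
def cellImage {m : ℕ} {P : Type*} {Q : Set P} {C : Set (EuclideanSpace ℝ (Fin m))} (f : C → Q)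
    (F : Set (EuclideanSpace ℝ (Fin m))) : Set P :=
  {x | ∃ c : C, (c : EuclideanSpace ℝ (Fin m)) ∈ F ∧ (f c : P) = x}

/-- A subdivision of `P` into closed sets `Q i`, each of which, with the length metric induced
from `P`, is isometric to an `m`-dimensional convex polyhedron `C i`. The family is locally finite,
and two of its members meet in a union of common proper faces. -/
structure ConvexSubdivision (m : ℕ) (P : Type*) [MetricSpace P] (ι : Type*) where
  Q : ι → Set P
  C : ι → Set (EuclideanSpace ℝ (Fin m))
  chart : ∀ i, C i ≃ₜ Q i
  isClosed : ∀ i, IsClosed (Q i)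
  isConvexPolyhedron : ∀ i, IsConvexPolyhedron (C i)
  interior_nonempty : ∀ i, (interior (C i)).Nonempty
  chart_isometry : ∀ i, ∀ a b : C i, intrinsicEDist (chart i a) (chart i b) = edist a b
  locallyFinite : LocallyFinite Q
  cover : ⋃ i, Q i = Set.univ
  faceToFace : ∀ i j, i ≠ j → ∀ x ∈ Q i ∩ Q j, ∃ F G, IsFace (C i) F ∧ F ≠ C i ∧
    IsFace (C j) G ∧ G ≠ C j ∧ cellImage (chart i) F = cellImage (chart j) G ∧
      x ∈ cellImage (chart i) F

/-!
The regular locus is the union of the interiors of the polyhedra and of open pieces of the facets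
between them. Indeed, a point of two cells which is not a smooth boundary point lies on a face of
codimension two (`mem_interior_or_smoothAt_or_face`), so it is singular; and in a chart at a regular
point, two cells which meet there lie on opposite sides of a hyperplane, so that there are no more
than two of them (`IsChartAt.normal_eq_neg`, `eq_or_eq_of_mem_regularLocus`). The regular points of
a facet form a convex set (`IsTame.combo_mem_regularLocus`), because two cells can be unfolded along
a facet without increasing the length of curves (`IsHinge.exists_unfold_le`).

Consequently the universal cover of the regular locus is a tree of polyhedra. Each cell is simply
connected, hence lifts; crossing a facet multiplies by a generator of the free group on the facets.
These transition functions define a covering space of the regular locus, whose monodromy assigns an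
element of the free group to each lift of a cell (`exists_label`). Adjacent lifts differ by one
letter, and each lift has at most one neighbor for each letter, hence the lifts form a tree
(`IsTame.exists_isLabelledTree`, `IsLabelledTree.eq_of_separated`). A curve in the universal cover
therefore crosses every facet which separates its end points (`IsTame.exists_mem_wall`). Unfolding
along the facets defines a developing map into Euclidean space, which does not increase lengths and
is isometric on each lift, so the lifts of the polyhedra are isometrically embedded
(`edist_eq_edist_coord`), and their closures in the completion are the whole polyhedra.

It remains to glue convex sets along a tree. A complete space is CAT(0) if its distance functions
satisfy Stewart's inequality (`isCAT0_of_stewart`). On a segment in a cell, this inequality for the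
distance to a point of another cell follows by induction on the distance in the tree: the distance
is the infimum of `h z + ‖z - x‖` over the points `z` of a convex face, where `h` satisfies
Stewart's inequality on the face, and the inequality survives the infimum by the joint convexity of
`(v, μ) ↦ ‖v‖ ^ 2 / μ` (`exists_combo_sq_le`, `Cells.stewart_of_same_cell`). A geodesic which
crosses a face is treated as in Reshetnyak's gluing theorem, by the first variation and a comparison
triangle (`stewart_crossing`, `Cells.exists_stewart`). This covers the points of the cells, which
are dense in the ramification (`Cells.isCAT0`).
-/

namespace Ramification

/-! ### Strong convexity of distance functions -/

section Perspective

variable {V : Type*} [NormedAddCommGroup V] [InnerProductSpace ℝ V]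

/-- Stewart's theorem in an inner product space. -/
theorem norm_sq_combo_sub (a b c : V) {s t : ℝ} (h : s + t = 1) :
    ‖s • a + t • b - c‖ ^ 2 = s * ‖a - c‖ ^ 2 + t * ‖b - c‖ ^ 2 - s * t * ‖a - b‖ ^ 2 := by
  obtain rfl : s = 1 - t := by linarith
  simp only [← real_inner_self_eq_norm_sq, inner_sub_left, inner_sub_right, inner_add_left,
    inner_add_right, real_inner_smul_left, real_inner_smul_right, real_inner_comm a b,
    real_inner_comm a c, real_inner_comm b c]
  ring

theorem norm_sq_combo (a b : V) {s t : ℝ} (h : s + t = 1) :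
    ‖s • a + t • b‖ ^ 2 = s * ‖a‖ ^ 2 + t * ‖b‖ ^ 2 - s * t * ‖a - b‖ ^ 2 := by
  simpa using norm_sq_combo_sub a b 0 h

/-- Joint convexity of `(d, e) ↦ ‖d‖ ^ 2 / e`, where `P` stands for the quotient. -/
theorem norm_sq_combo_le_of_perspective {d₁ d₂ : V} {e₁ e₂ P₁ P₂ s t : ℝ} (he₁ : 0 ≤ e₁)
    (he₂ : 0 ≤ e₂) (hP₁ : 0 ≤ P₁) (hP₂ : 0 ≤ P₂) (hs : 0 ≤ s) (ht : 0 ≤ t)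
    (h₁ : ‖d₁‖ ^ 2 = e₁ * P₁) (h₂ : ‖d₂‖ ^ 2 = e₂ * P₂) :
    ‖s • d₁ + t • d₂‖ ^ 2 ≤ (s * e₁ + t * e₂) * (s * P₁ + t * P₂) := by
  have key : 2 * inner ℝ d₁ d₂ ≤ e₁ * P₂ + e₂ * P₁ := by
    refine le_trans (by linarith [real_inner_le_norm d₁ d₂]) (b := 2 * (‖d₁‖ * ‖d₂‖)) ?_
    refine abs_le_of_sq_le_sq' ?_ (by positivity) |>.2
    have : (2 * (‖d₁‖ * ‖d₂‖)) ^ 2 = 4 * (‖d₁‖ ^ 2 * ‖d₂‖ ^ 2) := by ring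
    rw [this, h₁, h₂]
    nlinarith [sq_nonneg (e₁ * P₂ - e₂ * P₁)]
  have hexp : ‖s • d₁ + t • d₂‖ ^ 2 =
      s ^ 2 * ‖d₁‖ ^ 2 + t ^ 2 * ‖d₂‖ ^ 2 + s * t * (2 * inner ℝ d₁ d₂) := by
    rw [norm_add_sq_real, norm_smul, norm_smul, real_inner_smul_left, real_inner_smul_right,
      mul_pow, mul_pow, Real.norm_eq_abs, Real.norm_eq_abs, sq_abs, sq_abs]
    ring
  rw [hexp, h₁, h₂]
  nlinarith [mul_le_mul_of_nonneg_left key (mul_nonneg hs ht)]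

/-- The splitting of `(A + ‖a - x‖) ^ 2 - ‖x‖ ^ 2` into the value at `((1 + e) • a, 1 + e)` of the
perspective of `A ^ 2 - ‖a‖ ^ 2` and a quotient of the form `‖d‖ ^ 2 / e`. -/
theorem perspective_splitting (a x : V) {A e : ℝ} (he : 0 ≤ e) (hu : ‖a - x‖ = e * A) :
    0 ≤ (A + ‖a - x‖) ^ 2 - ‖x‖ ^ 2 - (1 + e) * (A ^ 2 - ‖a‖ ^ 2) ∧ ‖(1 + e) • a - x‖ ^ 2 =
      e * ((A + ‖a - x‖) ^ 2 - ‖x‖ ^ 2 - (1 + e) * (A ^ 2 - ‖a‖ ^ 2)) := by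
  have h₁ : ‖(1 + e) • a - x‖ ^ 2 =
      e * ((A + ‖a - x‖) ^ 2 - ‖x‖ ^ 2 - (1 + e) * (A ^ 2 - ‖a‖ ^ 2)) := by
    have h₂ : ‖a‖ ^ 2 - 2 * inner ℝ a x + ‖x‖ ^ 2 = (e * A) ^ 2 := by
      rw [← hu, norm_sub_sq_real]
    rw [hu, norm_sub_sq_real, norm_smul, real_inner_smul_left, mul_pow, Real.norm_eq_abs, sq_abs]
    linear_combination (1 + e) * h₂
  refine ⟨?_, h₁⟩
  rcases he.eq_or_lt with rfl | he
  · have : a = x := by simpa [sub_eq_zero] using hu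
    simp [this]
  · exact nonneg_of_mul_nonneg_right (h₁ ▸ sq_nonneg _) he

/-- The case of `exists_combo_sq_le` in which both values are positive. -/
theorem exists_combo_sq_le_of_pos (a b x y : V) {A B s t : ℝ} (hA : 0 < A) (hB : 0 < B)
    (hs : 0 ≤ s) (ht : 0 ≤ t) (hst : s + t = 1) :
    ∃ θ ∈ Icc (0 : ℝ) 1, ∀ H : ℝ, 0 ≤ H →
      H ^ 2 ≤ (1 - θ) * A ^ 2 + θ * B ^ 2 - θ * (1 - θ) * ‖a - b‖ ^ 2 →
      (H + ‖((1 - θ) • a + θ • b) - (s • x + t • y)‖) ^ 2 ≤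
        s * (A + ‖a - x‖) ^ 2 + t * (B + ‖b - y‖) ^ 2 - s * t * ‖x - y‖ ^ 2 := by
  obtain ⟨e₁, he₁⟩ : ∃ e, e = ‖a - x‖ / A := ⟨_, rfl⟩
  obtain ⟨e₂, he₂⟩ : ∃ e, e = ‖b - y‖ / B := ⟨_, rfl⟩
  have e₁0 : 0 ≤ e₁ := by rw [he₁]; positivity
  have e₂0 : 0 ≤ e₂ := by rw [he₂]; positivity
  have hu : ‖a - x‖ = e₁ * A := by rw [he₁]; field_simp
  have hv : ‖b - y‖ = e₂ * B := by rw [he₂]; field_simp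
  clear he₁ he₂
  -- the weights are such that `μ • ((1 - θ) • a + θ • b)` is the combination of `(1 + e₁) • a` and
  -- `(1 + e₂) • b`
  obtain ⟨μ, hμ⟩ : ∃ μ, μ = s * (1 + e₁) + t * (1 + e₂) := ⟨_, rfl⟩
  have hμ1 : μ - 1 = s * e₁ + t * e₂ := by rw [hμ]; linear_combination hst
  have hμe : 0 ≤ μ - 1 := by rw [hμ1]; positivity
  have hμ0 : 0 < μ := by linarith
  obtain ⟨θ, hθ⟩ : ∃ θ, θ = t * (1 + e₂) / μ := ⟨_, rfl⟩
  have hθμ : μ * θ = t * (1 + e₂) := by rw [hθ]; field_simp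
  have hθμ' : μ * (1 - θ) = s * (1 + e₁) := by rw [mul_sub, hθμ, hμ]; ring
  have hθ0 : 0 ≤ θ := by rw [hθ]; positivity
  have hθ1 : θ ≤ 1 := by
    have h0 : 0 ≤ μ * (1 - θ) := by rw [hθμ']; positivity
    have := nonneg_of_mul_nonneg_right h0 hμ0
    linarith
  refine ⟨θ, ⟨hθ0, hθ1⟩, fun H hH hle => ?_⟩
  obtain ⟨w, hw⟩ : ∃ w, w = (1 - θ) • a + θ • b := ⟨_, rfl⟩
  obtain ⟨c, hc⟩ : ∃ c, c = s • x + t • y := ⟨_, rfl⟩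
  rw [← hw, ← hc]
  obtain ⟨P₁, hP₁d⟩ : ∃ P, P = (A + ‖a - x‖) ^ 2 - ‖x‖ ^ 2 - (1 + e₁) * (A ^ 2 - ‖a‖ ^ 2) :=
    ⟨_, rfl⟩
  obtain ⟨P₂, hP₂d⟩ : ∃ P, P = (B + ‖b - y‖) ^ 2 - ‖y‖ ^ 2 - (1 + e₂) * (B ^ 2 - ‖b‖ ^ 2) :=
    ⟨_, rfl⟩
  obtain ⟨hP₁, hd₁⟩ := perspective_splitting a x e₁0 hu
  obtain ⟨hP₂, hd₂⟩ := perspective_splitting b y e₂0 hv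
  rw [← hP₁d] at hP₁ hd₁
  rw [← hP₂d] at hP₂ hd₂
  have hk := norm_sq_combo a b (s := 1 - θ) (t := θ) (by ring)
  have hcc := norm_sq_combo x y hst
  rw [← hw] at hk
  rw [← hc] at hcc
  have hμk : μ * (H ^ 2 - ‖w‖ ^ 2) ≤
      s * (1 + e₁) * (A ^ 2 - ‖a‖ ^ 2) + t * (1 + e₂) * (B ^ 2 - ‖b‖ ^ 2) := by
    rw [← hθμ, ← hθμ']
    have h₁ : H ^ 2 - ‖w‖ ^ 2 ≤ (1 - θ) * (A ^ 2 - ‖a‖ ^ 2) + θ * (B ^ 2 - ‖b‖ ^ 2) := by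
      rw [hk]; linarith
    linarith [mul_le_mul_of_nonneg_left h₁ hμ0.le]
  rcases hμe.eq_or_lt with h0 | hpos
  · -- both base points are the given points, or they have weight zero
    have z₁ : s * e₁ = 0 := by linarith [mul_nonneg hs e₁0, mul_nonneg ht e₂0]
    have z₂ : t * e₂ = 0 := by linarith [mul_nonneg hs e₁0, mul_nonneg ht e₂0]
    have hμ' : μ = 1 := by linarith
    have hθt : θ = t := by rw [hμ'] at hθμ; linarith
    have q₁ : s • a = s • x := by
      rcases mul_eq_zero.1 z₁ with h | h
      · simp [h]
      · rw [h, zero_mul, norm_eq_zero, sub_eq_zero] at hu; rw [hu]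
    have q₂ : t • b = t • y := by
      rcases mul_eq_zero.1 z₂ with h | h
      · simp [h]
      · rw [h, zero_mul, norm_eq_zero, sub_eq_zero] at hv; rw [hv]
    have hwc : w = c := by
      rw [hw, hc, hθt, show 1 - t = s by linarith, q₁, q₂]
    have hxy : s * t * ‖a - b‖ ^ 2 = s * t * ‖x - y‖ ^ 2 := by
      rcases mul_eq_zero.1 z₁ with h | h
      · simp [h]
      rcases mul_eq_zero.1 z₂ with h' | h'
      · simp [h']
      rw [h, zero_mul, norm_eq_zero, sub_eq_zero] at hu
      rw [h', zero_mul, norm_eq_zero, sub_eq_zero] at hv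
      rw [hu, hv]
    rw [hwc, sub_self, norm_zero, add_zero, ← hxy, hu, hv]
    rw [hθt, show 1 - t = s by linarith] at hle
    have f₁ : s * (A + e₁ * A) ^ 2 = s * A ^ 2 := by linear_combination (A ^ 2 * (2 + e₁)) * z₁
    have f₂ : t * (B + e₂ * B) ^ 2 = t * B ^ 2 := by linear_combination (B ^ 2 * (2 + e₂)) * z₂
    rw [f₁, f₂]
    linarith
  -- joint convexity gives the claim multiplied by `μ - 1`
  · have htitu := norm_sq_combo_le_of_perspective e₁0 e₂0 hP₁ hP₂ hs ht hd₁ hd₂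
    rw [← hμ1] at htitu
    have hvec : s • ((1 + e₁) • a - x) + t • ((1 + e₂) • b - y) = μ • w - c := by
      rw [hw, hc, smul_add, smul_smul, smul_smul, hθμ, hθμ', smul_sub, smul_sub, smul_smul,
        smul_smul]
      abel
    rw [hvec, norm_sub_sq_real, norm_smul, real_inner_smul_left, mul_pow, Real.norm_eq_abs,
      sq_abs] at htitu
    have hwm : ‖w - c‖ ^ 2 = ‖w‖ ^ 2 - 2 * inner ℝ w c + ‖c‖ ^ 2 := norm_sub_sq_real w c
    have step : (μ - 1) * (H + ‖w - c‖) ^ 2 ≤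
        (μ - 1) * (μ * (H ^ 2 - ‖w‖ ^ 2) + ‖c‖ ^ 2 + (s * P₁ + t * P₂)) := by
      have i₁ : (μ - 1) * (H + ‖w - c‖) ^ 2 ≤ μ * (μ - 1) * H ^ 2 + μ * ‖w - c‖ ^ 2 := by
        have := sq_nonneg ((μ - 1) * H - ‖w - c‖)
        linear_combination this
      rw [hwm] at i₁
      linear_combination i₁ + htitu
    have step' := le_of_mul_le_mul_left step hpos
    rw [hcc] at step'
    refine step'.trans ?_
    rw [hP₁d, hP₂d]
    linarith

/-- The analytic core of the gluing argument. Let `A`, `B` be the values at `a`, `b` of a function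
`h` with `h ^ 2 - ‖·‖ ^ 2` convex on the segment `[a, b]`. Then `g ^ 2 - ‖·‖ ^ 2` is convex too,
where `g x` is the infimum over `z ∈ [a, b]` of `h z + ‖z - x‖`. The reason is that `g x ^ 2 - ‖x‖ ^
2` is a partial infimum of `‖w - x‖ ^ 2 / (μ - 1) + μ * (h (w / μ) ^ 2 - ‖w / μ‖ ^ 2)`, which is
jointly convex in `(x, w, μ)`. -/
theorem exists_combo_sq_le (a b x y : V) {A B s t : ℝ} (hA : 0 ≤ A) (hB : 0 ≤ B)
    (hab : ‖a - b‖ ≤ A + B) (hs : 0 ≤ s) (ht : 0 ≤ t) (hst : s + t = 1) :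
    ∃ θ ∈ Icc (0 : ℝ) 1, ∀ H : ℝ, 0 ≤ H →
      H ^ 2 ≤ (1 - θ) * A ^ 2 + θ * B ^ 2 - θ * (1 - θ) * ‖a - b‖ ^ 2 →
      (H + ‖((1 - θ) • a + θ • b) - (s • x + t • y)‖) ^ 2 ≤
        s * (A + ‖a - x‖) ^ 2 + t * (B + ‖b - y‖) ^ 2 - s * t * ‖x - y‖ ^ 2 := by
  rcases hA.eq_or_lt with rfl | hA
  -- the function vanishes at `a`, and the triangle inequality suffices
  · refine ⟨0, by simp, fun H hH hle => ?_⟩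
    obtain rfl : H = 0 := by nlinarith
    have h₁ := norm_sq_combo_sub x y a hst
    have h₂ : ‖y - a‖ ≤ B + ‖b - y‖ := by
      have := norm_sub_le_norm_sub_add_norm_sub y b a
      rw [norm_sub_rev y b, norm_sub_rev b a] at this
      linarith
    have h₃ : ‖y - a‖ ^ 2 ≤ (B + ‖b - y‖) ^ 2 := by gcongr
    simp only [sub_zero, one_smul, zero_smul, add_zero, zero_add]
    rw [norm_sub_rev a, h₁, norm_sub_rev a x]
    nlinarith [mul_le_mul_of_nonneg_left h₃ ht]
  rcases hB.eq_or_lt with rfl | hB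
  -- the function vanishes at `b`
  · refine ⟨1, by simp, fun H hH hle => ?_⟩
    obtain rfl : H = 0 := by nlinarith
    have h₁ := norm_sq_combo_sub x y b hst
    have h₂ : ‖x - b‖ ≤ A + ‖a - x‖ := by
      have := norm_sub_le_norm_sub_add_norm_sub x a b
      rw [norm_sub_rev x a] at this
      linarith
    have h₃ : ‖x - b‖ ^ 2 ≤ (A + ‖a - x‖) ^ 2 := by gcongr
    simp only [sub_self, one_smul, zero_smul, zero_add]
    rw [norm_sub_rev b, h₁, norm_sub_rev b y]
    nlinarith [mul_le_mul_of_nonneg_left h₃ hs]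
  exact exists_combo_sq_le_of_pos a b x y hA hB hs ht hst

end Perspective

/-! ### Stewart's inequality and the crossing of a common face -/

section Stewart

variable {X : Type*} [MetricSpace X]

/-- The CAT(0) inequality for the distance from `p` to the point `m` which divides a geodesic from
`q` to `r` in the ratio `t : 1 - t`. -/
def Stewart (p q r m : X) (t : ℝ) : Prop :=
  dist p m ^ 2 ≤ (1 - t) * dist p q ^ 2 + t * dist p r ^ 2 - t * (1 - t) * dist q r ^ 2

theorem Stewart.symm {p q r m : X} {t : ℝ} (h : Stewart p q r m t) : Stewart p r q m (1 - t) := by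
  unfold Stewart at *
  rw [dist_comm r q]
  linarith

/-- First variation: `z` lies on a minimizing geodesic from `q` to `r`, hence the angle at `z`
between `q` and `a` and the angle between `a` and `r` add up to at least `π`. -/
theorem first_variation {q z r a : X} (hqr : dist q r = dist q z + dist z r)
    (hza : ∀ θ ∈ Icc (0 : ℝ) 1, ∃ y, Stewart q z a y θ ∧ Stewart r z a y θ) :
    (dist q z + dist z r) * (dist z a ^ 2 + dist q z * dist z r) ≤
      dist z r * dist q a ^ 2 + dist q z * dist r a ^ 2 := by
  set s := dist q z with hs
  set t := dist z r with ht
  have hs0 : 0 ≤ s := dist_nonneg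
  have ht0 : 0 ≤ t := dist_nonneg
  -- the points `q` and `r` are joined through a point of the geodesic from `z` to `a`; this point
  -- tends to `z` with `θ`
  have key : ∀ θ ∈ Ioc (0 : ℝ) 1, (s + t) * (dist z a ^ 2 + s * t) ≤
      t * dist q a ^ 2 + s * dist r a ^ 2 + θ * ((s + t) * dist z a ^ 2) := by
    rintro θ ⟨h0, h1⟩
    obtain ⟨y, hy₁, hy₂⟩ := hza θ ⟨h0.le, h1⟩
    unfold Stewart at hy₁ hy₂
    rw [dist_comm r z] at hy₂
    rw [← hs] at hy₁
    rw [← ht] at hy₂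
    have htri : s + t ≤ dist q y + dist r y := by
      rw [← hqr, dist_comm r y]; exact dist_triangle _ _ _
    have h2 : 2 * s * t * (s + t) ≤ t * (s ^ 2 + dist q y ^ 2) + s * (t ^ 2 + dist r y ^ 2) := by
      have := mul_le_mul_of_nonneg_left htri (by positivity : 0 ≤ 2 * s * t)
      nlinarith [mul_nonneg ht0 (sq_nonneg (s - dist q y)),
        mul_nonneg hs0 (sq_nonneg (t - dist r y))]
    have h3 := mul_le_mul_of_nonneg_left hy₁ ht0
    have h4 := mul_le_mul_of_nonneg_left hy₂ hs0
    refine le_of_mul_le_mul_left ?_ h0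
    linarith
  refine le_of_forall_pos_le_add fun ε hε => ?_
  set K := (s + t) * dist z a ^ 2 with hK
  have hK0 : 0 ≤ K := by positivity
  have hpos : 0 < min 1 (ε / (K + 1)) := by positivity
  refine (key _ ⟨hpos, min_le_left _ _⟩).trans ?_
  gcongr
  calc min 1 (ε / (K + 1)) * K ≤ ε / (K + 1) * (K + 1) := by
        gcongr
        · exact min_le_right _ _
        · linarith
    _ = ε := by field_simp

/-- A comparison triangle in the complex plane with a vertex at the origin and another one on the
positive real axis. -/
theorem exists_comparison_vertex {s l d : ℝ} (hs : 0 < s) (h₁ : s ≤ l + d) (h₂ : l ≤ s + d)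
    (h₃ : d ≤ s + l) : ∃ a : ℂ, ‖a‖ ^ 2 = l ^ 2 ∧ ‖(s : ℂ) - a‖ ^ 2 = d ^ 2 ∧
      ∀ t : ℝ, s * ‖a - ((-t : ℝ) : ℂ)‖ ^ 2 = (s + t) * (l ^ 2 + s * t) - t * d ^ 2 := by
  set x := (s ^ 2 + l ^ 2 - d ^ 2) / (2 * s) with hx
  have hxs : 2 * s * x = s ^ 2 + l ^ 2 - d ^ 2 := by rw [hx]; field_simp
  have hle : x ^ 2 ≤ l ^ 2 := by
    have h4 : (2 * s * x) ^ 2 ≤ (2 * s * l) ^ 2 := by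
      rw [hxs]
      nlinarith [mul_nonneg (mul_nonneg (sub_nonneg.2 h₁) (sub_nonneg.2 h₂))
        (mul_nonneg (sub_nonneg.2 h₃) (by linarith : 0 ≤ s + l + d))]
    rw [mul_pow, mul_pow _ l] at h4
    exact le_of_mul_le_mul_left h4 (by positivity)
  have hy : Real.sqrt (l ^ 2 - x ^ 2) ^ 2 = l ^ 2 - x ^ 2 := Real.sq_sqrt (by linarith)
  refine ⟨⟨x, Real.sqrt (l ^ 2 - x ^ 2)⟩, ?_, ?_, fun t => ?_⟩
  · rw [Complex.sq_norm, Complex.normSq_apply]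
    linear_combination hy
  · rw [Complex.sq_norm, Complex.normSq_apply]
    simp only [Complex.sub_re, Complex.ofReal_re, Complex.sub_im, Complex.ofReal_im]
    linear_combination hy - hxs
  · rw [Complex.sq_norm, Complex.normSq_apply]
    simp only [Complex.sub_re, Complex.ofReal_re, Complex.sub_im, Complex.ofReal_im]
    linear_combination s * hy + t * hxs

/-- The gluing step. The point `z` lies on a geodesic from `q` to `r`, and a geodesic from `p` to
`r` passes through `a`. If Stewart's inequality holds on geodesics from `q` to `a` and from `z` to
`a`, then it holds at `z` for the geodesic from `q` to `r`. By the first variation, the distance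
from `a` to `r` is at least the distance from `a` to the point `r'` which extends the side `q z` of
a planar comparison triangle of `q z a`, and `exists_combo_sq_le` applies in that plane. -/
theorem stewart_crossing {p q z r a : X} (hqr : dist q r = dist q z + dist z r)
    (hpr : dist p r = dist p a + dist a r)
    (hqa : ∀ θ ∈ Icc (0 : ℝ) 1, ∃ y, Stewart p q a y θ ∧ Stewart z q a y θ)
    (hza : ∀ θ ∈ Icc (0 : ℝ) 1, ∃ y, Stewart q z a y θ ∧ Stewart r z a y θ) :
    (dist q z + dist z r) * dist p z ^ 2 ≤ dist z r * dist p q ^ 2 + dist q z * dist p r ^ 2 -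
      dist q z * dist z r * (dist q z + dist z r) := by
  have hvar := first_variation hqr hza
  set s := dist q z with hs
  set t := dist z r with ht
  have hs0 : 0 ≤ s := dist_nonneg
  have ht0 : 0 ≤ t := dist_nonneg
  rcases hs0.eq_or_lt with h0 | hs0
  · have : q = z := by rw [← dist_eq_zero, ← hs, ← h0]
    rw [← h0, this]; linarith
  -- in the plane, `q`, `z`, `r` correspond to `s`, `0`, `-t`, and `a` to `a'`
  obtain ⟨a', ha₁, ha₂, ha₃⟩ := exists_comparison_vertex (s := s) (l := dist z a) (d := dist q a)
    hs0
    (by have := dist_triangle q a z; rw [dist_comm a z] at this; linarith)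
    (by have := dist_triangle z q a; rw [dist_comm z q] at this; linarith)
    (by have := dist_triangle q z a; linarith)
  have ha₂' : ‖(s : ℂ) - a'‖ = dist q a := by
    rwa [sq_eq_sq₀ (norm_nonneg _) dist_nonneg] at ha₂
  have har : ‖a' - ((-t : ℝ) : ℂ)‖ ≤ dist a r := by
    refine abs_le_of_sq_le_sq' ?_ dist_nonneg |>.2
    refine le_of_mul_le_mul_left ?_ hs0
    rw [ha₃, dist_comm a r]
    linarith
  have hst : 0 < s + t := by linarith
  have hsum : t / (s + t) + s / (s + t) = 1 := by field_simp; ring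
  obtain ⟨θ, hθ, H⟩ := exists_combo_sq_le (s : ℂ) a' (s : ℂ) ((-t : ℝ) : ℂ) (A := dist p q)
    (B := dist p a) (s := t / (s + t)) (t := s / (s + t)) dist_nonneg dist_nonneg
    (by rw [ha₂', dist_comm p q]; exact dist_triangle _ _ _) (by positivity) (by positivity) hsum
  obtain ⟨y, hy₁, hy₂⟩ := hqa θ hθ
  unfold Stewart at hy₁ hy₂
  have hz : (t / (s + t)) • (s : ℂ) + (s / (s + t)) • ((-t : ℝ) : ℂ) = 0 := by
    rw [Complex.real_smul, Complex.real_smul]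
    push_cast
    ring
  have hH := H (dist p y) dist_nonneg (by rw [ha₂']; exact hy₁)
  rw [hz, sub_zero, sub_self, norm_zero, add_zero] at hH
  have hzy : dist y z ≤ ‖(1 - θ) • (s : ℂ) + θ • a'‖ := by
    refine abs_le_of_sq_le_sq' ?_ (norm_nonneg _) |>.2
    rw [norm_sq_combo _ _ (by ring : 1 - θ + θ = 1), ha₁, ha₂', dist_comm y z]
    have : ‖(s : ℂ)‖ = dist z q := by
      rw [Complex.norm_real, Real.norm_eq_abs, abs_of_pos hs0, hs, dist_comm]
    rw [this]
    linarith
  have hnorm : ‖(s : ℂ) - ((-t : ℝ) : ℂ)‖ = s + t := by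
    rw [← Complex.ofReal_sub, Complex.norm_real, Real.norm_eq_abs, sub_neg_eq_add, abs_of_pos hst]
  have h₁ : dist p z ^ 2 ≤ (dist p y + ‖(1 - θ) • (s : ℂ) + θ • a'‖) ^ 2 := by
    gcongr
    exact (dist_triangle p y z).trans (by linarith)
  have h₂ : (dist p a + ‖a' - ((-t : ℝ) : ℂ)‖) ^ 2 ≤ dist p r ^ 2 := by
    rw [hpr]; gcongr
  have h₃ : dist p z ^ 2 ≤ t / (s + t) * dist p q ^ 2 + s / (s + t) * dist p r ^ 2 -
      t / (s + t) * (s / (s + t)) * (s + t) ^ 2 := by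
    rw [hnorm] at hH
    have : 0 ≤ s / (s + t) := by positivity
    linarith [mul_le_mul_of_nonneg_left h₂ this]
  calc (s + t) * dist p z ^ 2 ≤ _ := mul_le_mul_of_nonneg_left h₃ hst.le
    _ = _ := by field_simp

/-- Stewart's inequality extends from a part of a geodesic to the whole of it. -/
theorem Stewart.of_left {p q z r m : X} {θ τ : ℝ} (hτ : τ ∈ Icc (0 : ℝ) 1)
    (hqr : dist q r = dist q z + dist z r) (hm : Stewart p q z m τ)
    (hθ : θ * dist q r = τ * dist q z) (h0 : 0 < dist q r)
    (hcross : (dist q z + dist z r) * dist p z ^ 2 ≤ dist z r * dist p q ^ 2 +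
      dist q z * dist p r ^ 2 - dist q z * dist z r * (dist q z + dist z r)) :
    Stewart p q r m θ := by
  unfold Stewart at *
  rw [hqr] at *
  set s := dist q z
  set t := dist z r
  refine le_of_mul_le_mul_left ?_ h0
  have h₁ := mul_le_mul_of_nonneg_left hm h0.le
  have h₂ := mul_le_mul_of_nonneg_left hcross hτ.1
  have hθ' : θ * (1 - θ) * (s + t) ^ 2 = τ * s * (s + t) - τ ^ 2 * s ^ 2 := by
    linear_combination (s + t - θ * (s + t) - τ * s) * hθ
  calc _ ≤ _ := h₁
    _ ≤ (s + t - τ * s) * dist p q ^ 2 + τ * s * dist p r ^ 2 -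
        (s + t) * (τ * s * (s + t) - τ ^ 2 * s ^ 2) := by linarith
    _ = _ := by rw [← hθ', ← hθ]; ring

end Stewart

/-! ### Trees of convex sets -/

section CellTree

variable (V X : Type*) [NormedAddCommGroup V] [InnerProductSpace ℝ V] [MetricSpace X]

/-- Convex subsets of `V`, the cells, isometrically embedded into `X`, together with a function `N`
on pairs of cells which plays the part of the distance in a tree. -/
structure Cells where
  Cell : Type*
  dom : Cell → Set V
  map : Cell → V → X
  N : Cell → Cell → ℕ
  convex : ∀ c, Convex ℝ (dom c)
  dist_map : ∀ c, ∀ x ∈ dom c, ∀ y ∈ dom c, dist (map c x) (map c y) = ‖x - y‖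
  N_self : ∀ c, N c c = 0
  eq_of_N_eq_zero : ∀ c e, N c e = 0 → c = e

variable {V X} (T : Cells V X)

/-- `F` is a common face of the cells `c` and `c'`, given in the coordinates of `c'`, and `A`
transforms the coordinates of `c'` into those of `c`. The face separates the cells nearer to `c`
from those nearer to `c'`: geodesics between cells on the two sides pass through it. -/
structure Cells.IsWall (c c' : T.Cell) (F : Set V) (A : V →ᵃ[ℝ] V) : Prop where
  convex : Convex ℝ F
  subset : F ⊆ T.dom c'
  mapsTo : ∀ x ∈ F, A x ∈ T.dom c
  map_eq : ∀ x ∈ F, T.map c (A x) = T.map c' x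
  alternative : ∀ e, T.N e c' = T.N e c + 1 ∨ T.N e c = T.N e c' + 1
  separates : ∀ e e', T.N e c' = T.N e c + 1 → T.N e' c = T.N e' c' + 1 →
    ∀ x ∈ T.dom e, ∀ y ∈ T.dom e', ∃ a ∈ F,
      dist (T.map e x) (T.map e' y) = dist (T.map e x) (T.map c' a) + dist (T.map c' a) (T.map e' y)

variable {T}

theorem Cells.affine_combo (A : V →ᵃ[ℝ] V) (x y : V) (θ : ℝ) :
    A ((1 - θ) • x + θ • y) = (1 - θ) • A x + θ • A y := by
  rw [← AffineMap.lineMap_apply_module, AffineMap.apply_lineMap, AffineMap.lineMap_apply_module]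

/-- Distance functions satisfy Stewart's inequality on segments in cells. -/
theorem Cells.stewart_of_same_cell
    (hT : ∀ e c', T.N e c' ≠ 0 → ∃ c F A, T.IsWall c c' F A ∧ T.N e c' = T.N e c + 1) (n : ℕ) :
    ∀ e c, T.N e c = n → ∀ p ∈ T.dom e, ∀ x ∈ T.dom c, ∀ y ∈ T.dom c, ∀ θ ∈ Icc (0 : ℝ) 1,
      Stewart (T.map e p) (T.map c x) (T.map c y) (T.map c ((1 - θ) • x + θ • y)) θ := by
  induction n with
  | zero =>
    intro e c hec p hp x hx y hy θ hθ
    obtain rfl := T.eq_of_N_eq_zero _ _ hec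
    have hm := T.convex e hx hy (sub_nonneg.2 hθ.2) hθ.1 (by ring : 1 - θ + θ = 1)
    unfold Stewart
    rw [T.dist_map e _ hp _ hm, T.dist_map e _ hp _ hx, T.dist_map e _ hp _ hy,
      T.dist_map e _ hx _ hy, norm_sub_rev p, norm_sq_combo_sub x y p (by ring : 1 - θ + θ = 1),
      norm_sub_rev x p, norm_sub_rev y p]
    apply le_of_eq
    ring
  | succ n ih =>
    intro e c' hec p hp x hx y hy θ hθ
    obtain ⟨c, F, A, hW, hN⟩ := hT e c' (by omega)
    have hcc : T.N c' c = T.N c' c' + 1 := by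
      have := T.N_self c'
      rcases hW.alternative c' with h | h <;> omega
    -- the geodesics from `p` to the end points enter the cell `c'` at points `a`, `b` of a wall
    obtain ⟨a, ha, hax⟩ := hW.separates e c' hN hcc p hp x hx
    obtain ⟨b, hb, hby⟩ := hW.separates e c' hN hcc p hp y hy
    have h1θ : 0 ≤ 1 - θ := sub_nonneg.2 hθ.2
    obtain ⟨η, hη, H⟩ := exists_combo_sq_le a b x y (A := dist (T.map e p) (T.map c' a))
      (B := dist (T.map e p) (T.map c' b)) (s := 1 - θ) (t := θ) dist_nonneg dist_nonneg
      (by rw [← T.dist_map c' _ (hW.subset ha) _ (hW.subset hb), dist_comm (T.map e p)]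
          exact dist_triangle _ _ _) h1θ hθ.1 (by ring)
    have hw := hW.convex ha hb (sub_nonneg.2 hη.2) hη.1 (by ring : 1 - η + η = 1)
    have hm := T.convex c' hx hy h1θ hθ.1 (by ring : 1 - θ + θ = 1)
    -- the segment from `a` to `b` lies in a cell nearer to `e`, too
    have hSt := ih e c (by omega) p hp (A a) (hW.mapsTo a ha) (A b) (hW.mapsTo b hb) η hη
    rw [← Cells.affine_combo, hW.map_eq _ ha, hW.map_eq _ hb, hW.map_eq _ hw] at hSt
    unfold Stewart at hSt ⊢
    rw [T.dist_map c' _ (hW.subset ha) _ (hW.subset hb)] at hSt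
    have hfin := H _ dist_nonneg hSt
    rw [← T.dist_map c' _ (hW.subset ha) _ hx, ← T.dist_map c' _ (hW.subset hb) _ hy,
      ← T.dist_map c' _ (hW.subset hw) _ hm, ← T.dist_map c' _ hx _ hy, ← hax, ← hby] at hfin
    calc _ ≤ _ := pow_le_pow_left₀ dist_nonneg (dist_triangle _ _ _) 2
      _ ≤ _ := hfin
      _ = _ := by ring

/-- Stewart's inequality holds for geodesics between points of arbitrary cells. -/
theorem Cells.exists_stewart
    (hT : ∀ e c', T.N e c' ≠ 0 → ∃ c F A, T.IsWall c c' F A ∧ T.N e c' = T.N e c + 1) (n : ℕ) :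
    ∀ b c, T.N b c = n → ∀ x ∈ T.dom b, ∀ y ∈ T.dom c, ∀ θ ∈ Icc (0 : ℝ) 1,
      ∃ m, ∀ e, ∀ p ∈ T.dom e, Stewart (T.map e p) (T.map b x) (T.map c y) m θ := by
  induction n with
  | zero =>
    intro b c hbc x hx y hy θ hθ
    obtain rfl := T.eq_of_N_eq_zero _ _ hbc
    exact ⟨_, fun e p hp => Cells.stewart_of_same_cell hT _ e b rfl p hp x hx y hy θ hθ⟩
  | succ n ih =>
    intro b c' hbc x hx y hy θ hθ
    obtain ⟨c, F, A, hW, hN⟩ := hT b c' (by omega)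
    have hcc : T.N c' c = T.N c' c' + 1 := by
      have := T.N_self c'
      rcases hW.alternative c' with h | h <;> omega
    -- the geodesic from `x` to `y` crosses a wall at `z`, and `p` lies on one of its two sides
    obtain ⟨z, hz, hxz⟩ := hW.separates b c' hN hcc x hx y hy
    have hbc' : T.N b c = n := by omega
    have hcross : ∀ e, ∀ p ∈ T.dom e,
        (dist (T.map b x) (T.map c' z) + dist (T.map c' z) (T.map c' y)) *
          dist (T.map e p) (T.map c' z) ^ 2 ≤
        dist (T.map c' z) (T.map c' y) * dist (T.map e p) (T.map b x) ^ 2 +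
          dist (T.map b x) (T.map c' z) * dist (T.map e p) (T.map c' y) ^ 2 -
        dist (T.map b x) (T.map c' z) * dist (T.map c' z) (T.map c' y) *
          (dist (T.map b x) (T.map c' z) + dist (T.map c' z) (T.map c' y)) := by
      intro e p hp
      rcases hW.alternative e with h | h
      · obtain ⟨a, ha, hpa⟩ := hW.separates e c' h hcc p hp y hy
        refine stewart_crossing hxz hpa (fun η hη => ?_) fun η hη => ?_
        · obtain ⟨m, hm⟩ := ih b c hbc' x hx (A a) (hW.mapsTo a ha) η hη
          rw [hW.map_eq _ ha] at hm
          exact ⟨m, hm e p hp, hm c' z (hW.subset hz)⟩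
        · exact ⟨_, Cells.stewart_of_same_cell hT _ b c' rfl x hx z (hW.subset hz) a
            (hW.subset ha) η hη, Cells.stewart_of_same_cell hT _ c' c' rfl y hy z (hW.subset hz) a
            (hW.subset ha) η hη⟩
      · obtain ⟨a, ha, hpa⟩ := hW.separates b e hN h x hx p hp
        have := stewart_crossing (p := T.map e p) (q := T.map c' y) (z := T.map c' z)
          (r := T.map b x) (a := T.map c' a)
          (by rw [dist_comm, hxz, dist_comm (T.map c' y), dist_comm (T.map b x), add_comm])
          (by rw [dist_comm, hpa, dist_comm (T.map e p), dist_comm (T.map b x), add_comm])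
          (fun η hη => ⟨_, Cells.stewart_of_same_cell hT _ e c' rfl p hp y hy a
            (hW.subset ha) η hη, Cells.stewart_of_same_cell hT _ c' c' rfl z (hW.subset hz) y hy a
            (hW.subset ha) η hη⟩)
          (fun η hη => ⟨_, Cells.stewart_of_same_cell hT _ c' c' rfl y hy z (hW.subset hz) a
            (hW.subset ha) η hη, Cells.stewart_of_same_cell hT _ b c' rfl x hx z (hW.subset hz) a
            (hW.subset ha) η hη⟩)
        rw [dist_comm (T.map c' y) (T.map c' z), dist_comm (T.map c' z) (T.map b x)] at this
        linarith
    rcases (dist_nonneg (x := T.map b x) (y := T.map c' y)).eq_or_lt with h0 | h0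
    · refine ⟨T.map b x, fun e p _ => ?_⟩
      have := dist_eq_zero.1 h0.symm
      unfold Stewart
      rw [this, dist_self]
      linarith
    -- the dividing point lies before or after `z`
    rcases le_or_gt (θ * dist (T.map b x) (T.map c' y)) (dist (T.map b x) (T.map c' z))
      with hle | hlt
    · obtain ⟨τ, hτ, hτθ⟩ : ∃ τ ∈ Icc (0 : ℝ) 1, θ * dist (T.map b x) (T.map c' y) =
          τ * dist (T.map b x) (T.map c' z) := by
        rcases (dist_nonneg (x := T.map b x) (y := T.map c' z)).eq_or_lt with h1 | h1
        · exact ⟨0, by simp, by rw [← h1] at hle ⊢; linarith [mul_nonneg hθ.1 h0.le]⟩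
        · exact ⟨_, ⟨div_nonneg (mul_nonneg hθ.1 h0.le) h1.le, (div_le_one h1).2 hle⟩,
            by field_simp⟩
      obtain ⟨m, hm⟩ := ih b c hbc' x hx (A z) (hW.mapsTo z hz) τ hτ
      rw [hW.map_eq _ hz] at hm
      exact ⟨m, fun e p hp => Stewart.of_left hτ hxz (hm e p hp) hτθ h0 (hcross e p hp)⟩
    · obtain ⟨τ, hτ, hτθ⟩ : ∃ τ ∈ Icc (0 : ℝ) 1, (1 - θ) * dist (T.map b x) (T.map c' y) =
          τ * dist (T.map c' y) (T.map c' z) := by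
        rw [dist_comm (T.map c' y) (T.map c' z)]
        have h1 : (1 - θ) * dist (T.map b x) (T.map c' y) ≤ dist (T.map c' z) (T.map c' y) := by
          linarith
        rcases (dist_nonneg (x := T.map c' z) (y := T.map c' y)).eq_or_lt with h2 | h2
        · exact ⟨0, by simp, by
            rw [← h2] at h1 ⊢; linarith [mul_nonneg (sub_nonneg.2 hθ.2) h0.le]⟩
        · exact ⟨_, ⟨div_nonneg (mul_nonneg (sub_nonneg.2 hθ.2) h0.le) h2.le, (div_le_one h2).2 h1⟩,
            by field_simp⟩
      refine ⟨T.map c' ((1 - τ) • y + τ • z), fun e p hp => ?_⟩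
      have hm := Cells.stewart_of_same_cell hT _ e c' rfl p hp y hy z (hW.subset hz) τ hτ
      have hrev : dist (T.map c' y) (T.map b x) =
          dist (T.map c' y) (T.map c' z) + dist (T.map c' z) (T.map b x) := by
        rw [dist_comm, hxz, dist_comm (T.map c' y), dist_comm (T.map b x), add_comm]
      have := Stewart.of_left (θ := 1 - θ) hτ hrev hm (by rw [dist_comm (T.map c' y), hτθ])
        (by rwa [dist_comm]) (by
          have := hcross e p hp
          rw [dist_comm (T.map c' y) (T.map c' z), dist_comm (T.map c' z) (T.map b x)]
          linarith)
      simpa using this.symm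

end CellTree

/-! ### From Stewart's inequality to CAT(0) -/

section CAT0

variable {X : Type*} [MetricSpace X]

/-- Stewart points of pairs of points of a dense set yield Stewart points of all pairs. -/
theorem exists_stewart_of_dense [CompleteSpace X] {D : Set X} (hD : Dense D)
    {t : ℝ} (ht : t ∈ Icc (0 : ℝ) 1)
    (h : ∀ q ∈ D, ∀ r ∈ D, ∃ m, ∀ p ∈ D, Stewart p q r m t) (q r : X) :
    ∃ m, ∀ p, Stewart p q r m t := by
  have h' : ∀ q ∈ D, ∀ r ∈ D, ∃ m, ∀ p, Stewart p q r m t := by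
    intro q hq r hr
    obtain ⟨m, hm⟩ := h q hq r hr
    refine ⟨m, fun p => ?_⟩
    have hcl : IsClosed {p | Stewart p q r m t} := isClosed_le (by fun_prop) (by fun_prop)
    exact hcl.closure_subset_iff.2 (fun p hp => hm p hp) (hD p)
  obtain ⟨u, hu, huq⟩ := mem_closure_iff_seq_limit.1 (hD q)
  obtain ⟨v, hv, hvr⟩ := mem_closure_iff_seq_limit.1 (hD r)
  choose m hm using fun n => h' (u n) (hu n) (v n) (hv n)
  -- apply Stewart's inequality for the `n`-th pair to the `k`-th point `m k`
  have hmm : ∀ k n, dist (m k) (m n) ^ 2 ≤ (1 - t) * (t * dist (u k) (v k) + dist (u k) (u n)) ^ 2 +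
      t * ((1 - t) * dist (u k) (v k) + dist (v k) (v n)) ^ 2 -
        t * (1 - t) * dist (u n) (v n) ^ 2 := by
    intro k n
    have h1 : dist (m k) (u k) ≤ t * dist (u k) (v k) := by
      have := hm k (u k)
      unfold Stewart at this
      rw [dist_self] at this
      rw [dist_comm]
      refine abs_le_of_sq_le_sq' ?_ (mul_nonneg ht.1 dist_nonneg) |>.2
      nlinarith
    have h2 : dist (m k) (v k) ≤ (1 - t) * dist (u k) (v k) := by
      have := hm k (v k)
      unfold Stewart at this
      rw [dist_self, dist_comm (v k) (u k)] at this
      rw [dist_comm]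
      refine abs_le_of_sq_le_sq' ?_ (mul_nonneg (sub_nonneg.2 ht.2) dist_nonneg) |>.2
      nlinarith
    have h3 := hm n (m k)
    unfold Stewart at h3
    have h4 : dist (m k) (u n) ^ 2 ≤ (t * dist (u k) (v k) + dist (u k) (u n)) ^ 2 := by
      gcongr
      exact (dist_triangle _ _ _).trans (by gcongr)
    have h5 : dist (m k) (v n) ^ 2 ≤ ((1 - t) * dist (u k) (v k) + dist (v k) (v n)) ^ 2 := by
      gcongr
      exact (dist_triangle _ _ _).trans (by gcongr)
    have h6 := mul_le_mul_of_nonneg_left h4 (sub_nonneg.2 ht.2)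
    have h7 := mul_le_mul_of_nonneg_left h5 ht.1
    linarith
  have hcau : CauchySeq m := by
    rw [cauchySeq_iff_tendsto_dist_atTop_0]
    have hlim : Tendsto (fun i : ℕ × ℕ => (1 - t) * (t * dist (u i.1) (v i.1) +
        dist (u i.1) (u i.2)) ^ 2 + t * ((1 - t) * dist (u i.1) (v i.1) +
        dist (v i.1) (v i.2)) ^ 2 - t * (1 - t) * dist (u i.2) (v i.2) ^ 2) atTop
        (𝓝 ((1 - t) * (t * dist q r + dist q q) ^ 2 + t * ((1 - t) * dist q r +
        dist r r) ^ 2 - t * (1 - t) * dist q r ^ 2)) := by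
      rw [← prod_atTop_atTop_eq]
      have a1 := huq.comp (tendsto_fst (f := (atTop : Filter ℕ)) (g := (atTop : Filter ℕ)))
      have a2 := huq.comp (tendsto_snd (f := (atTop : Filter ℕ)) (g := (atTop : Filter ℕ)))
      have b1 := hvr.comp (tendsto_fst (f := (atTop : Filter ℕ)) (g := (atTop : Filter ℕ)))
      have b2 := hvr.comp (tendsto_snd (f := (atTop : Filter ℕ)) (g := (atTop : Filter ℕ)))
      exact ((((a1.dist b1).const_mul t).add (a1.dist a2)).pow 2 |>.const_mul (1 - t)).add
        ((((a1.dist b1).const_mul (1 - t)).add (b1.dist b2)).pow 2 |>.const_mul t) |>.sub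
        (((a2.dist b2).pow 2).const_mul (t * (1 - t)))
    have hzero : (1 - t) * (t * dist q r + dist q q) ^ 2 + t * ((1 - t) * dist q r +
        dist r r) ^ 2 - t * (1 - t) * dist q r ^ 2 = 0 := by
      rw [dist_self, dist_self]; ring
    rw [hzero] at hlim
    have hsq : Tendsto (fun i : ℕ × ℕ => dist (m i.1) (m i.2) ^ 2) atTop (𝓝 0) :=
      squeeze_zero (fun _ => sq_nonneg _) (fun i => hmm i.1 i.2) hlim
    have := hsq.sqrt
    simpa [Real.sqrt_sq dist_nonneg] using this
  obtain ⟨m', hm'⟩ := cauchySeq_tendsto_of_complete hcau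
  refine ⟨m', fun p => ?_⟩
  have hp : Tendsto (fun _ : ℕ => p) atTop (𝓝 p) := tendsto_const_nhds
  refine le_of_tendsto_of_tendsto' ((hp.dist hm').pow 2)
    ((((hp.dist huq).pow 2).const_mul (1 - t)).add (((hp.dist hvr).pow 2).const_mul t) |>.sub
      (((huq.dist hvr).pow 2).const_mul (t * (1 - t)))) fun n => hm n p

/-- A complete space is CAT(0) if any two points have, for each ratio, a point between them which
satisfies Stewart's inequality. Such points form a geodesic, which is the only one, and the
inequality applied twice compares points on two sides of a triangle. -/
theorem isCAT0_of_stewart [CompleteSpace X]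
    (h : ∀ t ∈ Icc (0 : ℝ) 1, ∀ q r : X, ∃ m, ∀ p, Stewart p q r m t) : IsCAT0 X := by
  have hgeo : ∀ {γ : ℝ → X} {x y : X}, IsGeodesic γ x y → ∀ s ∈ Icc (0 : ℝ) 1,
      ∀ t ∈ Icc (0 : ℝ) 1, dist (γ s) (γ t) = |s - t| * dist x y := by
    intro γ x y hγ s hs t ht
    have := hγ.edist_eq s hs t ht
    rw [edist_dist, edist_dist, ← ENNReal.ofReal_mul (abs_nonneg _),
      ENNReal.ofReal_eq_ofReal_iff dist_nonneg (by positivity)] at this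
    exact this
  -- a point of a geodesic is the Stewart point of the end points
  have hpt : ∀ {γ : ℝ → X} {x y : X}, IsGeodesic γ x y → ∀ t ∈ Icc (0 : ℝ) 1,
      ∀ p, Stewart p x y (γ t) t := by
    intro γ x y hγ t ht
    obtain ⟨m, hm⟩ := h t ht x y
    have h0 := hgeo hγ t ht 0 (by simp)
    have h1 := hgeo hγ t ht 1 (by simp)
    rw [hγ.source, sub_zero, abs_of_nonneg ht.1] at h0
    rw [hγ.target, abs_sub_comm, abs_of_nonneg (sub_nonneg.2 ht.2)] at h1
    have hγm := hm (γ t)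
    unfold Stewart at hγm
    rw [h0, h1] at hγm
    have : dist (γ t) m = 0 := by
      have : dist (γ t) m ^ 2 ≤ 0 := by nlinarith
      exact pow_eq_zero_iff two_ne_zero |>.1 (le_antisymm this (sq_nonneg _))
    rw [dist_eq_zero.1 this]
    exact hm
  refine ⟨inferInstance, fun x y => edist_ne_top x y, fun x y => ?_, ?_⟩
  · have hex : ∀ t : ℝ, ∃ m, t ∈ Icc (0 : ℝ) 1 → ∀ p, Stewart p x y m t := by
      intro t
      by_cases ht : t ∈ Icc (0 : ℝ) 1
      · obtain ⟨m, hm⟩ := h t ht x y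
        exact ⟨m, fun _ => hm⟩
      · exact ⟨x, fun h => absurd h ht⟩
    choose γ hγ using hex
    have hx : ∀ t ∈ Icc (0 : ℝ) 1, dist x (γ t) ≤ t * dist x y := by
      intro t ht
      have := hγ t ht x
      unfold Stewart at this
      rw [dist_self] at this
      refine abs_le_of_sq_le_sq' ?_ (mul_nonneg ht.1 dist_nonneg) |>.2
      nlinarith
    have hy : ∀ t ∈ Icc (0 : ℝ) 1, dist y (γ t) ≤ (1 - t) * dist x y := by
      intro t ht
      have := hγ t ht y
      unfold Stewart at this
      rw [dist_self, dist_comm y x] at this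
      refine abs_le_of_sq_le_sq' ?_ (mul_nonneg (sub_nonneg.2 ht.2) dist_nonneg) |>.2
      nlinarith
    have hle : ∀ s ∈ Icc (0 : ℝ) 1, ∀ t ∈ Icc (0 : ℝ) 1,
        dist (γ s) (γ t) ≤ |s - t| * dist x y := by
      intro s hs t ht
      have h1 := hγ t ht (γ s)
      unfold Stewart at h1
      have h2 := hx s hs
      have h3 := hy s hs
      rw [dist_comm] at h2 h3
      have h4 : dist (γ s) x ^ 2 ≤ (s * dist x y) ^ 2 := by gcongr
      have h5 : dist (γ s) y ^ 2 ≤ ((1 - s) * dist x y) ^ 2 := by gcongr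
      refine abs_le_of_sq_le_sq' ?_ (by positivity) |>.2
      rw [mul_pow, sq_abs]
      have h6 := mul_le_mul_of_nonneg_left h4 (sub_nonneg.2 ht.2)
      have h7 := mul_le_mul_of_nonneg_left h5 ht.1
      linarith
    have heq : ∀ s ∈ Icc (0 : ℝ) 1, ∀ t ∈ Icc (0 : ℝ) 1, s ≤ t →
        dist (γ s) (γ t) = |s - t| * dist x y := by
      intro s hs t ht hst
      refine le_antisymm (hle s hs t ht) ?_
      have h1 := hx s hs
      have h2 := hy t ht
      have h3 := dist_triangle4 x (γ s) (γ t) y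
      rw [dist_comm (γ t) y] at h3
      rw [abs_sub_comm, abs_of_nonneg (sub_nonneg.2 hst)]
      linarith
    refine ⟨γ, ?_, ?_, fun s hs t ht => ?_⟩
    · have := hx 0 (by simp)
      rw [zero_mul] at this
      exact (dist_le_zero.1 this).symm
    · have := hy 1 (by simp)
      rw [sub_self, zero_mul] at this
      exact (dist_le_zero.1 this).symm
    · rw [edist_dist, edist_dist, ← ENNReal.ofReal_mul (abs_nonneg _)]
      congr 1
      rcases le_total s t with hst | hst
      · exact heq s hs t ht hst
      · rw [dist_comm, abs_sub_comm]
        exact heq t ht s hs hst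
  · intro p q r γ η hγ hη p' q' r' hpq hqr hrp s hs t ht
    have e₁ : dist p' q' = dist p q := by
      rw [edist_dist, edist_dist, ENNReal.ofReal_eq_ofReal_iff dist_nonneg dist_nonneg] at hpq
      exact hpq
    have e₂ : dist q' r' = dist q r := by
      rw [edist_dist, edist_dist, ENNReal.ofReal_eq_ofReal_iff dist_nonneg dist_nonneg] at hqr
      exact hqr
    have e₃ : dist r' p' = dist r p := by
      rw [edist_dist, edist_dist, ENNReal.ofReal_eq_ofReal_iff dist_nonneg dist_nonneg] at hrp
      exact hrp
    rw [edist_dist, edist_dist]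
    refine ENNReal.ofReal_le_ofReal (abs_le_of_sq_le_sq' ?_ dist_nonneg |>.2)
    have h1 := hpt hη t ht (γ s)
    have h2 := hpt hγ s hs r
    have h3 := hgeo hγ s hs 0 (by simp)
    rw [hγ.source, sub_zero, abs_of_nonneg hs.1, dist_comm] at h3
    unfold Stewart at h1 h2
    rw [dist_comm (γ s) p] at h1
    have hE : dist (AffineMap.lineMap p' q' s) (AffineMap.lineMap p' r' t) ^ 2 =
        (1 - t) * (s * dist p q) ^ 2 + t * ((1 - s) * dist r p ^ 2 + s * dist q r ^ 2 -
          s * (1 - s) * dist p q ^ 2) - t * (1 - t) * dist r p ^ 2 := by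
      rw [← e₁, ← e₂, ← e₃, dist_comm q' r', dist_comm p' q', dist_eq_norm q' p',
        dist_eq_norm r' q', dist_eq_norm r' p', AffineMap.lineMap_apply_module,
        AffineMap.lineMap_apply_module, dist_comm, dist_eq_norm,
        norm_sq_combo_sub p' r' _ (by ring), norm_sub_rev p' (_ + _),
        norm_sub_rev r' (_ + _), norm_sq_combo_sub p' q' p' (by ring),
        norm_sq_combo_sub p' q' r' (by ring), sub_self, norm_zero, norm_sub_rev q' r',
        norm_sub_rev p' r', norm_sub_rev p' q']
      ring
    rw [hE]
    rw [dist_comm (γ s) r, h3, dist_comm p r] at h1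
    rw [dist_comm r q] at h2
    linarith [mul_le_mul_of_nonneg_left h2 ht.1]

end CAT0

/-- A complete space with a dense union of cells which are arranged like a tree is CAT(0). -/
theorem Cells.isCAT0 {V X : Type*} [NormedAddCommGroup V] [InnerProductSpace ℝ V] [MetricSpace X]
    [CompleteSpace X] (T : Cells V X)
    (hT : ∀ e c', T.N e c' ≠ 0 → ∃ c F A, T.IsWall c c' F A ∧ T.N e c' = T.N e c + 1)
    (hD : Dense (⋃ c, T.map c '' T.dom c)) : IsCAT0 X := by
  refine isCAT0_of_stewart fun t ht => exists_stewart_of_dense hD ht ?_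
  intro q hq r hr
  obtain ⟨b, x, hx, rfl⟩ := mem_iUnion.1 hq
  obtain ⟨c, y, hy, rfl⟩ := mem_iUnion.1 hr
  obtain ⟨m, hm⟩ := Cells.exists_stewart hT _ b c rfl x hx y hy t ht
  refine ⟨m, fun p hp => ?_⟩
  obtain ⟨e, z, hz, rfl⟩ := mem_iUnion.1 hp
  exact hm e z hz

/-! ### The metric completion -/

section Completion

variable {X : Type*} [PseudoEMetricSpace X]

/-- The constant Cauchy sequence. -/
noncomputable def constSeq (x : X) : CauchySequences X :=
  ⟨fun _ => x, cauchySeq_const x⟩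

/-- The canonical map from a space to its completion. -/
noncomputable def toCompletion (x : X) : MetricCompletion X :=
  SeparationQuotient.mk (constSeq x)

theorem edist_constSeq (x y : X) : edist (constSeq x) (constSeq y) = edist x y :=
  limsup_const (f := atTop) (edist x y)

theorem edist_toCompletion (x y : X) : edist (toCompletion x) (toCompletion y) = edist x y := by
  rw [toCompletion, toCompletion, SeparationQuotient.edist_mk, edist_constSeq]

theorem exists_edist_constSeq_lt (u : CauchySequences X) {ε : ℝ≥0∞} (hε : 0 < ε) :
    ∃ x, edist u (constSeq x) < ε := by
  obtain ⟨δ, hδ, hδε⟩ := exists_between hε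
  obtain ⟨N, hN⟩ := EMetric.cauchySeq_iff.1 u.2 δ hδ
  refine ⟨u.1 N, lt_of_le_of_lt ?_ hδε⟩
  refine limsup_le_of_le (h := ?_)
  filter_upwards [eventually_ge_atTop N] with n hn
  exact (hN n hn N le_rfl).le

theorem denseRange_toCompletion : DenseRange (toCompletion (X := X)) := by
  have h : DenseRange (constSeq (X := X)) := by
    intro u
    refine EMetric.mem_closure_iff.2 fun ε hε => ?_
    obtain ⟨x, hx⟩ := exists_edist_constSeq_lt u hε
    exact ⟨_, ⟨x, rfl⟩, hx⟩
  exact SeparationQuotient.surjective_mk.denseRange.comp h SeparationQuotient.continuous_mk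

instance completeSpace_cauchySequences : CompleteSpace (CauchySequences X) := by
  refine EMetric.complete_of_cauchySeq_tendsto fun U hU => ?_
  choose x hx using fun n : ℕ => exists_edist_constSeq_lt (U n) (ε := (n + 1 : ℝ≥0∞)⁻¹) (by simp)
  have hlim : Tendsto (fun n : ℕ => (n + 1 : ℝ≥0∞)⁻¹) atTop (𝓝 0) := by
    have := (tendsto_add_atTop_iff_nat 1).2 ENNReal.tendsto_inv_nat_nhds_zero
    simpa using this
  have hzero : Tendsto (fun n => edist (U n) (constSeq (x n))) atTop (𝓝 0) :=
    tendsto_of_tendsto_of_tendsto_of_le_of_le tendsto_const_nhds hlim (fun _ => bot_le)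
      fun n => (hx n).le
  have hxc : CauchySeq x := by
    refine EMetric.cauchySeq_iff.2 fun ε hε => ?_
    have hε3 : 0 < ε / 3 := ENNReal.div_pos hε.ne' (by simp)
    obtain ⟨N, hN⟩ := EMetric.cauchySeq_iff.1 hU (ε / 3) hε3
    obtain ⟨M, hM⟩ := eventually_atTop.1 (hzero.eventually (gt_mem_nhds hε3))
    refine ⟨max N M, fun m hm n hn => ?_⟩
    rw [← edist_constSeq]
    calc _ ≤ edist (constSeq (x m)) (U m) + edist (U m) (U n) + edist (U n) (constSeq (x n)) :=
          edist_triangle4 _ _ _ _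
      _ < ε / 3 + ε / 3 + ε / 3 := by
          refine ENNReal.add_lt_add (ENNReal.add_lt_add ?_ ?_) (hM n (le_of_max_le_right hn))
          · rw [edist_comm]
            exact hM m (le_of_max_le_right hm)
          · exact hN m (le_of_max_le_left hm) n (le_of_max_le_left hn)
      _ = ε := ENNReal.add_thirds ε
  refine ⟨⟨x, hxc⟩, tendsto_iff_edist_tendsto_0.2 ?_⟩
  have hx' : Tendsto (fun n => edist (constSeq (x n)) (⟨x, hxc⟩ : CauchySequences X)) atTop
      (𝓝 0) := by
    refine ENNReal.tendsto_nhds_zero.2 fun ε hε => ?_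
    obtain ⟨N, hN⟩ := EMetric.cauchySeq_iff.1 hxc ε hε
    filter_upwards [eventually_ge_atTop N] with n hn
    refine limsup_le_of_le (h := ?_)
    filter_upwards [eventually_ge_atTop N] with k hk
    exact (hN n hn k hk).le
  refine tendsto_of_tendsto_of_tendsto_of_le_of_le tendsto_const_nhds
    (by simpa using hzero.add hx') (fun _ => bot_le) fun n => edist_triangle _ _ _

end Completion

/-- An isometric embedding of a set into a complete space extends to the closure. -/
theorem exists_isometric_extension {E X : Type*} [PseudoMetricSpace E] [MetricSpace X]
    [CompleteSpace X] {S : Set E} {f : E → X}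
    (h : ∀ x ∈ S, ∀ y ∈ S, dist (f x) (f y) = dist x y) :
    ∃ g : E → X, (∀ x ∈ S, g x = f x) ∧
      ∀ x ∈ closure S, ∀ y ∈ closure S, dist (g x) (g y) = dist x y := by
  have hu : UniformContinuousOn f S := by
    refine Metric.uniformContinuousOn_iff.2 fun ε hε => ⟨ε, hε, fun x hx y hy hxy => ?_⟩
    rwa [h x hx y hy]
  have hlim : ∀ x ∈ closure S, Tendsto f (𝓝[S] x) (𝓝 (extendFrom S f x)) := by
    intro x hx
    have := mem_closure_iff_nhdsWithin_neBot.1 hx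
    refine tendsto_extendFrom (CompleteSpace.complete ?_)
    exact (cauchy_nhds.mono' this inf_le_left).map_of_le hu (le_principal_iff.2 self_mem_nhdsWithin)
  refine ⟨extendFrom S f, fun x hx => ?_, fun x hx y hy => ?_⟩
  · exact extendFrom_eq (subset_closure hx) (hu.continuousOn x hx)
  · have := mem_closure_iff_nhdsWithin_neBot.1 hx
    have := mem_closure_iff_nhdsWithin_neBot.1 hy
    have h₁ : Tendsto (fun p : E × E => dist (f p.1) (f p.2)) (𝓝[S] x ×ˢ 𝓝[S] y)
        (𝓝 (dist (extendFrom S f x) (extendFrom S f y))) :=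
      ((hlim x hx).comp tendsto_fst).dist ((hlim y hy).comp tendsto_snd)
    have h₂ : Tendsto (fun p : E × E => dist p.1 p.2) (𝓝[S] x ×ˢ 𝓝[S] y) (𝓝 (dist x y)) :=
      ((tendsto_id.mono_left inf_le_left).comp tendsto_fst).dist
        ((tendsto_id.mono_left inf_le_left).comp tendsto_snd)
    refine tendsto_nhds_unique (h₁.congr' ?_) h₂
    filter_upwards [prod_mem_prod (self_mem_nhdsWithin (s := S) (a := x))
      (self_mem_nhdsWithin (s := S) (a := y))] with p hp
    exact h _ hp.1 _ hp.2

/-! ### Extension of isometries -/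

/-- Isometric embeddings of subsets of a Euclidean space extend to the whole space. -/
theorem exists_affineIsometryEquiv_of_isometric {E : Type*} [NormedAddCommGroup E]
    [InnerProductSpace ℝ E] [FiniteDimensional ℝ E] {s : Set E} {g : E → E}
    (hg : ∀ x ∈ s, ∀ y ∈ s, dist (g x) (g y) = dist x y) :
    ∃ A : E ≃ᵃⁱ[ℝ] E, ∀ x ∈ s, A x = g x := by
  rcases s.eq_empty_or_nonempty with rfl | ⟨x₀, hx₀⟩
  · exact ⟨AffineIsometryEquiv.refl ℝ E, by simp⟩
  let T₁ : (s →₀ ℝ) →ₗ[ℝ] E := Finsupp.linearCombination ℝ fun x : s => (x : E) - x₀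
  let T₂ : (s →₀ ℝ) →ₗ[ℝ] E := Finsupp.linearCombination ℝ fun x : s => g x - g x₀
  have hinner : ∀ x y : s, inner ℝ (g x - g x₀) (g y - g x₀) = inner ℝ ((x : E) - x₀) (y - x₀) := by
    intro x y
    have h (u v : E) : inner ℝ u v = (‖u‖ ^ 2 + ‖v‖ ^ 2 - ‖u - v‖ ^ 2) / 2 := by
      rw [norm_sub_sq_real]; ring
    rw [h, h, sub_sub_sub_cancel_right, sub_sub_sub_cancel_right, ← dist_eq_norm, ← dist_eq_norm,
      ← dist_eq_norm, ← dist_eq_norm, ← dist_eq_norm, ← dist_eq_norm, hg _ x.2 _ hx₀,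
      hg _ y.2 _ hx₀, hg _ x.2 _ y.2]
  -- the Gram matrices agree, so `T₁ c ↦ T₂ c` is a well-defined isometry
  have hnorm : ∀ c, ‖T₂ c‖ = ‖T₁ c‖ := by
    intro c
    rw [← sq_eq_sq₀ (norm_nonneg _) (norm_nonneg _), ← real_inner_self_eq_norm_sq,
      ← real_inner_self_eq_norm_sq]
    simp only [T₁, T₂, Finsupp.linearCombination_apply, Finsupp.sum, sum_inner, inner_sum,
      real_inner_smul_left, real_inner_smul_right, hinner]
  obtain ⟨σ, hσ⟩ := T₁.rangeRestrict.exists_rightInverse_of_surjective T₁.range_rangeRestrict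
  have hσ' : ∀ y : T₁.range, T₁ (σ y) = y := by
    intro y
    have := LinearMap.congr_fun hσ y
    exact congrArg Subtype.val this
  let L₀ : T₁.range →ₗᵢ[ℝ] E :=
    ⟨T₂ ∘ₗ σ, fun y => by rw [LinearMap.comp_apply, hnorm, hσ']; rfl⟩
  have hL₀ : ∀ x : s, ∀ h : (x : E) - x₀ ∈ T₁.range, L₀ ⟨(x : E) - x₀, h⟩ = g x - g x₀ := by
    intro x h
    have h₁ : T₁ (σ ⟨(x : E) - x₀, h⟩ - Finsupp.single x 1) = 0 := by
      rw [map_sub, hσ']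
      simp [T₁]
    have h₂ : T₂ (σ ⟨(x : E) - x₀, h⟩ - Finsupp.single x 1) = 0 := by
      rw [← norm_eq_zero, hnorm, h₁, norm_zero]
    rw [map_sub, sub_eq_zero] at h₂
    change T₂ (σ _) = _
    rw [h₂]
    simp [T₂]
  let L := L₀.extend.toLinearIsometryEquiv rfl
  refine ⟨((AffineIsometryEquiv.vaddConst ℝ x₀).symm.trans L.toAffineIsometryEquiv).trans
    (AffineIsometryEquiv.vaddConst ℝ (g x₀)), fun x hx => ?_⟩
  have hmem : x - x₀ ∈ T₁.range := ⟨Finsupp.single ⟨x, hx⟩ 1, by simp [T₁]⟩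
  have h₃ : L₀.extend (x - x₀) = g x - g x₀ := by
    rw [← hL₀ ⟨x, hx⟩ hmem]
    exact L₀.extend_apply ⟨x - x₀, hmem⟩
  change L₀.extend (x - x₀) + g x₀ = g x
  rw [h₃, sub_add_cancel]

/-! ### Faces of convex polyhedra -/

section Polyhedra

section Cone

variable {E : Type*} [NormedAddCommGroup E] [InnerProductSpace ℝ E] [FiniteDimensional ℝ E]
  {κ : Type*} {a : κ → E}

theorem finrank_span_image_mono {B B' : Set κ} (h : B ⊆ B') :
    Module.finrank ℝ (Submodule.span ℝ (a '' B)) ≤ Module.finrank ℝ (Submodule.span ℝ (a '' B')) :=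
  Submodule.finrank_mono (Submodule.span_mono (image_mono h))

omit [FiniteDimensional ℝ E] in
theorem inner_eq_zero_of_mem_span {B : Set κ} {u z : E} (h : ∀ k ∈ B, inner ℝ (a k) u = 0)
    (hz : z ∈ Submodule.span ℝ (a '' B)) : inner ℝ z u = 0 := by
  induction hz using Submodule.span_induction with
  | mem x hx => obtain ⟨k, hk, rfl⟩ := hx; exact h k hk
  | zero => simp
  | add x y _ _ hx hy => rw [inner_add_left, hx, hy, add_zero]
  | smul c x _ hx => rw [real_inner_smul_left, hx, mul_zero]

/-- A polyhedral cone has an extreme ray, modulo its lineality space: some point of the cone, at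
which not all constraints are active, has active constraints of corank one. -/
theorem exists_active_corank_one {B : Set κ} (hB : B.Finite) {o : E}
    (ho : ∀ k ∈ B, inner ℝ (a k) o < 0) (hne : B.Nonempty) :
    ∃ u, (∀ k ∈ B, inner ℝ (a k) u ≤ 0) ∧
      Module.finrank ℝ (Submodule.span ℝ (a '' {k ∈ B | inner ℝ (a k) u = 0})) + 1 =
        Module.finrank ℝ (Submodule.span ℝ (a '' B)) := by
  set S := Submodule.span ℝ (a '' B) with hS
  have haS : ∀ k ∈ B, a k ∈ S := fun k hk => Submodule.subset_span ⟨k, hk, rfl⟩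
  let r : E → ℕ := fun u =>
    Module.finrank ℝ (Submodule.span ℝ (a '' {k ∈ B | inner ℝ (a k) u = 0}))
  let good : E → Prop := fun u => u ∈ S ∧ (∀ k ∈ B, inner ℝ (a k) u ≤ 0) ∧
    ∃ k ∈ B, inner ℝ (a k) u < 0
  have hrS : ∀ u, r u ≤ Module.finrank ℝ S := fun u => finrank_span_image_mono (sep_subset _ _)
  have hgood : ∃ u, good u := by
    have hproj : ∀ k ∈ B, inner ℝ (a k) (S.starProjection o) = inner ℝ (a k) o := by
      intro k hk
      have := S.starProjection_inner_eq_zero o (a k) (haS k hk)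
      rw [real_inner_comm, inner_sub_right, sub_eq_zero] at this
      exact this.symm
    obtain ⟨k, hk⟩ := hne
    exact ⟨S.starProjection o, S.starProjection_apply_mem o,
      fun k hk => by rw [hproj k hk]; exact (ho k hk).le, k, hk, by rw [hproj k hk]; exact ho k hk⟩
  -- a good point with the largest number of independent active constraints
  obtain ⟨u, ⟨huS, hu, k₀, hk₀, hk₀u⟩, hmax⟩ : ∃ u, good u ∧ ∀ u', good u' → r u' ≤ r u := by
    have hfin : (r '' {u | good u}).Finite :=
      (finite_Iic (Module.finrank ℝ S)).subset (by rintro _ ⟨u, -, rfl⟩; exact hrS u)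
    obtain ⟨_, ⟨u, hu, rfl⟩, hmax⟩ := hfin.exists_maximal (Set.Nonempty.image _ hgood)
    exact ⟨u, hu, fun u' hu' => by
      by_contra hlt
      push Not at hlt
      exact absurd (hmax ⟨u', hu', rfl⟩ hlt.le) (not_le.2 hlt)⟩
  refine ⟨u, hu, ?_⟩
  set B' := {k ∈ B | inner ℝ (a k) u = 0} with hB'
  set S' := Submodule.span ℝ (a '' B') with hS'
  have hS'S : S' ≤ S := Submodule.span_mono (image_mono (sep_subset _ _))
  have huS' : ∀ z ∈ S', inner ℝ z u = 0 := fun z hz =>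
    inner_eq_zero_of_mem_span (fun k hk => hk.2) hz
  have hlt : Module.finrank ℝ S' < Module.finrank ℝ S := by
    refine lt_of_le_of_ne (Submodule.finrank_mono hS'S) fun heq => ?_
    have := Submodule.eq_of_le_of_finrank_eq hS'S heq
    have h1 := huS' (a k₀) (this ▸ haS k₀ hk₀)
    linarith
  by_contra hne'
  have h2 : Module.finrank ℝ S' + 2 ≤ Module.finrank ℝ S := by omega
  -- a direction in `S` orthogonal to the active constraints and independent of `u`
  obtain ⟨w, hwS, hwS', hwu⟩ : ∃ w ∈ S, (∀ z ∈ S', inner ℝ z w = 0) ∧ w ∉ ℝ ∙ u := by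
    by_contra hcon
    push Not at hcon
    have hle : S ≤ S' ⊔ (ℝ ∙ u) := by
      intro z hz
      have hp := S'.starProjection_apply_mem z
      have hq : z - S'.starProjection z ∈ ℝ ∙ u := by
        refine hcon _ (S.sub_mem hz (hS'S hp)) fun y hy => ?_
        rw [real_inner_comm]
        exact S'.starProjection_inner_eq_zero z y hy
      have := Submodule.add_mem_sup hp hq
      rwa [add_sub_cancel] at this
    have h3 := Submodule.finrank_mono hle
    have h4 := Submodule.finrank_add_le_finrank_add_finrank S' (ℝ ∙ u)
    have hu0 : u ≠ 0 := by
      rintro rfl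
      rw [inner_zero_right] at hk₀u
      exact lt_irrefl _ hk₀u
    have h5 := finrank_span_singleton (K := ℝ) hu0
    omega
  have hw0 : ∃ k ∈ B, inner ℝ (a k) w ≠ 0 := by
    by_contra hcon
    push Not at hcon
    have : inner ℝ w w = 0 := inner_eq_zero_of_mem_span hcon hwS
    rw [inner_self_eq_zero] at this
    exact hwu (this ▸ Submodule.zero_mem _)
  wlog hpos : ∃ k ∈ B, 0 < inner ℝ (a k) w generalizing w
  · obtain ⟨k, hk, hkw⟩ := hw0
    push Not at hpos
    have hkw' := lt_of_le_of_ne (hpos k hk) hkw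
    refine this (-w) (S.neg_mem hwS) (fun z hz => by rw [inner_neg_right, hwS' z hz, neg_zero])
      (fun h => hwu (by simpa using Submodule.neg_mem _ h)) ⟨k, hk, ?_⟩ ⟨k, hk, ?_⟩
    · rw [inner_neg_right]; linarith
    · rw [inner_neg_right]; linarith
  -- move in the direction `w` until one more constraint is active; this contradicts maximality
  obtain ⟨k₁, ⟨hk₁, hk₁w⟩, hmin⟩ := (hB.subset (sep_subset B fun k => 0 < inner ℝ (a k) w)
    ).exists_minimalFor (fun k => -inner ℝ (a k) u / inner ℝ (a k) w) _ hpos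
  set t := -inner ℝ (a k₁) u / inner ℝ (a k₁) w with ht
  have ht0 : 0 ≤ t := div_nonneg (neg_nonneg.2 (hu k₁ hk₁)) hk₁w.le
  have hle : ∀ k ∈ B, inner ℝ (a k) (u + t • w) ≤ 0 := by
    intro k hk
    rw [inner_add_right, real_inner_smul_right]
    rcases le_or_gt (inner ℝ (a k) w) 0 with h | h
    · nlinarith [hu k hk]
    · have h3 : t ≤ -inner ℝ (a k) u / inner ℝ (a k) w := by
        by_contra hlt'
        push Not at hlt'
        exact absurd (hmin ⟨hk, h⟩ hlt'.le) (not_le.2 hlt')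
      rw [le_div_iff₀ h] at h3
      linarith
  have hk₁z : inner ℝ (a k₁) (u + t • w) = 0 := by
    rw [inner_add_right, real_inner_smul_right, ht, div_mul_cancel₀ _ hk₁w.ne']
    ring
  have huS2 : u + t • w ∈ S := S.add_mem huS (S.smul_mem t hwS)
  have hgood' : good (u + t • w) := by
    refine ⟨huS2, hle, ?_⟩
    by_contra hcon
    push Not at hcon
    have h3 : inner ℝ (u + t • w) (u + t • w) = 0 :=
      inner_eq_zero_of_mem_span (fun k hk => le_antisymm (hle k hk) (hcon k hk)) huS2
    rw [inner_self_eq_zero] at h3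
    rcases ht0.eq_or_lt with h0 | h0
    · rw [← h0, zero_smul, add_zero] at h3
      rw [h3, inner_zero_right] at hk₀u
      exact lt_irrefl _ hk₀u
    · refine hwu (Submodule.mem_span_singleton.2 ⟨-t⁻¹, ?_⟩)
      have : u = -(t • w) := eq_neg_of_add_eq_zero_left h3
      rw [this, smul_neg, neg_smul, neg_neg, smul_smul, inv_mul_cancel₀ h0.ne', one_smul]
  have hmax' := hmax _ hgood'
  have hsub : S' ⊔ (ℝ ∙ a k₁) ≤
      Submodule.span ℝ (a '' {k ∈ B | inner ℝ (a k) (u + t • w) = 0}) := by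
    refine sup_le (Submodule.span_mono (image_mono fun k hk => ⟨hk.1, ?_⟩)) ?_
    · rw [inner_add_right, real_inner_smul_right, hk.2,
        hwS' _ (Submodule.subset_span ⟨k, hk, rfl⟩), mul_zero, add_zero]
    · rw [Submodule.span_singleton_le_iff_mem]
      exact Submodule.subset_span ⟨k₁, ⟨hk₁, hk₁z⟩, rfl⟩
  have hlt2 : S' < S' ⊔ (ℝ ∙ a k₁) := by
    refine lt_of_le_of_ne le_sup_left fun heq => ?_
    have : a k₁ ∈ S' := by
      rw [heq]; exact Submodule.mem_sup_right (Submodule.mem_span_singleton_self _)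
    exact hk₁w.ne' (hwS' _ this)
  have := (Submodule.finrank_lt_finrank_of_lt hlt2).trans_le (Submodule.finrank_mono hsub)
  exact absurd hmax' (not_le.2 this)

/-- A pointed polyhedral cone with at least two independent constraints has a point where the active
constraints have rank exactly two. -/
theorem exists_active_rank_two {B : Set κ} (hB : B.Finite) {o : E}
    (ho : ∀ k ∈ B, inner ℝ (a k) o < 0)
    (h2 : 2 ≤ Module.finrank ℝ (Submodule.span ℝ (a '' B))) :
    ∃ v, (∀ k ∈ B, inner ℝ (a k) v ≤ 0) ∧
      Module.finrank ℝ (Submodule.span ℝ (a '' {k ∈ B | inner ℝ (a k) v = 0})) = 2 := by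
  let r : E → ℕ := fun u =>
    Module.finrank ℝ (Submodule.span ℝ (a '' {k ∈ B | inner ℝ (a k) u = 0}))
  -- minimize the number of independent active constraints among those with at least two
  obtain ⟨v, ⟨hv, hv2⟩, hmin⟩ : ∃ v, ((∀ k ∈ B, inner ℝ (a k) v ≤ 0) ∧ 2 ≤ r v) ∧
      ∀ v', (∀ k ∈ B, inner ℝ (a k) v' ≤ 0) → 2 ≤ r v' → r v ≤ r v' := by
    have hne : {v | (∀ k ∈ B, inner ℝ (a k) v ≤ 0) ∧ 2 ≤ r v}.Nonempty :=
      have h0 : {k ∈ B | inner ℝ (a k) (0 : E) = 0} = B := by ext; simp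
      ⟨0, by simp, by simp only [r]; rwa [h0]⟩
    refine ⟨Function.argminOn r _ hne, Function.argminOn_mem r _ hne, fun v' h h' => ?_⟩
    exact Function.argminOn_le r {v | (∀ k ∈ B, inner ℝ (a k) v ≤ 0) ∧ 2 ≤ r v} ⟨h, h'⟩
  refine ⟨v, hv, ?_⟩
  by_contra hne
  have h3 : 3 ≤ r v := by
    have : r v ≠ 2 := hne
    omega
  set B' := {k ∈ B | inner ℝ (a k) v = 0} with hB'
  have hB'ne : B'.Nonempty := by
    by_contra h
    rw [not_nonempty_iff_eq_empty] at h
    have : r v = 0 := by simp only [r]; rw [← hB', h]; simp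
    omega
  obtain ⟨u, hu, hur⟩ := exists_active_corank_one (a := a) (hB.subset (sep_subset _ _))
    (fun k hk => ho k hk.1) hB'ne
  -- move from `v` a little in the direction `u`
  have hev : ∀ᶠ ε in 𝓝[>] (0 : ℝ), ∀ k ∈ B \ B', inner ℝ (a k) (v + ε • u) < 0 := by
    rw [eventually_all_finite (hB.subset sdiff_subset)]
    intro k hk
    have hk0 : inner ℝ (a k) v < 0 := lt_of_le_of_ne (hv k hk.1) fun h => hk.2 ⟨hk.1, h⟩
    have hcont : Tendsto (fun ε : ℝ => inner ℝ (a k) (v + ε • u)) (𝓝 0) (𝓝 (inner ℝ (a k) v)) := by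
      have : Continuous fun ε : ℝ => inner ℝ (a k) (v + ε • u) := by fun_prop
      simpa using this.tendsto 0
    exact (hcont.eventually (gt_mem_nhds hk0)).filter_mono nhdsWithin_le_nhds
  obtain ⟨ε, hε, hε0⟩ := (hev.and self_mem_nhdsWithin).exists
  have hε0 : 0 < ε := hε0
  have hval : ∀ k ∈ B', inner ℝ (a k) (v + ε • u) = ε * inner ℝ (a k) u := by
    intro k hk
    rw [inner_add_right, real_inner_smul_right, hk.2, zero_add]
  have hact : {k ∈ B | inner ℝ (a k) (v + ε • u) = 0} = {k ∈ B' | inner ℝ (a k) u = 0} := by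
    ext k
    constructor
    · rintro ⟨hk, hk0⟩
      have hkB : k ∈ B' := by
        by_contra h
        exact (hε k ⟨hk, h⟩).ne hk0
      rw [hval k hkB] at hk0
      exact ⟨hkB, (mul_eq_zero.1 hk0).resolve_left hε0.ne'⟩
    · rintro ⟨hk, hk0⟩
      exact ⟨hk.1, by rw [hval k hk, hk0, mul_zero]⟩
  have hr : r (v + ε • u) + 1 = r v := by
    simp only [r]
    rw [hact, hur]
  have := hmin (v + ε • u) (fun k hk => ?_) (by omega)
  · omega
  · by_cases h : k ∈ B'
    · rw [hval k h]
      exact mul_nonpos_of_nonneg_of_nonpos hε0.le (hu k h)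
    · exact (hε k ⟨hk, h⟩).le

end Cone

variable {m : ℕ}

/-- Near its point `x`, the set `C` is the half-space with the outer unit normal `n` at `x`. -/
structure SmoothAt (C : Set (EuclideanSpace ℝ (Fin m))) (n x : EuclideanSpace ℝ (Fin m)) :
    Prop where
  mem : x ∈ C
  norm_eq : ‖n‖ = 1
  le : ∀ y ∈ C, inner ℝ n y ≤ inner ℝ n x
  eventually : ∀ᶠ y in 𝓝 x, inner ℝ n y ≤ inner ℝ n x → y ∈ C

variable {C F : Set (EuclideanSpace ℝ (Fin m))} {n x y : EuclideanSpace ℝ (Fin m)}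

theorem IsConvexPolyhedron.convex (hC : IsConvexPolyhedron C) : Convex ℝ C := by
  obtain ⟨k, a, b, rfl⟩ := hC
  intro x hx y hy s t hs ht hst i
  rw [inner_add_right, real_inner_smul_right, real_inner_smul_right]
  have h₁ := mul_le_mul_of_nonneg_left (hx i) hs
  have h₂ := mul_le_mul_of_nonneg_left (hy i) ht
  calc _ ≤ s * b i + t * b i := add_le_add h₁ h₂
    _ = b i := by rw [← add_mul, hst, one_mul]

theorem IsConvexPolyhedron.isClosed (hC : IsConvexPolyhedron C) : IsClosed C := by
  obtain ⟨k, a, b, rfl⟩ := hC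
  have : {x | ∀ i, inner ℝ (a i) x ≤ b i} = ⋂ i, {x | inner ℝ (a i) x ≤ b i} := by ext; simp
  rw [this]
  exact isClosed_iInter fun i => isClosed_le (by fun_prop) continuous_const

/-- A linear functional which attains its maximum over a half-space is a multiple of the normal. -/
theorem SmoothAt.eq_smul_inner (h : SmoothAt C n x) {l : EuclideanSpace ℝ (Fin m) →L[ℝ] ℝ}
    (hl : ∀ y ∈ C, l y ≤ l x) : 0 ≤ l n ∧ ∀ w, l w = l n * inner ℝ n w := by
  have hneg : ∀ w, inner ℝ n w ≤ 0 → l w ≤ 0 := by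
    intro w hw
    have hcont : Tendsto (fun ε : ℝ => x + ε • w) (𝓝[>] 0) (𝓝 x) := by
      have : Continuous fun ε : ℝ => x + ε • w := by fun_prop
      have := this.tendsto 0
      simp only [zero_smul, add_zero] at this
      exact this.mono_left nhdsWithin_le_nhds
    obtain ⟨ε, hε, hε0⟩ := ((hcont.eventually h.eventually).and self_mem_nhdsWithin).exists
    have hε0 : 0 < ε := hε0
    have hmem : x + ε • w ∈ C := by
      apply hε
      rw [inner_add_right, real_inner_smul_right]
      nlinarith
    have := hl _ hmem
    rw [map_add, map_smul, smul_eq_mul] at this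
    nlinarith
  have hnn : inner ℝ n n = (1 : ℝ) := by rw [real_inner_self_eq_norm_sq, h.norm_eq, one_pow]
  refine ⟨?_, fun w => ?_⟩
  · have := hneg (-n) (by rw [inner_neg_right, hnn]; norm_num)
    rw [map_neg] at this
    linarith
  · have h0 : inner ℝ n (w - inner ℝ n w • n) = 0 := by
      rw [inner_sub_right, real_inner_smul_right, hnn, mul_one, sub_self]
    have h1 := hneg (w - inner ℝ n w • n) h0.le
    have h2 := hneg (-(w - inner ℝ n w • n)) (by rw [inner_neg_right, h0, neg_zero])
    rw [map_neg] at h2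
    rw [map_sub, map_smul, smul_eq_mul] at h1 h2
    linarith

theorem SmoothAt.normal_eq (h : SmoothAt C n x) {n' : EuclideanSpace ℝ (Fin m)} (hn' : ‖n'‖ = 1)
    (hle : ∀ y ∈ C, inner ℝ n' y ≤ inner ℝ n' x) : n' = n := by
  obtain ⟨h0, hl⟩ := h.eq_smul_inner (l := innerSL ℝ n') (by simpa using hle)
  simp only [innerSL_apply_apply] at h0 hl
  have h1 : n' = (inner ℝ n' n : ℝ) • n := by
    refine ext_inner_right ℝ fun w => ?_
    rw [hl, real_inner_smul_left]
  have h2 := congrArg norm h1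
  rw [norm_smul, hn', h.norm_eq, mul_one, Real.norm_eq_abs, abs_of_nonneg h0] at h2
  rw [h1, ← h2, one_smul]

/-- The only proper face through a smooth boundary point is the facet with the same normal. -/
theorem SmoothAt.face_eq (h : SmoothAt C n x) (hF : IsFace C F) (hne : F ≠ C) (hx : x ∈ F) :
    F = {y ∈ C | inner ℝ n y = inner ℝ n x} := by
  obtain ⟨l, hl⟩ := hF.2 hF.1
  have hmax : ∀ y ∈ C, l y ≤ l x := by
    rw [hl] at hx
    exact hx.2
  obtain ⟨h0, hln⟩ := h.eq_smul_inner hmax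
  have hpos : 0 < l n := by
    refine lt_of_le_of_ne h0 fun heq => hne ?_
    rw [hl]
    ext y
    refine ⟨fun hy => hy.1, fun hy => ⟨hy, fun z _ => ?_⟩⟩
    rw [hln z, hln y, ← heq, zero_mul, zero_mul]
  rw [hl]
  ext y
  refine and_congr_right fun hy => ⟨fun hyz => ?_, fun hyx z hz => ?_⟩
  · have h1 := hyz x h.mem
    rw [hln x, hln y] at h1
    exact le_antisymm (h.le y hy) (le_of_mul_le_mul_left h1 hpos)
  · rw [hln z, hln y]
    exact mul_le_mul_of_nonneg_left (hyx ▸ h.le z hz) hpos.le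

/-- A linear functional which attains its maximum at an interior point is zero, hence proper faces
do not meet the interior. -/
theorem face_eq_of_mem_interior (hF : IsFace C F) (hx : x ∈ F) (hxi : x ∈ interior C) : F = C := by
  obtain ⟨l, hl⟩ := hF.2 hF.1
  have hmax : ∀ y ∈ C, l y ≤ l x := by
    rw [hl] at hx
    exact hx.2
  have hneg : ∀ w, l w ≤ 0 := by
    intro w
    have hcont : Tendsto (fun ε : ℝ => x + ε • w) (𝓝[>] 0) (𝓝 x) := by
      have : Continuous fun ε : ℝ => x + ε • w := by fun_prop
      have := this.tendsto 0
      simp only [zero_smul, add_zero] at this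
      exact this.mono_left nhdsWithin_le_nhds
    obtain ⟨ε, hε, hε0⟩ := ((hcont.eventually (mem_interior_iff_mem_nhds.1 hxi)).and
      self_mem_nhdsWithin).exists
    have hε0 : 0 < ε := hε0
    have := hmax _ hε
    rw [map_add, map_smul, smul_eq_mul] at this
    nlinarith
  have hzero : ∀ w, l w = 0 := fun w => le_antisymm (hneg w) (by
    have := hneg (-w); rw [map_neg] at this; linarith)
  rw [hl]
  ext y
  simp [hzero]

/-- Points of a segment in a facet are smooth if the end points are. -/
theorem SmoothAt.combo (hC : Convex ℝ C) (hx : SmoothAt C n x) (hy : SmoothAt C n y)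
    (hxy : inner ℝ n x = inner ℝ n y) {s t : ℝ} (hs : 0 ≤ s) (ht : 0 ≤ t) (hst : s + t = 1) :
    SmoothAt C n (s • x + t • y) := by
  have hin : inner ℝ n (s • x + t • y) = inner ℝ n x := by
    rw [inner_add_right, real_inner_smul_right, real_inner_smul_right, ← hxy, ← add_mul, hst,
      one_mul]
  refine ⟨hC hx.mem hy.mem hs ht hst, hx.norm_eq, fun z hz => hin ▸ hx.le z hz, ?_⟩
  have h₁ : Tendsto (fun z => x + (z - (s • x + t • y))) (𝓝 (s • x + t • y)) (𝓝 x) := by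
    have : Continuous fun z => x + (z - (s • x + t • y)) := by fun_prop
    simpa using this.tendsto (s • x + t • y)
  have h₂ : Tendsto (fun z => y + (z - (s • x + t • y))) (𝓝 (s • x + t • y)) (𝓝 y) := by
    have : Continuous fun z => y + (z - (s • x + t • y)) := by fun_prop
    simpa using this.tendsto (s • x + t • y)
  filter_upwards [h₁.eventually hx.eventually, h₂.eventually hy.eventually] with z hz₁ hz₂ hz
  have e : s • (x + (z - (s • x + t • y))) + t • (y + (z - (s • x + t • y))) = z := by
    rw [smul_add, smul_add, add_add_add_comm, ← add_smul, hst, one_smul, add_sub_cancel]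
  rw [← e]
  refine hC (hz₁ ?_) (hz₂ ?_) hs ht hst
  · rw [inner_add_right, inner_sub_right]; linarith
  · rw [inner_add_right, inner_sub_right]; linarith

theorem SmoothAt.eventually_mem_interior (h : SmoothAt C n x) :
    ∀ᶠ y in 𝓝 x, inner ℝ n y < inner ℝ n x → y ∈ interior C := by
  obtain ⟨U, hU, hUo, hxU⟩ := mem_nhds_iff.1 h.eventually
  filter_upwards [hUo.mem_nhds hxU] with y hy hlt
  refine mem_interior.2 ⟨U ∩ {z | inner ℝ n z < inner ℝ n x}, fun z hz => hU hz.1 (le_of_lt hz.2),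
    hUo.inter (isOpen_lt (by fun_prop) continuous_const), hy, hlt⟩

/-- The points of a polyhedron which neither are interior points nor have a neighborhood in which
the polyhedron is a half-space lie on a face of codimension two. -/
theorem mem_interior_or_smoothAt_or_face (hC : IsConvexPolyhedron C) (hint : (interior C).Nonempty)
    (hx : x ∈ C) : x ∈ interior C ∨ (∃ n, SmoothAt C n x) ∨
      ∃ F, IsFace C F ∧ faceDim F + 2 = m ∧ x ∈ F := by
  obtain ⟨o, ho⟩ := hint
  obtain ⟨k, a, b, rfl⟩ := hC
  set C := {x | ∀ i, inner ℝ (a i) x ≤ b i} with hCdef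
  have hoC : o ∈ C := interior_subset ho
  -- nontrivial constraints are strict at the interior point
  have hostrict : ∀ i, a i ≠ 0 → inner ℝ (a i) o < b i := by
    intro i hi
    by_contra hcon
    push Not at hcon
    have heq : inner ℝ (a i) o = b i := le_antisymm (hoC i) hcon
    have hcont : Tendsto (fun ε : ℝ => o + ε • a i) (𝓝[>] 0) (𝓝 o) := by
      have : Continuous fun ε : ℝ => o + ε • a i := by fun_prop
      have := this.tendsto 0
      simp only [zero_smul, add_zero] at this
      exact this.mono_left nhdsWithin_le_nhds
    obtain ⟨ε, hε, hε0⟩ := ((hcont.eventually (mem_interior_iff_mem_nhds.1 ho)).and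
      self_mem_nhdsWithin).exists
    have hε0 : 0 < ε := hε0
    have h1 := hε i
    rw [inner_add_right, real_inner_smul_right, heq] at h1
    have h2 : 0 < inner ℝ (a i) (a i) := real_inner_self_pos.2 hi
    nlinarith
  have hb : ∀ i, a i = 0 → 0 ≤ b i := fun i hi => by
    have := hoC i; rwa [hi, inner_zero_left] at this
  set B := {i | a i ≠ 0 ∧ inner ℝ (a i) x = b i} with hB
  have hBo : ∀ i ∈ B, inner ℝ (a i) (o - x) < 0 := by
    intro i hi
    rw [inner_sub_right, hi.2]
    linarith [hostrict i hi.1]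
  -- nearby points satisfy the inactive constraints
  have hnear : ∀ᶠ y in 𝓝 x, ∀ i ∉ B, inner ℝ (a i) y ≤ b i := by
    rw [eventually_all]
    intro i
    by_cases hi : a i = 0
    · exact Eventually.of_forall fun y _ => by rw [hi, inner_zero_left]; exact hb i hi
    by_cases hi' : i ∈ B
    · exact Eventually.of_forall fun y h => absurd hi' h
    have hlt : inner ℝ (a i) x < b i := lt_of_le_of_ne (hx i) fun h => hi' ⟨hi, h⟩
    have hcont : Tendsto (fun y => inner ℝ (a i) y) (𝓝 x) (𝓝 (inner ℝ (a i) x)) :=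
      Continuous.tendsto (by fun_prop) x
    filter_upwards [hcont.eventually (gt_mem_nhds hlt)] with y hy _ using hy.le
  rcases B.eq_empty_or_nonempty with hBe | ⟨i₀, hi₀⟩
  · left
    rw [mem_interior_iff_mem_nhds]
    filter_upwards [hnear] with y hy i using hy i (by rw [hBe]; exact notMem_empty i)
  right
  rcases lt_or_ge (Module.finrank ℝ (Submodule.span ℝ (a '' B))) 2 with hr | hr
  · left
    -- all active constraints are positive multiples of one of them
    have hspan : Submodule.span ℝ (a '' B) = ℝ ∙ a i₀ := by
      symm
      apply Submodule.eq_of_le_of_finrank_le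
      · rw [Submodule.span_singleton_le_iff_mem]
        exact Submodule.subset_span ⟨i₀, hi₀, rfl⟩
      · rw [finrank_span_singleton hi₀.1]
        omega
    have hmul : ∀ i ∈ B, ∃ c : ℝ, 0 < c ∧ a i = c • a i₀ := by
      intro i hi
      have hmem : a i ∈ ℝ ∙ a i₀ := hspan ▸ Submodule.subset_span ⟨i, hi, rfl⟩
      obtain ⟨c, hc⟩ := Submodule.mem_span_singleton.1 hmem
      refine ⟨c, ?_, hc.symm⟩
      have h1 := hBo i hi
      rw [← hc, real_inner_smul_left] at h1
      have h2 := hBo i₀ hi₀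
      by_contra hcon
      push Not at hcon
      nlinarith
    have hn0 : 0 < ‖a i₀‖ := norm_pos_iff.2 hi₀.1
    refine ⟨‖a i₀‖⁻¹ • a i₀, hx, ?_, fun y hy => ?_, ?_⟩
    · rw [norm_smul, norm_inv, norm_norm, inv_mul_cancel₀ hn0.ne']
    · rw [real_inner_smul_left, real_inner_smul_left, hi₀.2]
      exact mul_le_mul_of_nonneg_left (hy i₀) (by positivity)
    · filter_upwards [hnear] with y hy hyx i
      by_cases hi : i ∈ B
      · obtain ⟨c, hc, hci⟩ := hmul i hi
        rw [real_inner_smul_left, real_inner_smul_left] at hyx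
        have h1 := le_of_mul_le_mul_left hyx (by positivity)
        rw [← hi.2, hci, real_inner_smul_left, real_inner_smul_left]
        exact mul_le_mul_of_nonneg_left h1 hc.le
      · exact hy i hi
  · right
    obtain ⟨v, hv, hv2⟩ := exists_active_rank_two (toFinite B) hBo hr
    set B' := {i ∈ B | inner ℝ (a i) v = 0} with hB'
    -- the face of the constraints which stay active in the direction `v`
    let F := {y ∈ C | ∀ i ∈ B', inner ℝ (a i) y = b i}
    have hxF : x ∈ F := ⟨hx, fun i hi => hi.1.2⟩
    classical
    refine ⟨F, ⟨⟨x, hxF⟩, fun _ => ⟨∑ i ∈ B'.toFinset, innerSL ℝ (a i), ?_⟩⟩, ?_, hxF⟩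
    · have hsum : ∀ y, (∑ i ∈ B'.toFinset, innerSL ℝ (a i)) y =
          ∑ i ∈ B'.toFinset, inner ℝ (a i) y := by
        intro y
        simp
      have hle : ∀ y ∈ C, ∑ i ∈ B'.toFinset, inner ℝ (a i) y ≤ ∑ i ∈ B'.toFinset, b i :=
        fun y hy => Finset.sum_le_sum fun i _ => hy i
      ext y
      simp only [hsum]
      refine and_congr_right fun hy => ⟨fun h z hz => ?_, fun h i hi => ?_⟩
      · rw [Finset.sum_congr rfl fun i hi => h i (mem_toFinset.1 hi)]
        exact hle z hz
      · have h1 := h x hx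
        rw [Finset.sum_congr rfl fun i hi => hxF.2 i (mem_toFinset.1 hi)] at h1
        exact (Finset.sum_eq_sum_iff_of_le fun i _ => hy i).1 (le_antisymm (hle y hy) h1) i
          (mem_toFinset.2 hi)
    · -- a point of the face where the other constraints are strict
      obtain ⟨y, hyF, hys⟩ : ∃ y ∈ F, ∀ i ∉ B', a i ≠ 0 → inner ℝ (a i) y < b i := by
        have hev : ∀ᶠ ε in 𝓝[>] (0 : ℝ), ∀ i ∉ B', a i ≠ 0 → inner ℝ (a i) (x + ε • v) < b i := by
          rw [eventually_all]
          intro i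
          by_cases hi : a i = 0
          · exact Eventually.of_forall fun _ _ h => absurd hi h
          by_cases hi' : i ∈ B
          · filter_upwards [self_mem_nhdsWithin] with ε hε hiB _
            have hε : 0 < ε := hε
            have : inner ℝ (a i) v < 0 := lt_of_le_of_ne (hv i hi') fun h => hiB ⟨hi', h⟩
            rw [inner_add_right, real_inner_smul_right, hi'.2]
            nlinarith
          · have hlt : inner ℝ (a i) x < b i := lt_of_le_of_ne (hx i) fun h => hi' ⟨hi, h⟩
            have hcont : Tendsto (fun ε : ℝ => inner ℝ (a i) (x + ε • v)) (𝓝 0)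
                (𝓝 (inner ℝ (a i) x)) := by
              have : Continuous fun ε : ℝ => inner ℝ (a i) (x + ε • v) := by fun_prop
              simpa using this.tendsto 0
            filter_upwards [(hcont.eventually (gt_mem_nhds hlt)).filter_mono nhdsWithin_le_nhds]
              with ε hε _ _ using hε
        obtain ⟨ε, hε⟩ := hev.exists
        have hB'eq : ∀ i ∈ B', inner ℝ (a i) (x + ε • v) = b i := by
          intro i hi
          rw [inner_add_right, real_inner_smul_right, hi.2, hi.1.2, mul_zero, add_zero]
        refine ⟨x + ε • v, ⟨fun i => ?_, hB'eq⟩, hε⟩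
        by_cases hi : a i = 0
        · rw [hi, inner_zero_left]; exact hb i hi
        by_cases hi' : i ∈ B'
        · exact (hB'eq i hi').le
        · exact (hε i hi' hi).le
      -- the face spans the orthogonal complement of its two independent normals
      have hvs : vectorSpan ℝ F = (Submodule.span ℝ (a '' B'))ᗮ := by
        apply le_antisymm
        · refine Submodule.span_le.2 ?_
          rintro _ ⟨p, hp, q, hq, rfl⟩
          refine (Submodule.mem_orthogonal _ _).2 fun z hz =>
            inner_eq_zero_of_mem_span (fun i hi => ?_) hz
          change inner ℝ (a i) (p - q) = 0
          rw [inner_sub_right, hp.2 i hi, hq.2 i hi, sub_self]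
        · intro w hw
          have hw0 : ∀ i ∈ B', inner ℝ (a i) w = 0 := fun i hi =>
            (Submodule.mem_orthogonal _ _).1 hw _ (Submodule.subset_span ⟨i, hi, rfl⟩)
          have hev : ∀ᶠ ε in 𝓝[>] (0 : ℝ), ∀ i ∉ B', a i ≠ 0 →
              inner ℝ (a i) (y + ε • w) < b i := by
            rw [eventually_all]
            intro i
            by_cases hi : i ∉ B' ∧ a i ≠ 0
            · have hcont : Tendsto (fun ε : ℝ => inner ℝ (a i) (y + ε • w)) (𝓝 0)
                  (𝓝 (inner ℝ (a i) y)) := by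
                have : Continuous fun ε : ℝ => inner ℝ (a i) (y + ε • w) := by fun_prop
                simpa using this.tendsto 0
              filter_upwards [(hcont.eventually (gt_mem_nhds (hys i hi.1 hi.2))).filter_mono
                nhdsWithin_le_nhds] with ε hε _ _ using hε
            · exact Eventually.of_forall fun _ h h' => absurd ⟨h, h'⟩ hi
          obtain ⟨ε, hε, hε0⟩ := (hev.and self_mem_nhdsWithin).exists
          have hε0 : 0 < ε := hε0
          have hB'eq : ∀ i ∈ B', inner ℝ (a i) (y + ε • w) = b i := by
            intro i hi
            rw [inner_add_right, real_inner_smul_right, hw0 i hi, hyF.2 i hi, mul_zero, add_zero]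
          have hmem : y + ε • w ∈ F := by
            refine ⟨fun i => ?_, hB'eq⟩
            by_cases hi : a i = 0
            · rw [hi, inner_zero_left]; exact hb i hi
            by_cases hi' : i ∈ B'
            · exact (hB'eq i hi').le
            · exact (hε i hi' hi).le
          have h1 := vsub_mem_vectorSpan ℝ hmem hyF
          rw [vsub_eq_sub, add_sub_cancel_left] at h1
          have h2 := Submodule.smul_mem _ ε⁻¹ h1
          rwa [smul_smul, inv_mul_cancel₀ hε0.ne', one_smul] at h2
      unfold faceDim
      rw [hvs]
      have := Submodule.finrank_add_finrank_orthogonal (Submodule.span ℝ (a '' B'))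
      rw [hv2, finrank_euclideanSpace_fin] at this
      omega

end Polyhedra

/-! ### Lengths of curves -/

section Length

variable {X Y : Type*} [PseudoEMetricSpace X] [PseudoEMetricSpace Y]

theorem eVariationOn_subpath_le {x y : X} (γ : Path x y) {s t : unitInterval} (hst : s ≤ t) :
    pathLength (γ.subpath s t) ≤ eVariationOn γ (Icc s t) := by
  refine eVariationOn.comp_le_of_monotoneOn (γ : unitInterval → X) _ ?_ ?_
  · intro u _ v _ huv
    have h₁ : (u : ℝ) ≤ v := huv
    have h₂ : (s : ℝ) ≤ t := hst
    change (1 - (u : ℝ)) * s + u * t ≤ (1 - (v : ℝ)) * s + v * t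
    nlinarith
  · intro u _
    have : Icc.convexComb s t u ∈ uIcc s t := by
      rw [← Path.range_subpathAux]; exact mem_range_self u
    rwa [uIcc_of_le hst] at this

theorem edist_le_pathLength {x y : X} (γ : Path x y) : edist x y ≤ pathLength γ := by
  have := eVariationOn.edist_le (γ : unitInterval → X) (mem_univ 0) (mem_univ 1)
  rwa [γ.source, γ.target] at this

/-- A curve is no longer than another one if each chord of it is at most as long as the
corresponding arc of the other one. -/
theorem eVariationOn_le_of_edist_le {f : unitInterval → X} {g : unitInterval → Y}
    {s t : unitInterval}
    (h : ∀ u ∈ Icc s t, ∀ v ∈ Icc s t, u ≤ v → edist (f u) (f v) ≤ eVariationOn g (Icc u v)) :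
    eVariationOn f (Icc s t) ≤ eVariationOn g (Icc s t) := by
  refine iSup_le fun ⟨n, u, hu, hus⟩ => ?_
  calc ∑ i ∈ Finset.range n, edist (f (u (i + 1))) (f (u i))
      ≤ ∑ i ∈ Finset.range n, eVariationOn g (Icc (u i) (u (i + 1))) := by
        refine Finset.sum_le_sum fun i _ => ?_
        rw [edist_comm]
        exact h _ (hus i) _ (hus (i + 1)) (hu (Nat.le_succ i))
    _ = eVariationOn g (Icc (u 0) (u n)) := eVariationOn.sum' g hu
    _ ≤ eVariationOn g (Icc s t) := eVariationOn.mono g (Icc_subset_Icc (hus 0).1 (hus n).2)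

theorem pathLength_le_of_edist_le {x y : X} (γ : Path x y) {C : NNReal}
    (h : ∀ s t, edist (γ s) (γ t) ≤ C * edist s t) : pathLength γ ≤ C := by
  have h₁ : LipschitzOnWith C γ univ := fun s _ t _ => h s t
  have h₂ := h₁.comp_eVariationOn_le (g := fun s : unitInterval => s) (s := univ) (mapsTo_univ _ _)
  have h₃ : eVariationOn (fun s : unitInterval => s) univ ≤ 1 := by
    have hI : (univ : Set unitInterval) ∩ Icc 0 1 = univ :=
      eq_univ_of_forall fun u => ⟨mem_univ _, u.2.1, u.2.2⟩
    have := MonotoneOn.eVariationOn_eq (f := fun s : unitInterval => (s : ℝ)) (s := univ)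
      (a := 0) (b := 1) (fun u _ v _ huv => huv) (mem_univ _) (mem_univ _)
    rw [hI] at this
    have h' : eVariationOn (fun s : unitInterval => (s : ℝ)) univ ≤ 1 := by
      rw [this]; simp
    exact h'
  calc pathLength γ ≤ C * eVariationOn (fun s : unitInterval => s) univ := h₂
    _ ≤ C * 1 := by gcongr
    _ = C := mul_one _

/-- A continuous curve in the union of two closed sets, from one of them to the other one, stays in
the first set until it meets both of them. -/
theorem exists_mem_inter_uIcc {A B : Set unitInterval} (hA : IsClosed A) (hB : IsClosed B)
    {u v : unitInterval} (hcov : ∀ w ∈ uIcc u v, w ∈ A ∨ w ∈ B) (hu : u ∈ A) (hv : v ∈ B) :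
    ∃ w ∈ uIcc u v, w ∈ A ∧ w ∈ B ∧ uIcc u w ⊆ A := by
  have hcl : ∀ p q : unitInterval, p < q → Icc p q ⊆ closure (Ioo p q) := by
    intro p q hpq
    rw [closure_Ioo hpq.ne]
  rcases le_total u v with huv | hvu
  · rw [uIcc_of_le huv] at hcov ⊢
    obtain ⟨w, ⟨hwB, hwu, hwv⟩, hmin⟩ := (isCompact_Icc.inter_left hB).exists_isLeast
      (⟨v, hv, right_mem_Icc.2 huv⟩ : (B ∩ Icc u v).Nonempty)
    have hsub : Icc u w ⊆ A := by
      rcases hwu.eq_or_lt with rfl | hlt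
      · rw [Icc_self]; exact singleton_subset_iff.2 hu
      · refine (hcl _ _ hlt).trans (closure_minimal (fun p hp => ?_) hA)
        have hp' : p ∈ Icc u v := ⟨hp.1.le, hp.2.le.trans hwv⟩
        exact (hcov p hp').resolve_right fun h => (hmin ⟨h, hp'⟩).not_gt hp.2
    exact ⟨w, ⟨hwu, hwv⟩, hsub (right_mem_Icc.2 hwu), hwB, by rwa [uIcc_of_le hwu]⟩
  · rw [uIcc_of_ge hvu] at hcov ⊢
    obtain ⟨w, ⟨hwB, hwv, hwu⟩, hmax⟩ := (isCompact_Icc.inter_left hB).exists_isGreatest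
      (⟨v, hv, left_mem_Icc.2 hvu⟩ : (B ∩ Icc v u).Nonempty)
    have hsub : Icc w u ⊆ A := by
      rcases hwu.eq_or_lt with rfl | hlt
      · rw [Icc_self]; exact singleton_subset_iff.2 hu
      · refine (hcl _ _ hlt).trans (closure_minimal (fun p hp => ?_) hA)
        have hp' : p ∈ Icc v u := ⟨hwv.trans hp.1.le, hp.2.le⟩
        exact (hcov p hp').resolve_right fun h => (hmax ⟨h, hp'⟩).not_gt hp.1
    exact ⟨w, ⟨hwv, hwu⟩, hsub (left_mem_Icc.2 hwu), hwB, by rwa [uIcc_of_ge hwu]⟩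

theorem eVariationOn_uIcc_add {f : unitInterval → X} {u v w : unitInterval} (hw : w ∈ uIcc u v) :
    eVariationOn f (uIcc u w) + eVariationOn f (uIcc w v) = eVariationOn f (uIcc u v) := by
  rcases le_total u v with huv | hvu
  · rw [uIcc_of_le huv] at hw ⊢
    rw [uIcc_of_le hw.1, uIcc_of_le hw.2]
    simpa using eVariationOn.Icc_add_Icc f hw.1 hw.2 (mem_univ _)
  · rw [uIcc_of_ge hvu] at hw ⊢
    rw [uIcc_of_ge hw.2, uIcc_of_ge hw.1, add_comm]
    simpa using eVariationOn.Icc_add_Icc f hw.1 hw.2 (mem_univ _)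

end Length

/-! ### Polyhedral spaces are length spaces -/

section LengthSpace

variable {m : ℕ} {V : Type*} (K : EuclideanComplex V m)

/-- The point which divides the segment between two points of a closed simplex. -/
noncomputable def realizationCombo {s : Finset V} (hs : s ∈ K.faces)
    (x y : K.toAbstractSimplicialComplex.Realization) (hx : x.1.support ⊆ s) (hy : y.1.support ⊆ s)
    (t : unitInterval) : K.toAbstractSimplicialComplex.Realization :=
  ⟨(1 - (t : ℝ)) • x.1 + (t : ℝ) • y.1, by
    have hsum : ((1 - (t : ℝ)) • x.1 + (t : ℝ) • y.1).sum (fun _ a => a) = 1 := by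
      rw [Finsupp.sum_add_index' (by simp) (by simp), Finsupp.sum_smul_index' (by simp),
        Finsupp.sum_smul_index' (by simp)]
      simp only [smul_eq_mul]
      rw [← Finsupp.mul_sum, ← Finsupp.mul_sum, x.2.2.2, y.2.2.2]
      ring
    refine ⟨?_, fun v => ?_, hsum⟩
    · have hsub : ((1 - (t : ℝ)) • x.1 + (t : ℝ) • y.1).support ⊆ s := by
        classical
        exact Finsupp.support_add.trans (Finset.union_subset (Finsupp.support_smul.trans hx)
          (Finsupp.support_smul.trans hy))
      refine (K.isRelLowerSet_faces hs).2 hsub ?_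
      rw [Finset.nonempty_iff_ne_empty]
      intro h
      rw [Finsupp.sum, h, Finset.sum_empty] at hsum
      exact zero_ne_one hsum
    · have := mul_nonneg (sub_nonneg.2 t.2.2) (x.2.2.1 v)
      have := mul_nonneg t.2.1 (y.2.2.1 v)
      simp only [Finsupp.add_apply, Finsupp.smul_apply, smul_eq_mul]
      linarith⟩

theorem realizationCombo_support {s : Finset V} (hs : s ∈ K.faces)
    (x y : K.toAbstractSimplicialComplex.Realization) (hx : x.1.support ⊆ s) (hy : y.1.support ⊆ s)
    (t : unitInterval) : (realizationCombo K hs x y hx hy t).1.support ⊆ s := by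
  classical
  exact Finsupp.support_add.trans (Finset.union_subset (Finsupp.support_smul.trans hx)
    (Finsupp.support_smul.trans hy))

theorem place_realizationCombo {s : Finset V} (hs : s ∈ K.faces)
    (x y : K.toAbstractSimplicialComplex.Realization) (hx : x.1.support ⊆ s) (hy : y.1.support ⊆ s)
    (t : unitInterval) : K.place s (realizationCombo K hs x y hx hy t) =
      AffineMap.lineMap (K.place s x) (K.place s y) (t : ℝ) := by
  unfold EuclideanComplex.place realizationCombo
  rw [Finsupp.sum_add_index' (by simp) (by simp [add_smul]), Finsupp.sum_smul_index' (by simp),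
    Finsupp.sum_smul_index' (by simp), AffineMap.lineMap_apply_module, Finsupp.smul_sum,
    Finsupp.smul_sum]
  simp only [smul_eq_mul, mul_smul]

variable {K} {P : Type*} [MetricSpace P]

/-- A chain of segments in simplices is a curve, no longer than the chain. -/
theorem exists_path_of_hasChain (e : P ≃ K.toAbstractSimplicialComplex.Realization)
    (he : ∀ x y : P, IsGLB {L : ℝ | K.HasChain (e x) (e y) L} (dist x y))
    {x y : K.toAbstractSimplicialComplex.Realization} {L : ℝ} (h : K.HasChain x y L) :
    0 ≤ L ∧ ∃ γ : Path (e.symm x) (e.symm y), pathLength γ ≤ ENNReal.ofReal L := by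
  induction h with
  | refl x => exact ⟨le_rfl, Path.refl _, (pathLength_refl _).trans_le (by simp)⟩
  | cons x y z L s hs hx hy _ ih =>
    obtain ⟨hL, η, hη⟩ := ih
    refine ⟨by positivity, ?_⟩
    set C : NNReal := nndist (K.place s x) (K.place s y) with hC
    let c : unitInterval → P := fun t => e.symm (realizationCombo K hs x y hx hy t)
    have hc : ∀ t u, edist (c t) (c u) ≤ C * edist t u := by
      intro t u
      have h₁ : dist (c t) (c u) ≤
          dist (K.place s (e (c t))) (K.place s (e (c u))) + 0 := by
        refine (he (c t) (c u)).1 (EuclideanComplex.HasChain.cons _ _ _ _ s hs ?_ ?_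
          (EuclideanComplex.HasChain.refl _))
        · simp only [c, Equiv.apply_symm_apply]; exact realizationCombo_support K hs x y hx hy t
        · simp only [c, Equiv.apply_symm_apply]; exact realizationCombo_support K hs x y hx hy u
      simp only [c, Equiv.apply_symm_apply, place_realizationCombo, add_zero,
        dist_lineMap_lineMap] at h₁
      rw [edist_nndist, edist_nndist, ← ENNReal.coe_mul, ENNReal.coe_le_coe, ← NNReal.coe_le_coe]
      push_cast
      rw [hC, coe_nndist, mul_comm]
      exact h₁
    have hcont : Continuous c := (show LipschitzWith C c from hc).continuous
    let γ : Path (e.symm x) (e.symm y) :=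
      { toFun := c
        continuous_toFun := hcont
        source' := by
          simp only [c]; congr 1; apply Subtype.ext; simp [realizationCombo]
        target' := by
          simp only [c]; congr 1; apply Subtype.ext; simp [realizationCombo] }
    refine ⟨γ.trans η, (pathLength_trans_le γ η).trans ?_⟩
    rw [ENNReal.ofReal_add dist_nonneg hL]
    refine add_le_add ((pathLength_le_of_edist_le γ hc).trans (le_of_eq ?_)) hη
    rw [hC, ← edist_nndist, edist_dist]

/-- The metric of a polyhedral space is a length metric. -/
theorem exists_path_length_lt {m : ℕ} (hP : IsPolyhedralSpace m P) (x y : P) {r : ℝ}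
    (hr : dist x y < r) : ∃ γ : Path x y, pathLength γ < ENNReal.ofReal r := by
  obtain ⟨V, K, e, he⟩ := hP
  obtain ⟨L, hL, hLr⟩ := (isGLB_lt_iff (he x y)).1 hr
  obtain ⟨hL0, γ, hγ⟩ := exists_path_of_hasChain e he hL
  refine ⟨γ.cast (by simp) (by simp), lt_of_le_of_lt hγ ?_⟩
  exact (ENNReal.ofReal_lt_ofReal_iff (hL0.trans_lt hLr)).2 hLr

/-- Suppose that `D` does not increase the lengths of the curves near `a`. Then it does not increase
distances near `a`. -/
theorem exists_ball_dist_le {m : ℕ} (hP : IsPolyhedralSpace m P) {E : Type*} [PseudoMetricSpace E]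
    {D : P → E} {a : P} {U : Set P} (hU : U ∈ 𝓝 a)
    (h : ∀ τ : unitInterval → P, Continuous τ → (∀ u, τ u ∈ U) →
      edist (D (τ 0)) (D (τ 1)) ≤ eVariationOn τ (uIcc 0 1)) :
    ∃ r > 0, Metric.ball a r ⊆ U ∧
      ∀ x ∈ Metric.ball a r, ∀ y ∈ Metric.ball a r, dist (D x) (D y) ≤ dist x y := by
  obtain ⟨r, hr, hrU⟩ := Metric.mem_nhds_iff.1 hU
  refine ⟨r / 3, by positivity, (Metric.ball_subset_ball (by linarith)).trans hrU,
    fun x hx y hy => ?_⟩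
  rw [Metric.mem_ball] at hx hy
  have hxy : dist x y < 2 * r / 3 := by
    have := dist_triangle_right x y a
    linarith
  refine le_of_forall_gt fun c hc => ?_
  obtain ⟨γ, hγ⟩ := exists_path_length_lt hP x y (lt_min hc hxy)
  have huniv : (uIcc (0 : unitInterval) 1) = univ := by
    rw [uIcc_of_le zero_le_one]
    exact eq_univ_of_forall fun u => ⟨u.2.1, u.2.2⟩
  have h₁ := h γ γ.continuous fun u => hrU ?_
  · rw [γ.source, γ.target, huniv] at h₁
    have h₂ := h₁.trans_lt hγ
    rw [edist_dist] at h₂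
    exact ((ENNReal.ofReal_lt_ofReal_iff_of_nonneg dist_nonneg).1 h₂).trans_le (min_le_left _ _)
  · have h₁ : edist x (γ u) ≤ pathLength γ := by
      have := eVariationOn.edist_le (γ : unitInterval → P) (mem_univ 0) (mem_univ u)
      rwa [γ.source] at this
    have h₂ := h₁.trans_lt hγ
    rw [edist_dist] at h₂
    have h₃ := ((ENNReal.ofReal_lt_ofReal_iff_of_nonneg dist_nonneg).1 h₂).trans_le
      (min_le_right _ _)
    rw [Metric.mem_ball]
    have := dist_triangle_left (γ u) a x
    linarith

end LengthSpace

/-! ### Charts of a subdivision -/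

section Charts

variable {m : ℕ} {P : Type*} [MetricSpace P] {ι : Type*} (S : ConvexSubdivision m P ι)

/-- The chart of the cell `Q i`, with a junk value outside of the polyhedron `C i`. -/
noncomputable def toP (i : ι) (c : EuclideanSpace ℝ (Fin m)) : P :=
  haveI := Classical.propDecidable (c ∈ S.C i)
  if h : c ∈ S.C i then S.chart i ⟨c, h⟩
  else S.chart i ⟨(S.interior_nonempty i).some, interior_subset (S.interior_nonempty i).some_mem⟩

/-- The coordinates of a point of the cell `Q i`, with the junk value `0` outside of the cell. -/
noncomputable def coord (i : ι) (x : P) : EuclideanSpace ℝ (Fin m) :=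
  haveI := Classical.propDecidable (x ∈ S.Q i)
  if h : x ∈ S.Q i then (S.chart i).symm ⟨x, h⟩ else 0

variable {S} {i j k : ι} {x y a : P} {c d : EuclideanSpace ℝ (Fin m)}

theorem toP_of_mem (h : c ∈ S.C i) : toP S i c = S.chart i ⟨c, h⟩ := dif_pos h

theorem coord_of_mem (h : x ∈ S.Q i) : coord S i x = (S.chart i).symm ⟨x, h⟩ := dif_pos h

theorem toP_mem (h : c ∈ S.C i) : toP S i c ∈ S.Q i := by
  rw [toP_of_mem h]; exact Subtype.coe_prop _

theorem coord_mem (h : x ∈ S.Q i) : coord S i x ∈ S.C i := by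
  rw [coord_of_mem h]; exact Subtype.coe_prop _

theorem coord_toP (h : c ∈ S.C i) : coord S i (toP S i c) = c := by
  rw [coord_of_mem (toP_mem h)]
  simp [toP_of_mem h]

theorem toP_coord (h : x ∈ S.Q i) : toP S i (coord S i x) = x := by
  rw [toP_of_mem (coord_mem h)]
  simp [coord_of_mem h]

theorem convex_C (S : ConvexSubdivision m P ι) (i : ι) : Convex ℝ (S.C i) :=
  IsConvexPolyhedron.convex (S.isConvexPolyhedron i)

theorem edist_toP_le (hc : c ∈ S.C i) (hd : d ∈ S.C i) :
    edist (toP S i c) (toP S i d) ≤ edist c d := by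
  rw [toP_of_mem hc, toP_of_mem hd]
  have := S.chart_isometry i ⟨c, hc⟩ ⟨d, hd⟩
  calc _ ≤ intrinsicEDist (S.chart i ⟨c, hc⟩) (S.chart i ⟨d, hd⟩) :=
        le_iInf fun γ => edist_le_pathLength γ
    _ = edist c d := this

theorem dist_toP_le (hc : c ∈ S.C i) (hd : d ∈ S.C i) :
    dist (toP S i c) (toP S i d) ≤ dist c d := by
  have := edist_toP_le hc hd
  rwa [edist_dist, edist_dist, ENNReal.ofReal_le_ofReal_iff dist_nonneg] at this

theorem continuousOn_toP (S : ConvexSubdivision m P ι) (i : ι) : ContinuousOn (toP S i) (S.C i) :=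
  (LipschitzOnWith.of_dist_le_mul (K := 1) fun c hc d hd => by
    simpa using dist_toP_le hc hd).continuousOn

theorem continuousOn_coord (S : ConvexSubdivision m P ι) (i : ι) :
    ContinuousOn (coord S i) (S.Q i) := by
  rw [continuousOn_iff_continuous_domRestrict]
  have : (S.Q i).domRestrict (coord S i) =
      fun x => ((S.chart i).symm x : EuclideanSpace ℝ (Fin m)) := by
    ext1 x
    exact coord_of_mem x.2
  rw [this]
  exact continuous_subtype_val.comp (S.chart i).symm.continuous

/-- The coordinates of the end points of a curve in a cell are no further apart than the length of
the curve. -/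
theorem edist_coord_le {τ : unitInterval → P} (hτ : Continuous τ) {s t : unitInterval}
    (hQ : ∀ u ∈ uIcc s t, τ u ∈ S.Q i) :
    edist (coord S i (τ s)) (coord S i (τ t)) ≤ eVariationOn τ (uIcc s t) := by
  wlog hst : s ≤ t generalizing s t
  · rw [edist_comm, uIcc_comm]
    exact this (by rwa [uIcc_comm]) (le_of_not_ge hst)
  rw [uIcc_of_le hst] at hQ ⊢
  have hs := hQ s (left_mem_Icc.2 hst)
  have ht := hQ t (right_mem_Icc.2 hst)
  let γ : Path (τ 0) (τ 1) := ⟨⟨τ, hτ⟩, rfl, rfl⟩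
  have hmem : ∀ u, γ.subpath s t u ∈ S.Q i := by
    intro u
    have : γ.subpath s t u ∈ γ '' Icc s t := by
      rw [← Path.range_subpath_of_le γ s t hst]; exact mem_range_self u
    obtain ⟨v, hv, hvu⟩ := this
    rw [← hvu]
    exact hQ v hv
  let η : Path (⟨τ s, hs⟩ : S.Q i) ⟨τ t, ht⟩ :=
    { toFun := fun u => ⟨γ.subpath s t u, hmem u⟩
      continuous_toFun := (γ.subpath s t).continuous.subtype_mk _
      source' := Subtype.ext (γ.subpath s t).source
      target' := Subtype.ext (γ.subpath s t).target }
  have h₁ := S.chart_isometry i ((S.chart i).symm ⟨τ s, hs⟩) ((S.chart i).symm ⟨τ t, ht⟩)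
  rw [Homeomorph.apply_symm_apply, Homeomorph.apply_symm_apply] at h₁
  rw [coord_of_mem hs, coord_of_mem ht]
  calc _ = intrinsicEDist (⟨τ s, hs⟩ : S.Q i) ⟨τ t, ht⟩ := h₁.symm
    _ ≤ pathLength η := iInf_le _ η
    _ = pathLength (γ.subpath s t) := rfl
    _ ≤ eVariationOn γ (Icc s t) := eVariationOn_subpath_le γ hst
    _ = _ := rfl

theorem eventually_cells_subset (S : ConvexSubdivision m P ι) (a : P) :
    ∀ᶠ y in 𝓝 a, ∀ i, y ∈ S.Q i → a ∈ S.Q i :=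
  S.locallyFinite.eventually_subset S.isClosed a

theorem exists_cell (S : ConvexSubdivision m P ι) (x : P) : ∃ i, x ∈ S.Q i :=
  mem_iUnion.1 (S.cover ▸ mem_univ x)

variable (S) in
/-- `Z` is a common proper face of the cells `Q i` and `Q j`. -/
def CommonFace (i j : ι) (Z : Set P) : Prop :=
  ∃ F G, IsFace (S.C i) F ∧ F ≠ S.C i ∧ IsFace (S.C j) G ∧ G ≠ S.C j ∧
    cellImage (S.chart i) F = Z ∧ cellImage (S.chart j) G = Z

theorem exists_commonFace (hij : i ≠ j) (hi : x ∈ S.Q i) (hj : x ∈ S.Q j) :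
    ∃ Z, CommonFace S i j Z ∧ x ∈ Z := by
  obtain ⟨F, G, hF, hF', hG, hG', h, hx⟩ := S.faceToFace i j hij x ⟨hi, hj⟩
  exact ⟨_, ⟨F, G, hF, hF', hG, hG', rfl, h.symm⟩, hx⟩

theorem CommonFace.symm {Z : Set P} (h : CommonFace S i j Z) : CommonFace S j i Z := by
  obtain ⟨F, G, h₁, h₂, h₃, h₄, h₅, h₆⟩ := h
  exact ⟨G, F, h₃, h₄, h₁, h₂, h₆, h₅⟩

theorem mem_cellImage_iff {F : Set (EuclideanSpace ℝ (Fin m))} (hF : F ⊆ S.C i) :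
    x ∈ cellImage (S.chart i) F ↔ x ∈ S.Q i ∧ coord S i x ∈ F := by
  constructor
  · rintro ⟨c, hc, rfl⟩
    refine ⟨Subtype.coe_prop _, ?_⟩
    rw [← toP_of_mem c.2, coord_toP c.2]
    exact hc
  · rintro ⟨hx, hF'⟩
    exact ⟨⟨coord S i x, hF hF'⟩, hF', by rw [← toP_of_mem, toP_coord hx]⟩

theorem IsFace.subset {C F : Set (EuclideanSpace ℝ (Fin m))} (hF : IsFace C F) : F ⊆ C :=
  hF.2.subset

theorem CommonFace.subset_left {Z : Set P} (h : CommonFace S i j Z) : Z ⊆ S.Q i := by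
  obtain ⟨F, G, h₁, h₂, h₃, h₄, rfl, h₆⟩ := h
  exact fun x hx => ((mem_cellImage_iff (IsFace.subset h₁)).1 hx).1

theorem CommonFace.subset_right {Z : Set P} (h : CommonFace S i j Z) : Z ⊆ S.Q j :=
  h.symm.subset_left

theorem CommonFace.notMem_interior {Z : Set P} (h : CommonFace S i j Z) (hx : x ∈ Z) :
    coord S i x ∉ interior (S.C i) := by
  obtain ⟨F, G, h₁, h₂, h₃, h₄, rfl, h₆⟩ := h
  exact fun hi => h₂ (face_eq_of_mem_interior h₁ ((mem_cellImage_iff (IsFace.subset h₁)).1 hx).2 hi)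

theorem coord_notMem_interior (hij : i ≠ j) (hi : x ∈ S.Q i) (hj : x ∈ S.Q j) :
    coord S i x ∉ interior (S.C i) := by
  obtain ⟨Z, hZ, hx⟩ := exists_commonFace hij hi hj
  exact hZ.notMem_interior hx

/-- Common faces are convex in the coordinates of either cell. -/
theorem CommonFace.combo_mem {Z : Set P} (h : CommonFace S i j Z) (hx : x ∈ Z) (hy : y ∈ Z)
    {s t : ℝ} (hs : 0 ≤ s) (ht : 0 ≤ t) (hst : s + t = 1) :
    toP S i (s • coord S i x + t • coord S i y) ∈ Z := by
  obtain ⟨F, G, h₁, h₂, h₃, h₄, rfl, h₆⟩ := h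
  have hconv := h₁.2.convex (convex_C S i)
  rw [mem_cellImage_iff (IsFace.subset h₁)] at hx hy ⊢
  have hmem := hconv hx.2 hy.2 hs ht hst
  have hC := IsFace.subset h₁ hmem
  exact ⟨toP_mem hC, by rwa [coord_toP hC]⟩

/-- A smooth point of a common face determines this face. -/
theorem CommonFace.mem_iff {Z : Set P} (h : CommonFace S i j Z) {n : EuclideanSpace ℝ (Fin m)}
    (ha : a ∈ Z) (hn : SmoothAt (S.C i) n (coord S i a)) :
    x ∈ Z ↔ x ∈ S.Q i ∧ inner ℝ n (coord S i x) = inner ℝ n (coord S i a) := by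
  obtain ⟨F, G, h₁, h₂, h₃, h₄, rfl, h₆⟩ := h
  rw [mem_cellImage_iff (IsFace.subset h₁)] at ha ⊢
  refine and_congr_right fun hx => ?_
  have := hn.face_eq h₁ h₂ ha.2
  rw [this]
  exact ⟨fun h => h.2, fun h => ⟨coord_mem hx, h⟩⟩

theorem CommonFace.eq_of_smoothAt {Z Z' : Set P} (h : CommonFace S i j Z) (h' : CommonFace S i k Z')
    {n : EuclideanSpace ℝ (Fin m)} (ha : a ∈ Z) (ha' : a ∈ Z')
    (hn : SmoothAt (S.C i) n (coord S i a)) : Z = Z' := by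
  ext x
  rw [h.mem_iff ha hn, h'.mem_iff ha' hn]

/-- The segment between two points of a common face, drawn in the coordinates of `Q i`, is a curve
in the cell `Q j`. -/
theorem CommonFace.edist_coord_le {Z : Set P} (h : CommonFace S i j Z) (hx : x ∈ Z) (hy : y ∈ Z) :
    edist (coord S j x) (coord S j y) ≤ edist (coord S i x) (coord S i y) := by
  let g : unitInterval → EuclideanSpace ℝ (Fin m) := fun t =>
    (1 - (t : ℝ)) • coord S i x + (t : ℝ) • coord S i y
  have hxi := coord_mem (h.subset_left hx)
  have hyi := coord_mem (h.subset_left hy)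
  have hg : ∀ t, g t ∈ S.C i := fun t =>
    convex_C S i hxi hyi (sub_nonneg.2 t.2.2) t.2.1 (by ring)
  have hcont : Continuous g := by fun_prop
  let γ : Path (toP S i (g 0)) (toP S i (g 1)) :=
    { toFun := fun t => toP S i (g t)
      continuous_toFun := (continuousOn_toP S i).comp_continuous hcont hg
      source' := rfl
      target' := rfl }
  have hlen : pathLength γ ≤ nndist (coord S i x) (coord S i y) := by
    refine pathLength_le_of_edist_le γ fun s t => (edist_toP_le (hg s) (hg t)).trans (le_of_eq ?_)
    simp only [g]
    rw [← AffineMap.lineMap_apply_module, ← AffineMap.lineMap_apply_module, edist_nndist,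
      nndist_lineMap_lineMap, edist_nndist s t, mul_comm]
    norm_cast
  have hcell := Ramification.edist_coord_le (S := S) (i := j) γ.continuous (s := 0) (t := 1)
    fun u _ => h.subset_right (h.combo_mem hx hy (sub_nonneg.2 u.2.2) u.2.1 (by ring))
  have e₀ : toP S i (g 0) = x := by simp [g, toP_coord (h.subset_left hx)]
  have e₁ : toP S i (g 1) = y := by simp [g, toP_coord (h.subset_left hy)]
  rw [edist_nndist (coord S i x)]
  refine le_trans (le_of_eq ?_) (hcell.trans ((eVariationOn.mono _ (subset_univ _)).trans hlen))
  rw [γ.source, γ.target, e₀, e₁]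

/-- The change of coordinates along a common face is isometric. -/
theorem CommonFace.dist_coord {Z : Set P} (h : CommonFace S i j Z) (hx : x ∈ Z) (hy : y ∈ Z) :
    dist (coord S i x) (coord S i y) = dist (coord S j x) (coord S j y) := by
  have := le_antisymm (h.symm.edist_coord_le hx hy) (h.edist_coord_le hx hy)
  rwa [edist_dist, edist_dist, ENNReal.ofReal_eq_ofReal_iff dist_nonneg dist_nonneg] at this

/-- Near a smooth point of `Q i`, the other cells meet `Q i` only in the facet. -/
theorem eventually_inner_coord_eq {n : EuclideanSpace ℝ (Fin m)} (hi : a ∈ S.Q i)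
    (hn : SmoothAt (S.C i) n (coord S i a)) :
    ∀ᶠ y in 𝓝 a, ∀ j, j ≠ i → y ∈ S.Q i → y ∈ S.Q j →
      inner ℝ n (coord S i y) = inner ℝ n (coord S i a) := by
  have h := (continuousOn_coord S i a hi).eventually hn.eventually_mem_interior
  rw [eventually_nhdsWithin_iff] at h
  filter_upwards [h] with y hy j hj hyi hyj
  by_contra hne
  exact coord_notMem_interior hj.symm hyi hyj
    (hy hyi (lt_of_le_of_ne (hn.le _ (coord_mem hyi)) hne))

/-- The unfolding of two adjacent cells: an isometry of the Euclidean space which identifies the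
coordinates along the common facet and maps the second cell to the other side of the facet. -/
theorem CommonFace.exists_unfolding {Z : Set P} (h : CommonFace S i j Z)
    {n n' : EuclideanSpace ℝ (Fin m)} (ha : a ∈ Z) (hn : SmoothAt (S.C i) n (coord S i a))
    (hn' : SmoothAt (S.C j) n' (coord S j a)) :
    ∃ A : EuclideanSpace ℝ (Fin m) ≃ᵃⁱ[ℝ] EuclideanSpace ℝ (Fin m),
      (∀ x ∈ Z, A (coord S j x) = coord S i x) ∧ A.linearIsometryEquiv n' = -n := by
  obtain ⟨A, hA⟩ := exists_affineIsometryEquiv_of_isometric (s := coord S j '' Z)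
    (g := fun c => coord S i (toP S j c)) (by
      rintro _ ⟨x, hx, rfl⟩ _ ⟨y, hy, rfl⟩
      simp only [toP_coord (h.subset_right hx), toP_coord (h.subset_right hy)]
      exact h.dist_coord hx hy)
  have hA' : ∀ x ∈ Z, A (coord S j x) = coord S i x := by
    intro x hx
    rw [hA _ ⟨x, hx, rfl⟩, toP_coord (h.subset_right hx)]
  have hai := h.subset_left ha
  have haj := h.subset_right ha
  have hnn : inner ℝ n n = (1 : ℝ) := by rw [real_inner_self_eq_norm_sq, hn.norm_eq, one_pow]
  -- `A` maps directions along the facet to directions along the facet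
  have hperp : ∀ w, inner ℝ n w = 0 → inner ℝ (A.linearIsometryEquiv n') w = 0 := by
    intro w hw
    have hcont : Tendsto (fun ε : ℝ => coord S i a + ε • w) (𝓝[>] 0) (𝓝 (coord S i a)) := by
      have : Continuous fun ε : ℝ => coord S i a + ε • w := by fun_prop
      have := this.tendsto 0
      simp only [zero_smul, add_zero] at this
      exact this.mono_left nhdsWithin_le_nhds
    obtain ⟨ε, hε, hε0⟩ := ((hcont.eventually hn.eventually).and self_mem_nhdsWithin).exists
    have hε0 : 0 < ε := hε0
    have heq : inner ℝ n (coord S i a + ε • w) = inner ℝ n (coord S i a) := by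
      rw [inner_add_right, real_inner_smul_right, hw, mul_zero, add_zero]
    have hC := hε heq.le
    have hz : toP S i (coord S i a + ε • w) ∈ Z := by
      rw [h.mem_iff ha hn, coord_toP hC]
      exact ⟨toP_mem hC, heq⟩
    have h₁ := hA' _ hz
    rw [coord_toP hC] at h₁
    have h₂ := ((h.symm.mem_iff ha hn').1 hz).2
    have h₃ : A.linearIsometryEquiv (coord S j (toP S i (coord S i a + ε • w)) - coord S j a) =
        ε • w := by
      have := A.map_vsub (coord S j (toP S i (coord S i a + ε • w))) (coord S j a)
      rw [vsub_eq_sub, vsub_eq_sub] at this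
      rw [this, h₁, hA' a ha, add_sub_cancel_left]
    have h₄ : inner ℝ (A.linearIsometryEquiv n') (ε • w) = 0 := by
      rw [← h₃, LinearIsometryEquiv.inner_map_map, inner_sub_right, h₂, sub_self]
    rw [real_inner_smul_right] at h₄
    exact (mul_eq_zero.1 h₄).resolve_left hε0.ne'
  have hmul : A.linearIsometryEquiv n' = (inner ℝ n (A.linearIsometryEquiv n') : ℝ) • n := by
    set v := A.linearIsometryEquiv n'
    set w := v - (inner ℝ n v : ℝ) • n with hw
    have h₁ : inner ℝ n w = 0 := by
      rw [hw, inner_sub_right, real_inner_smul_right, hnn, mul_one, sub_self]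
    have h₂ := hperp w h₁
    have h₃ : inner ℝ w w = 0 := by
      conv_lhs => rw [hw, inner_sub_left, real_inner_smul_left, h₁, h₂]
      simp
    rw [inner_self_eq_zero] at h₃
    exact sub_eq_zero.1 h₃
  have hnorm : ‖A.linearIsometryEquiv n'‖ = 1 := by
    rw [LinearIsometryEquiv.norm_map, hn'.norm_eq]
  have habs : |(inner ℝ n (A.linearIsometryEquiv n') : ℝ)| = 1 := by
    have h₁ := congrArg norm hmul
    rwa [norm_smul, hn.norm_eq, mul_one, hnorm, Real.norm_eq_abs, eq_comm] at h₁
  rcases eq_or_eq_neg_of_abs_eq habs with h₁ | h₁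
  · -- both cells lie on the same side: compose with the reflection in the facet
    rw [h₁, one_smul] at hmul
    let R := Submodule.reflection (ℝ ∙ n)ᗮ
    let p := coord S i a
    let B : EuclideanSpace ℝ (Fin m) ≃ᵃⁱ[ℝ] EuclideanSpace ℝ (Fin m) :=
      ((AffineIsometryEquiv.vaddConst ℝ p).symm.trans R.toAffineIsometryEquiv).trans
        (AffineIsometryEquiv.vaddConst ℝ p)
    refine ⟨A.trans B, fun x hx => ?_, ?_⟩
    · change R (A (coord S j x) - p) + p = _
      rw [hA' x hx, Submodule.reflection_mem_subspace_eq_self, sub_add_cancel]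
      rw [Submodule.mem_orthogonal_singleton_iff_inner_right, inner_sub_right,
        ((h.mem_iff ha hn).1 hx).2, sub_self]
    · have h₂ : (A.trans B).linearIsometryEquiv n' = R (A.linearIsometryEquiv n') := by
        have e : ∀ (T : EuclideanSpace ℝ (Fin m) ≃ᵃⁱ[ℝ] EuclideanSpace ℝ (Fin m)),
            T.linearIsometryEquiv n' = T n' - T 0 := fun T => by
          have := T.map_vsub n' 0
          simpa using this
        rw [e, e]
        change R (A n' - p) + p - (R (A 0 - p) + p) = _
        rw [add_sub_add_right_eq_sub, ← map_sub, sub_sub_sub_cancel_right]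
      rw [h₂, hmul]
      exact Submodule.reflection_orthogonalComplement_singleton_eq_neg n
  · refine ⟨A, hA', ?_⟩
    rw [hmul, h₁, neg_one_smul]

end Charts

/-! ### Charts at regular points -/

section Regular

variable {m : ℕ} {P : Type*} [MetricSpace P] {ι : Type*} {S : ConvexSubdivision m P ι}
  {i j k : ι} {a x y : P}

local notation "E" => EuclideanSpace ℝ (Fin m)

/-- A map which is isometric near `a` and covers a neighborhood of the image of `a` shows that `a`
is regular. -/
theorem mem_regularLocus_of_dist_eq {D : P → E} {r : ℝ} (hr : 0 < r)
    (hD : ∀ x ∈ Metric.ball a r, ∀ y ∈ Metric.ball a r, dist (D x) (D y) = dist x y)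
    (hs : ∀ᶠ z in 𝓝 (D a), ∃ y ∈ Metric.ball a r, D y = z) : a ∈ regularLocus m P := by
  obtain ⟨q, hq, hqs⟩ := Metric.eventually_nhds_iff_ball.1 hs
  have ha := Metric.mem_ball_self (x := a) hr
  have hmem : ∀ y : Metric.ball a (min q r), (y : P) ∈ Metric.ball a r := fun y =>
    Metric.ball_subset_ball (min_le_right _ _) y.2
  let f : Metric.ball a (min q r) → Metric.ball (D a) (min q r) := fun y => ⟨D y, by
    rw [Metric.mem_ball, hD _ (hmem y) _ ha]; exact y.2⟩
  have hf : Isometry f := Isometry.of_dist_eq fun y z => hD _ (hmem y) _ (hmem z)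
  have hsurj : Function.Surjective f := by
    rintro ⟨z, hz⟩
    obtain ⟨y, hy, rfl⟩ := hqs z (Metric.ball_subset_ball (min_le_left _ _) hz)
    rw [Metric.mem_ball, hD _ hy _ ha] at hz
    exact ⟨⟨y, hz⟩, rfl⟩
  exact ⟨_, Metric.ball_mem_nhds a (lt_min hq hr), _, Metric.isOpen_ball,
    ⟨⟨Equiv.ofBijective f ⟨hf.injective, hsurj⟩, hf⟩⟩⟩

variable (a) in
/-- `φ` maps the ball around `a` of radius `r` isometrically onto a ball in Euclidean space. -/
structure IsChartAt (φ : P → EuclideanSpace ℝ (Fin m)) (r : ℝ) : Prop where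
  pos : 0 < r
  dist_eq : ∀ x ∈ Metric.ball a r, ∀ y ∈ Metric.ball a r, dist (φ x) (φ y) = dist x y
  surj : ∀ z ∈ Metric.ball (φ a) r, ∃ y ∈ Metric.ball a r, φ y = z

theorem exists_isChartAt (ha : a ∈ regularLocus m P) :
    ∃ (φ : P → EuclideanSpace ℝ (Fin m)) (r : ℝ), IsChartAt a φ r := by
  classical
  obtain ⟨U, hU, W, hW, ⟨e⟩⟩ := ha
  have haU := mem_of_mem_nhds hU
  obtain ⟨r₁, hr₁, hU⟩ := Metric.mem_nhds_iff.1 hU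
  obtain ⟨r₂, hr₂, hW⟩ := Metric.mem_nhds_iff.1 (hW.mem_nhds (e ⟨a, haU⟩).2)
  let φ : P → E := fun x => if h : x ∈ U then e ⟨x, h⟩ else 0
  have hφ : ∀ x (h : x ∈ U), φ x = e ⟨x, h⟩ := fun x h => dif_pos h
  have hsub : Metric.ball a (min r₁ r₂) ⊆ U := (Metric.ball_subset_ball (min_le_left _ _)).trans hU
  refine ⟨φ, min r₁ r₂, lt_min hr₁ hr₂, fun x hx y hy => ?_, fun z hz => ?_⟩
  · rw [hφ x (hsub hx), hφ y (hsub hy)]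
    exact e.isometry.dist_eq _ _
  · rw [hφ a haU] at hz
    have hzW : z ∈ W := hW (Metric.ball_subset_ball (min_le_right _ _) hz)
    refine ⟨e.symm ⟨z, hzW⟩, ?_, ?_⟩
    · have := e.isometry.dist_eq (e.symm ⟨z, hzW⟩) ⟨a, haU⟩
      rw [IsometryEquiv.apply_symm_apply] at this
      rw [Metric.mem_ball]
      change dist (e.symm ⟨z, hzW⟩) ⟨a, haU⟩ < _
      rw [← this]
      exact hz
    · rw [hφ _ (e.symm ⟨z, hzW⟩).2]
      simp

theorem IsChartAt.mem_regularLocus {φ : P → E} {r : ℝ} (h : IsChartAt a φ r)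
    (hx : x ∈ Metric.ball a r) : x ∈ regularLocus m P := by
  have ha := Metric.mem_ball_self (x := a) h.pos
  have hφx : φ x ∈ Metric.ball (φ a) r := by
    rw [Metric.mem_ball, h.dist_eq _ hx _ ha]; exact hx
  obtain ⟨q, hq, hqr⟩ := Metric.isOpen_iff.1 Metric.isOpen_ball x hx
  refine mem_regularLocus_of_dist_eq (D := φ) hq
    (fun y hy z hz => h.dist_eq _ (hqr hy) _ (hqr hz)) ?_
  filter_upwards [Metric.isOpen_ball.mem_nhds hφx, Metric.ball_mem_nhds (φ x) hq] with z hz hz'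
  obtain ⟨y, hy, rfl⟩ := h.surj z hz
  rw [Metric.mem_ball, h.dist_eq _ hy _ hx] at hz'
  exact ⟨y, hz', rfl⟩

/-- Near the interior points of a cell, the coordinates are isometric. -/
theorem exists_ball_dist_coord_eq (hP : IsPolyhedralSpace m P) (hi : a ∈ S.Q i)
    (ha : coord S i a ∈ interior (S.C i)) : ∃ r > 0, Metric.ball a r ⊆ S.Q i ∧
      ∀ x ∈ Metric.ball a r, ∀ y ∈ Metric.ball a r,
        dist (coord S i x) (coord S i y) = dist x y := by
  have hU : S.Q i ∈ 𝓝 a := by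
    filter_upwards [eventually_cells_subset S a] with y hy
    obtain ⟨j, hj⟩ := exists_cell S y
    by_cases hij : i = j
    · rwa [hij]
    · exact absurd ha (coord_notMem_interior hij hi (hy j hj))
  obtain ⟨r, hr, hrU, h⟩ := exists_ball_dist_le hP (D := coord S i) hU
    fun τ hτ hτU => edist_coord_le hτ fun u _ => hτU u
  refine ⟨r, hr, hrU, fun x hx y hy => le_antisymm (h x hx y hy) ?_⟩
  have := dist_toP_le (coord_mem (hrU hx)) (coord_mem (hrU hy))
  rwa [toP_coord (hrU hx), toP_coord (hrU hy)] at this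

theorem mem_regularLocus_of_mem_interior (hP : IsPolyhedralSpace m P) (hi : a ∈ S.Q i)
    (ha : coord S i a ∈ interior (S.C i)) : a ∈ regularLocus m P := by
  obtain ⟨r, hr, hrU, h⟩ := exists_ball_dist_coord_eq hP hi ha
  refine mem_regularLocus_of_dist_eq hr h ?_
  filter_upwards [isOpen_interior.mem_nhds ha, Metric.ball_mem_nhds _ hr] with z hz hz'
  have hzC := interior_subset hz
  refine ⟨toP S i z, ?_, coord_toP hzC⟩
  have := dist_toP_le hzC (coord_mem hi)
  rw [toP_coord hi] at this
  exact this.trans_lt hz'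

theorem eq_of_eventuallyEq {A B : E ≃ᵃⁱ[ℝ] E} {c : E} (h : ∀ᶠ x in 𝓝 c, A x = B x) : A = B := by
  ext1 x
  have hcont : Tendsto (fun ε : ℝ => AffineMap.lineMap c x ε) (𝓝[>] 0) (𝓝 c) := by
    have : Continuous fun ε : ℝ => (AffineMap.lineMap c x ε : E) := AffineMap.lineMap_continuous
    have := this.tendsto 0
    rw [AffineMap.lineMap_apply_zero] at this
    exact this.mono_left nhdsWithin_le_nhds
  obtain ⟨ε, hε, hε0⟩ := ((hcont.eventually h).and self_mem_nhdsWithin).exists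
  have hε0 : (0 : ℝ) < ε := hε0
  have hc := h.self_of_nhds
  have h₁ : A (AffineMap.lineMap c x ε) = AffineMap.lineMap (A c) (A x) ε :=
    A.toAffineEquiv.toAffineMap.apply_lineMap c x ε
  have h₂ : B (AffineMap.lineMap c x ε) = AffineMap.lineMap (B c) (B x) ε :=
    B.toAffineEquiv.toAffineMap.apply_lineMap c x ε
  rw [h₁, h₂, hc, AffineMap.lineMap_apply_module', AffineMap.lineMap_apply_module'] at hε
  have := smul_right_injective _ hε0.ne' (add_right_cancel hε)
  exact sub_left_injective this

/-- A map which is isometric near every point of a connected set agrees there with one rigid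
motion. -/
theorem exists_affineIsometryEquiv_of_locally {K : Set E} (hK : IsPreconnected K)
    (hne : K.Nonempty) {g : E → E}
    (h : ∀ c ∈ K, ∃ U ∈ 𝓝 c, ∀ x ∈ U, ∀ y ∈ U, dist (g x) (g y) = dist x y) :
    ∃ A : E ≃ᵃⁱ[ℝ] E, ∀ x ∈ K, g x = A x := by
  have hloc : ∀ c ∈ K, ∃ A : E ≃ᵃⁱ[ℝ] E, ∀ᶠ x in 𝓝 c, g x = A x := by
    intro c hc
    obtain ⟨U, hU, hg⟩ := h c hc
    obtain ⟨A, hA⟩ := exists_affineIsometryEquiv_of_isometric hg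
    exact ⟨A, by filter_upwards [hU] with x hx using (hA x hx).symm⟩
  obtain ⟨c₀, hc₀⟩ := hne
  obtain ⟨A, hA⟩ := hloc c₀ hc₀
  refine ⟨A, ?_⟩
  have hsub : K ⊆ {c | ∀ᶠ x in 𝓝 c, g x = A x} := by
    refine hK.subset_of_closure_inter_subset ?_ ⟨c₀, hc₀, hA⟩ ?_
    · exact isOpen_iff_mem_nhds.2 fun c hc => eventually_eventually_nhds.2 hc
    · rintro c ⟨hcl, hc⟩
      obtain ⟨B, hB⟩ := hloc c hc
      obtain ⟨d, hd, hdA⟩ := mem_closure_iff_nhds.1 hcl _ (eventually_eventually_nhds.2 hB)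
      have : B = A := eq_of_eventuallyEq (c := d) (by
        filter_upwards [hd, hdA] with x h₁ h₂ using h₁.symm.trans h₂)
      rwa [this] at hB
  exact fun x hx => (hsub hx).self_of_nhds

/-- Near a regular point, a chart of the space and the coordinates of a cell differ by a rigid
motion. -/
theorem IsChartAt.exists_affine (hP : IsPolyhedralSpace m P) {φ : P → E} {r : ℝ}
    (h : IsChartAt a φ r) (hi : a ∈ S.Q i) : ∃ A : E ≃ᵃⁱ[ℝ] E,
      ∀ c ∈ S.C i, dist c (coord S i a) < r →
        toP S i c ∈ Metric.ball a r ∧ φ (toP S i c) = A c := by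
  set p := coord S i a with hp
  have hball : ∀ c ∈ S.C i, dist c p < r → toP S i c ∈ Metric.ball a r := by
    intro c hc hcr
    have := dist_toP_le hc (coord_mem hi)
    rw [toP_coord hi] at this
    exact this.trans_lt hcr
  have hcl : ∀ c ∈ S.C i, dist c p < r → c ∈ closure (interior (S.C i) ∩ Metric.ball p r) := by
    intro c hc hcr
    have h₁ : c ∈ closure (interior (S.C i)) := by
      rw [(convex_C S i).closure_interior_eq_closure_of_nonempty_interior (S.interior_nonempty i)]
      exact subset_closure hc
    rw [inter_comm]
    exact Metric.isOpen_ball.inter_closure ⟨hcr, h₁⟩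
  obtain ⟨A, hA⟩ := exists_affineIsometryEquiv_of_locally
    (K := interior (S.C i) ∩ Metric.ball p r) (g := fun c => φ (toP S i c))
    ((convex_C S i).interior.inter (convex_ball _ _)).isPreconnected
    (by
      have := hcl p (coord_mem hi) (by rw [dist_self]; exact h.pos)
      exact closure_nonempty_iff.1 ⟨p, this⟩)
    (by
      rintro c ⟨hc, hcr⟩
      have hcC := interior_subset hc
      obtain ⟨q, hq, hqU, hq'⟩ := exists_ball_dist_coord_eq hP (toP_mem hcC)
        ((coord_toP hcC).symm ▸ hc)
      have hcont : ContinuousAt (toP S i) c :=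
        (continuousOn_toP S i).continuousAt (mem_interior_iff_mem_nhds.1 hc)
      refine ⟨interior (S.C i) ∩ Metric.ball p r ∩ toP S i ⁻¹' Metric.ball (toP S i c) q,
        inter_mem ((isOpen_interior.inter Metric.isOpen_ball).mem_nhds ⟨hc, hcr⟩)
          (hcont.preimage_mem_nhds (Metric.ball_mem_nhds _ hq)), ?_⟩
      rintro x ⟨⟨hx, hxr⟩, hxq⟩ y ⟨⟨hy, hyr⟩, hyq⟩
      have hxC := interior_subset hx
      have hyC := interior_subset hy
      rw [h.dist_eq _ (hball _ hxC hxr) _ (hball _ hyC hyr), ← hq' _ hxq _ hyq, coord_toP hxC,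
        coord_toP hyC])
  refine ⟨A, fun c hc hcr => ⟨hball c hc hcr, ?_⟩⟩
  have hφ : ContinuousOn φ (Metric.ball a r) :=
    (LipschitzOnWith.of_dist_le_mul (K := 1) fun x hx y hy => by
      simpa using (h.dist_eq x hx y hy).le).continuousOn
  have hEq : EqOn (fun c => φ (toP S i c)) A (S.C i ∩ Metric.ball p r) := by
    refine EqOn.of_subset_closure (s := interior (S.C i) ∩ Metric.ball p r) (fun x hx => hA x hx)
      ?_ A.continuous.continuousOn (inter_subset_inter_left _ interior_subset)
      fun x hx => hcl x hx.1 hx.2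
    exact hφ.comp ((continuousOn_toP S i).mono inter_subset_left) fun x hx => hball x hx.1 hx.2
  exact hEq ⟨hc, hcr⟩

theorem apply_add_smul (A : E ≃ᵃⁱ[ℝ] E) (p u : E) :
    A (p + A.linearIsometryEquiv.symm u) = A p + u := by
  have := A.map_vadd p (A.linearIsometryEquiv.symm u)
  rw [LinearIsometryEquiv.apply_symm_apply, vadd_eq_add, vadd_eq_add] at this
  rw [add_comm p, this, add_comm]

/-- Cells which meet at a regular point lie on opposite sides of a hyperplane of a chart. -/
theorem IsChartAt.normal_eq_neg {φ : P → E} {r : ℝ} (h : IsChartAt a φ r) (hij : i ≠ j)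
    (hi : a ∈ S.Q i) (hj : a ∈ S.Q j) {A B : E ≃ᵃⁱ[ℝ] E}
    (hA : ∀ c ∈ S.C i, dist c (coord S i a) < r → toP S i c ∈ Metric.ball a r ∧ φ (toP S i c) = A c)
    (hB : ∀ c ∈ S.C j, dist c (coord S j a) < r → toP S j c ∈ Metric.ball a r ∧ φ (toP S j c) = B c)
    {n n' : E} (hn : SmoothAt (S.C i) n (coord S i a)) (hn' : SmoothAt (S.C j) n' (coord S j a)) :
    B.linearIsometryEquiv n' = -A.linearIsometryEquiv n := by
  set v := A.linearIsometryEquiv n with hv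
  set w := B.linearIsometryEquiv n' with hw
  have hv1 : ‖v‖ = 1 := by rw [hv, LinearIsometryEquiv.norm_map, hn.norm_eq]
  have hw1 : ‖w‖ = 1 := by rw [hw, LinearIsometryEquiv.norm_map, hn'.norm_eq]
  -- a direction which points into both cells would lead to common interior points
  have key : ∀ u : E, inner ℝ v u < 0 → ¬ inner ℝ w u < 0 := by
    intro u hu hu'
    have step : ∀ {l : ι} {T : E ≃ᵃⁱ[ℝ] E} {ν : E}, a ∈ S.Q l → SmoothAt (S.C l) ν (coord S l a) →
        inner ℝ (T.linearIsometryEquiv ν) u < 0 → ∀ᶠ ε in 𝓝[>] (0 : ℝ),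
          coord S l a + T.linearIsometryEquiv.symm (ε • u) ∈ interior (S.C l) ∧
          dist (coord S l a + T.linearIsometryEquiv.symm (ε • u)) (coord S l a) < r := by
      intro l T ν hl hν hlt
      have hcont : Tendsto (fun ε : ℝ => coord S l a + T.linearIsometryEquiv.symm (ε • u)) (𝓝[>] 0)
          (𝓝 (coord S l a)) := by
        have : Continuous fun ε : ℝ => coord S l a + T.linearIsometryEquiv.symm (ε • u) := by
          fun_prop
        have := this.tendsto 0
        simp only [zero_smul, map_zero, add_zero] at this
        exact this.mono_left nhdsWithin_le_nhds
      filter_upwards [hcont.eventually hν.eventually_mem_interior,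
        hcont.eventually (Metric.ball_mem_nhds _ h.pos), self_mem_nhdsWithin] with ε h₁ h₂ h₃
      refine ⟨h₁ ?_, h₂⟩
      have h₄ : inner ℝ ν (T.linearIsometryEquiv.symm (ε • u)) =
          ε * inner ℝ (T.linearIsometryEquiv ν) u := by
        rw [← LinearIsometryEquiv.inner_map_map T.linearIsometryEquiv,
          LinearIsometryEquiv.apply_symm_apply, real_inner_smul_right]
      rw [inner_add_right, h₄]
      linarith [mul_neg_of_pos_of_neg (show (0 : ℝ) < ε from h₃) hlt]
    obtain ⟨ε, ⟨h₁, h₂⟩, h₃, h₄⟩ := ((step (T := A) hi hn hu).and (step (T := B) hj hn' hu')).exists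
    obtain ⟨m₁, e₁⟩ := hA _ (interior_subset h₁) h₂
    obtain ⟨m₂, e₂⟩ := hB _ (interior_subset h₃) h₄
    have hAa := (hA _ (coord_mem hi) (by rw [dist_self]; exact h.pos)).2
    have hBa := (hB _ (coord_mem hj) (by rw [dist_self]; exact h.pos)).2
    rw [toP_coord hi] at hAa
    rw [toP_coord hj] at hBa
    rw [apply_add_smul, ← hAa] at e₁
    rw [apply_add_smul, ← hBa] at e₂
    have hd := h.dist_eq _ m₁ _ m₂
    rw [e₁, e₂, dist_self, eq_comm, dist_eq_zero] at hd
    refine coord_notMem_interior hij (toP_mem (interior_subset h₁)) ?_ ?_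
    · rw [hd]; exact toP_mem (interior_subset h₃)
    · rwa [coord_toP (interior_subset h₁)]
  -- unless the unit vectors `v` and `w` are opposite, `-(v + w)` is such a direction
  have h₁ := key (-(v + w))
  simp only [inner_neg_right, inner_add_right, real_inner_self_eq_norm_sq, hv1, hw1] at h₁
  rw [real_inner_comm v w] at h₁
  have hcs : -1 ≤ inner ℝ v w := by
    have := abs_real_inner_le_norm v w
    rw [hv1, hw1, mul_one] at this
    exact (abs_le.1 this).1
  have heq : inner ℝ v w = (-1 : ℝ) := by
    by_contra hne
    have : -1 < inner ℝ v w := lt_of_le_of_ne hcs (Ne.symm hne)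
    exact h₁ (by linarith) (by linarith)
  have h₂ : ‖w + v‖ ^ 2 = 0 := by
    rw [norm_add_sq_real, real_inner_comm, heq, hv1, hw1]; norm_num
  exact eq_neg_of_add_eq_zero_left (norm_eq_zero.1 (by simpa using h₂))

/-- No three cells meet at a regular point. -/
theorem eq_or_eq_of_mem_regularLocus (hP : IsPolyhedralSpace m P) (ha : a ∈ regularLocus m P)
    (hsm : ∀ l l', l ≠ l' → a ∈ S.Q l → a ∈ S.Q l' → ∃ n, SmoothAt (S.C l) n (coord S l a))
    (hij : i ≠ j) (hi : a ∈ S.Q i) (hj : a ∈ S.Q j) (hk : a ∈ S.Q k) : k = i ∨ k = j := by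
  by_contra hcon
  push Not at hcon
  obtain ⟨φ, r, h⟩ := exists_isChartAt ha
  obtain ⟨A, hA⟩ := h.exists_affine hP hi
  obtain ⟨B, hB⟩ := h.exists_affine hP hj
  obtain ⟨C, hC⟩ := h.exists_affine hP hk
  obtain ⟨n, hn⟩ := hsm i j hij hi hj
  obtain ⟨n', hn'⟩ := hsm j i hij.symm hj hi
  obtain ⟨n'', hn''⟩ := hsm k i hcon.1 hk hi
  have h₁ := h.normal_eq_neg hij hi hj hA hB hn hn'
  have h₂ := h.normal_eq_neg hcon.1.symm hi hk hA hC hn hn''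
  have h₃ := h.normal_eq_neg hcon.2.symm hj hk hB hC hn' hn''
  -- three unit vectors cannot be opposite to one another
  rw [h₂, h₁, neg_neg, neg_eq_iff_add_eq_zero, ← two_smul ℝ, smul_eq_zero] at h₃
  have h₄ := h₃.resolve_left two_ne_zero
  have := hn.norm_eq
  rw [← LinearIsometryEquiv.norm_map A.linearIsometryEquiv, h₄, norm_zero] at this
  exact zero_ne_one this

end Regular

/-! ### Unfolding two adjacent cells -/

section Hinge

variable {m : ℕ} {P : Type*} [MetricSpace P] {ι : Type*} {S : ConvexSubdivision m P ι}
  {i j k : ι} {a x y : P} {Z : Set P} {n n' : EuclideanSpace ℝ (Fin m)}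
  {A : EuclideanSpace ℝ (Fin m) ≃ᵃⁱ[ℝ] EuclideanSpace ℝ (Fin m)}

local notation "E" => EuclideanSpace ℝ (Fin m)

variable (S i j Z a n n' A) in
/-- The point `a` lies in the relative interior of a facet `Z` between `Q i` and `Q j`, and in no
other cell. The motion `A` unfolds `Q j`: it places the second cell, in its coordinates, next to the
first one. -/
structure IsHinge : Prop where
  commonFace : CommonFace S i j Z
  mem : a ∈ Z
  left : SmoothAt (S.C i) n (coord S i a)
  right : SmoothAt (S.C j) n' (coord S j a)
  eq_or_eq : ∀ k, a ∈ S.Q k → k = i ∨ k = j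
  ne : i ≠ j
  apply_coord : ∀ x ∈ Z, A (coord S j x) = coord S i x
  normal : A.linearIsometryEquiv n' = -n

theorem IsHinge.mem_left (h : IsHinge S i j a Z n n' A) : a ∈ S.Q i :=
  h.commonFace.subset_left h.mem

theorem IsHinge.mem_right (h : IsHinge S i j a Z n n' A) : a ∈ S.Q j :=
  h.commonFace.subset_right h.mem

theorem apply_sub (A : E ≃ᵃⁱ[ℝ] E) (x y : E) :
    A x - A y = A.linearIsometryEquiv (x - y) :=
  (A.map_vsub x y).symm

/-- The second cell lies, after unfolding, on the other side of the hyperplane. -/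
theorem IsHinge.inner_apply (h : IsHinge S i j a Z n n' A) (c : E) :
    inner ℝ n (A c) - inner ℝ n (coord S i a) = inner ℝ n' (coord S j a) - inner ℝ n' c := by
  rw [← h.apply_coord a h.mem, ← inner_sub_right, apply_sub, ← neg_neg n, ← h.normal,
    inner_neg_left, LinearIsometryEquiv.inner_map_map, inner_sub_right]
  ring

theorem IsHinge.symm (h : IsHinge S i j a Z n n' A) : IsHinge S j i a Z n' n A.symm where
  commonFace := h.commonFace.symm
  mem := h.mem
  left := h.right
  right := h.left
  eq_or_eq k hk := (h.eq_or_eq k hk).symm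
  ne := h.ne.symm
  apply_coord x hx := by rw [← h.apply_coord x hx, AffineIsometryEquiv.symm_apply_apply]
  normal := by
    have : A.linearIsometryEquiv (-n') = n := by rw [map_neg, h.normal, neg_neg]
    rw [← this]
    exact A.linearIsometryEquiv.symm_apply_apply (-n')

/-- Orthogonal projection to a hyperplane. -/
noncomputable def hyperplaneProj (n p c : EuclideanSpace ℝ (Fin m)) : EuclideanSpace ℝ (Fin m) :=
  c - (inner ℝ n c - inner ℝ n p : ℝ) • n

theorem inner_hyperplaneProj (hn : ‖n‖ = 1) (p c : E) :
    inner ℝ n (hyperplaneProj n p c) = inner ℝ n p := by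
  rw [hyperplaneProj, inner_sub_right, real_inner_smul_right, real_inner_self_eq_norm_sq, hn]
  ring

theorem hyperplaneProj_eq_self {p c : E} (h : inner ℝ n c = inner ℝ n p) :
    hyperplaneProj n p c = c := by
  rw [hyperplaneProj, h, sub_self, zero_smul, sub_zero]

theorem dist_hyperplaneProj_le (hn : ‖n‖ = 1) (p c d : E) :
    dist (hyperplaneProj n p c) (hyperplaneProj n p d) ≤ dist c d := by
  rw [dist_eq_norm, dist_eq_norm]
  have e : hyperplaneProj n p c - hyperplaneProj n p d = (c - d) - (inner ℝ n (c - d) : ℝ) • n := by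
    simp only [hyperplaneProj, inner_sub_right, sub_smul]
    abel
  rw [e]
  refine le_of_sq_le_sq ?_ (norm_nonneg _)
  rw [norm_sub_sq_real, norm_smul, hn, real_inner_smul_right, real_inner_comm, mul_one,
    Real.norm_eq_abs, sq_abs]
  nlinarith [sq_nonneg (inner ℝ n (c - d) : ℝ)]

theorem IsHinge.eventually_cells (h : IsHinge S i j a Z n n' A) :
    ∀ᶠ y in 𝓝 a, (y ∈ S.Q i ∨ y ∈ S.Q j) ∧ (y ∈ S.Q i → y ∈ S.Q j → y ∈ Z) := by
  filter_upwards [eventually_cells_subset S a, eventually_inner_coord_eq h.mem_left h.left]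
    with y hy hy'
  constructor
  · obtain ⟨k, hk⟩ := exists_cell S y
    rcases h.eq_or_eq k (hy k hk) with rfl | rfl
    · exact Or.inl hk
    · exact Or.inr hk
  · intro hi hj
    exact (h.commonFace.mem_iff h.mem h.left).2 ⟨hi, hy' j h.ne.symm hi hj⟩

/-- A curve near `a` with both ends in `Q i` is no shorter than their distance in coordinates: the
part of the curve in `Q j` is projected to the facet. -/
theorem IsHinge.exists_fold (h : IsHinge S i j a Z n n' A) :
    ∃ U ∈ 𝓝 a, ∀ τ : unitInterval → P, Continuous τ → (∀ u, τ u ∈ U) → ∀ s t, τ s ∈ S.Q i →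
      τ t ∈ S.Q i → edist (coord S i (τ s)) (coord S i (τ t)) ≤ eVariationOn τ (uIcc s t) := by
  classical
  set p := coord S i a with hp
  let pr : P → E := fun y => hyperplaneProj n p (A (coord S j y))
  have hprA : ∀ y, inner ℝ n (pr y) = inner ℝ n p := fun y =>
    inner_hyperplaneProj h.left.norm_eq _ _
  have hprcont : ContinuousOn pr (S.Q j) := by
    have h₁ : Continuous (hyperplaneProj n p) := by unfold hyperplaneProj; fun_prop
    exact h₁.comp_continuousOn (A.continuous.comp_continuousOn (continuousOn_coord S j))
  have hpra : pr a = p := by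
    simp only [pr]
    rw [h.apply_coord a h.mem, hyperplaneProj_eq_self rfl]
  have hpr : ∀ᶠ y in 𝓝 a, y ∈ S.Q j → pr y ∈ S.C i := by
    have h₁ := hprcont a h.mem_right
    rw [ContinuousWithinAt, hpra] at h₁
    have := h₁.eventually h.left.eventually
    rw [eventually_nhdsWithin_iff] at this
    filter_upwards [this] with y hy hyj
    exact hy hyj (hprA y).le
  have hU := h.eventually_cells.and hpr
  refine ⟨_, hU, fun τ hτ hτU => ?_⟩
  -- the curve is retracted to `Q i`
  let Θ : P → P := fun y => if y ∈ S.Q i then y else toP S i (pr y)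
  have hΘi : ∀ y, y ∈ S.Q i → Θ y = y := fun y hy => if_pos hy
  have hΘj : ∀ u, τ u ∈ S.Q j → Θ (τ u) = toP S i (pr (τ u)) := by
    intro u hu
    by_cases hi : τ u ∈ S.Q i
    · have hz := (hτU u).1.2 hi hu
      have h₁ : pr (τ u) = coord S i (τ u) := by
        simp only [pr]
        rw [h.apply_coord _ hz, hyperplaneProj_eq_self ((h.commonFace.mem_iff h.mem h.left).1 hz).2]
      rw [hΘi _ hi, h₁, toP_coord hi]
    · exact if_neg hi
  have hci : IsClosed (τ ⁻¹' S.Q i) := (S.isClosed i).preimage hτ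
  have hcj : IsClosed (τ ⁻¹' S.Q j) := (S.isClosed j).preimage hτ
  have hmemC : ∀ u, τ u ∈ S.Q j → pr (τ u) ∈ S.C i := fun u hu => (hτU u).2 hu
  have hmem : ∀ u, Θ (τ u) ∈ S.Q i := by
    intro u
    rcases (hτU u).1.1 with hu | hu
    · rwa [hΘi _ hu]
    · rw [hΘj u hu]
      exact toP_mem (hmemC u hu)
  have hcont : Continuous fun u => Θ (τ u) := by
    rw [← continuousOn_univ]
    have huniv : (univ : Set unitInterval) = τ ⁻¹' S.Q i ∪ τ ⁻¹' S.Q j :=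
      (eq_univ_of_forall fun u => (hτU u).1.1).symm
    rw [huniv]
    refine ContinuousOn.union_of_isClosed ?_ ?_ hci hcj
    · exact hτ.continuousOn.congr fun u hu => hΘi _ hu
    · refine ContinuousOn.congr (f := fun u => toP S i (pr (τ u))) ?_ fun u hu => hΘj u hu
      exact (continuousOn_toP S i).comp (hprcont.comp hτ.continuousOn fun u hu => hu)
        fun u hu => hmemC u hu
  -- the projection does not increase the length of an arc in `Q j`
  have harc : ∀ u v, (∀ w ∈ uIcc u v, τ w ∈ S.Q j) →
      edist (Θ (τ u)) (Θ (τ v)) ≤ eVariationOn τ (uIcc u v) := by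
    intro u v huv
    have hu := huv u left_mem_uIcc
    have hv := huv v right_mem_uIcc
    rw [hΘj u hu, hΘj v hv]
    refine (edist_toP_le (hmemC u hu) (hmemC v hv)).trans (le_trans ?_ (edist_coord_le hτ huv))
    rw [edist_dist, edist_dist]
    refine ENNReal.ofReal_le_ofReal ((dist_hyperplaneProj_le h.left.norm_eq _ _ _).trans ?_)
    rw [A.dist_map]
  -- arcs with at least one end in `Q i` are cut at the facet
  have hone : ∀ u v, τ u ∈ S.Q i → edist (Θ (τ u)) (Θ (τ v)) ≤ eVariationOn τ (uIcc u v) := by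
    intro u v hu
    by_cases hv : τ v ∈ S.Q i
    · rw [hΘi _ hu, hΘi _ hv]
      exact eVariationOn.edist_le τ left_mem_uIcc right_mem_uIcc
    · have hv' := (hτU v).1.1.resolve_left hv
      obtain ⟨w, hw, hwj, hwi, hwsub⟩ := exists_mem_inter_uIcc hcj hci (u := v) (v := u)
        (fun w _ => (hτU w).1.1.symm) hv' hu
      have hw' : w ∈ uIcc u v := by rwa [uIcc_comm]
      rw [← eVariationOn_uIcc_add hw']
      refine (edist_triangle _ (Θ (τ w)) _).trans (add_le_add ?_ ?_)
      · rw [hΘi _ hu, hΘi _ hwi]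
        exact eVariationOn.edist_le τ left_mem_uIcc right_mem_uIcc
      · exact harc w v fun q hq => hwsub (by rwa [uIcc_comm])
  have hall : ∀ u v, edist (Θ (τ u)) (Θ (τ v)) ≤ eVariationOn τ (uIcc u v) := by
    intro u v
    by_cases hu : τ u ∈ S.Q i
    · exact hone u v hu
    · have hu' := (hτU u).1.1.resolve_left hu
      by_cases hex : ∃ w ∈ uIcc u v, τ w ∈ S.Q i
      · obtain ⟨w, hw, hwi⟩ := hex
        rw [← eVariationOn_uIcc_add hw]
        refine (edist_triangle _ (Θ (τ w)) _).trans (add_le_add ?_ (hone w v hwi))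
        rw [edist_comm, uIcc_comm]
        exact hone w u hwi
      · push Not at hex
        exact harc u v fun w hw => (hτU w).1.1.resolve_left (hex w hw)
  intro s t hs ht
  wlog hst : s ≤ t generalizing s t
  · rw [edist_comm, uIcc_comm]
    exact this t s ht hs (le_of_not_ge hst)
  have h₁ := edist_coord_le (S := S) (i := i) hcont (s := s) (t := t) fun u _ => hmem u
  rw [hΘi _ hs, hΘi _ ht] at h₁
  refine h₁.trans ?_
  rw [uIcc_of_le hst]
  refine eVariationOn_le_of_edist_le fun u _ v _ huv => ?_
  rw [← uIcc_of_le huv]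
  exact hall u v

variable (S i j A) in
open Classical in
/-- The two cells, placed next to each other in Euclidean space. -/
noncomputable def unfold (y : P) : EuclideanSpace ℝ (Fin m) :=
  if y ∈ S.Q i then coord S i y else A (coord S j y)

theorem unfold_of_mem (hy : y ∈ S.Q i) : unfold S i j A y = coord S i y := if_pos hy

theorem unfold_of_mem_right (hZ : y ∈ S.Q i → y ∈ Z) (hA : ∀ x ∈ Z, A (coord S j x) = coord S i x) :
    unfold S i j A y = A (coord S j y) := by
  by_cases hi : y ∈ S.Q i
  · rw [unfold_of_mem hi, hA y (hZ hi)]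
  · exact if_neg hi

/-- The unfolding does not increase the lengths of curves. -/
theorem IsHinge.exists_unfold_le (h : IsHinge S i j a Z n n' A) :
    ∃ U ∈ 𝓝 a, (∀ y ∈ U, (y ∈ S.Q i ∨ y ∈ S.Q j) ∧ (y ∈ S.Q i → y ∈ S.Q j → y ∈ Z)) ∧
      ∀ τ : unitInterval → P, Continuous τ → (∀ u, τ u ∈ U) → ∀ s t,
        edist (unfold S i j A (τ s)) (unfold S i j A (τ t)) ≤ eVariationOn τ (uIcc s t) := by
  obtain ⟨U₁, hU₁, h₁⟩ := h.exists_fold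
  obtain ⟨U₂, hU₂, h₂⟩ := h.symm.exists_fold
  refine ⟨{y | _} ∩ (U₁ ∩ U₂), inter_mem h.eventually_cells (inter_mem hU₁ hU₂),
    fun y hy => hy.1, fun τ hτ hτU => ?_⟩
  replace h₁ := h₁ τ hτ fun u => (hτU u).2.1
  replace h₂ := h₂ τ hτ fun u => (hτU u).2.2
  have hj : ∀ u, τ u ∈ S.Q j → unfold S i j A (τ u) = A (coord S j (τ u)) := fun u hu =>
    unfold_of_mem_right (fun hi => (hτU u).1.2 hi hu) h.apply_coord
  have hii : ∀ s t, τ s ∈ S.Q i → τ t ∈ S.Q i →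
      edist (unfold S i j A (τ s)) (unfold S i j A (τ t)) ≤ eVariationOn τ (uIcc s t) := by
    intro s t hs ht
    rw [unfold_of_mem hs, unfold_of_mem ht]
    exact h₁ s t hs ht
  have hjj : ∀ s t, τ s ∈ S.Q j → τ t ∈ S.Q j →
      edist (unfold S i j A (τ s)) (unfold S i j A (τ t)) ≤ eVariationOn τ (uIcc s t) := by
    intro s t hs ht
    rw [hj s hs, hj t ht, A.edist_map]
    exact h₂ s t hs ht
  have hij : ∀ s t, τ s ∈ S.Q i → τ t ∈ S.Q j →
      edist (unfold S i j A (τ s)) (unfold S i j A (τ t)) ≤ eVariationOn τ (uIcc s t) := by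
    intro s t hs ht
    obtain ⟨w, hw, hwi, hwj, -⟩ := exists_mem_inter_uIcc ((S.isClosed i).preimage hτ)
      ((S.isClosed j).preimage hτ) (fun w _ => (hτU w).1.1) hs ht
    rw [← eVariationOn_uIcc_add hw]
    exact (edist_triangle _ _ _).trans (add_le_add (hii s w hs hwi) (hjj w t hwj ht))
  intro s t
  rcases (hτU s).1.1 with hs | hs <;> rcases (hτU t).1.1 with ht | ht
  · exact hii s t hs ht
  · exact hij s t hs ht
  · rw [edist_comm, uIcc_comm]
    exact hij t s ht hs
  · exact hjj s t hs ht

/-- Smooth points of a facet between exactly two cells are regular. -/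
theorem IsHinge.mem_regularLocus (hP : IsPolyhedralSpace m P) (h : IsHinge S i j a Z n n' A) :
    a ∈ regularLocus m P := by
  obtain ⟨U, hU, hUc, hUτ⟩ := h.exists_unfold_le
  obtain ⟨r, hr, hrU, hle⟩ := exists_ball_dist_le hP hU fun τ hτ hτU => hUτ τ hτ hτU 0 1
  set D := unfold S i j A with hD
  set p := coord S i a with hp
  have hDa : D a = p := unfold_of_mem h.mem_left
  have hDj : ∀ y ∈ Metric.ball a r, y ∈ S.Q j → D y = A (coord S j y) := fun y hy hyj =>
    unfold_of_mem_right (fun hi => (hUc y (hrU hy)).2 hi hyj) h.apply_coord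
  have hAp : A (coord S j a) = p := h.apply_coord a h.mem
  obtain ⟨q₁, hq₁, hC₁⟩ := Metric.eventually_nhds_iff_ball.1 h.left.eventually
  obtain ⟨q₂, hq₂, hC₂⟩ := Metric.eventually_nhds_iff_ball.1 h.right.eventually
  set q := min r (min q₁ q₂) with hq
  have hq0 : 0 < q := lt_min hr (lt_min hq₁ hq₂)
  have hballs : Metric.ball a q ⊆ Metric.ball a r := Metric.ball_subset_ball (min_le_left _ _)
  have hDball : ∀ y ∈ Metric.ball a q, D y ∈ Metric.ball p q := by
    intro y hy
    have := hle y (hballs hy) a (Metric.mem_ball_self hr)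
    rw [hDa] at this
    exact this.trans_lt hy
  -- upper bounds for distances in `P`
  have hii : ∀ x ∈ Metric.ball a q, ∀ y ∈ Metric.ball a q, x ∈ S.Q i → y ∈ S.Q i →
      dist x y ≤ dist (D x) (D y) := by
    intro x hx y hy hxi hyi
    have := dist_toP_le (coord_mem hxi) (coord_mem hyi)
    rw [toP_coord hxi, toP_coord hyi] at this
    rwa [hD, unfold_of_mem hxi, unfold_of_mem hyi]
  have hjj : ∀ x ∈ Metric.ball a q, ∀ y ∈ Metric.ball a q, x ∈ S.Q j → y ∈ S.Q j →
      dist x y ≤ dist (D x) (D y) := by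
    intro x hx y hy hxj hyj
    have := dist_toP_le (coord_mem hxj) (coord_mem hyj)
    rw [toP_coord hxj, toP_coord hyj] at this
    rwa [hDj x (hballs hx) hxj, hDj y (hballs hy) hyj, A.dist_map]
  have hij : ∀ x ∈ Metric.ball a q, ∀ y ∈ Metric.ball a q, x ∈ S.Q i → y ∈ S.Q j →
      dist x y ≤ dist (D x) (D y) := by
    intro x hx y hy hxi hyj
    have h₁ : inner ℝ n (D x) ≤ inner ℝ n p := by
      rw [hD, unfold_of_mem hxi]
      exact h.left.le _ (coord_mem hxi)
    have h₂ : inner ℝ n p ≤ inner ℝ n (D y) := by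
      have e := h.inner_apply (coord S j y)
      rw [← hDj y (hballs hy) hyj] at e
      linarith [h.right.le _ (coord_mem hyj)]
    -- the segment between the images meets the hyperplane
    obtain ⟨z, hz, hzn⟩ : ∃ z ∈ segment ℝ (D x) (D y), inner ℝ n z = inner ℝ n p :=
      (convex_segment (𝕜 := ℝ) (D x) (D y)).isPreconnected.intermediate_value
        (left_mem_segment ℝ _ _) (right_mem_segment ℝ _ _)
        (f := fun z => (inner ℝ n z : ℝ)) (by fun_prop) ⟨h₁, h₂⟩
    have hzb : z ∈ Metric.ball p q :=
      (convex_ball p q).segment_subset (hDball x hx) (hDball y hy) hz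
    have hzC : z ∈ S.C i := hC₁ z (Metric.ball_subset_ball
      ((min_le_right _ _).trans (min_le_left _ _)) hzb) hzn.le
    have hzZ : toP S i z ∈ Z := by
      rw [h.commonFace.mem_iff h.mem h.left, coord_toP hzC]
      exact ⟨toP_mem hzC, hzn⟩
    have h₃ := dist_toP_le (coord_mem hxi) hzC
    rw [toP_coord hxi] at h₃
    have h₄ := dist_toP_le (coord_mem (h.commonFace.subset_right hzZ)) (coord_mem hyj)
    rw [toP_coord hyj, toP_coord (h.commonFace.subset_right hzZ), ← A.dist_map, h.apply_coord _ hzZ,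
      coord_toP hzC, ← hDj y (hballs hy) hyj] at h₄
    have h₅ : D x = coord S i x := unfold_of_mem hxi
    rw [← h₅] at h₃
    calc dist x y ≤ dist x (toP S i z) + dist (toP S i z) y := dist_triangle _ _ _
      _ ≤ dist (D x) z + dist z (D y) := add_le_add h₃ h₄
      _ = dist (D x) (D y) := dist_add_dist_of_mem_segment hz
  refine mem_regularLocus_of_dist_eq (D := D) hq0 (fun x hx y hy =>
    le_antisymm (hle x (hballs hx) y (hballs hy)) ?_) ?_
  · rcases (hUc x (hrU (hballs hx))).1 with hx' | hx' <;>
      rcases (hUc y (hrU (hballs hy))).1 with hy' | hy'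
    · exact hii x hx y hy hx' hy'
    · exact hij x hx y hy hx' hy'
    · rw [dist_comm, dist_comm (D x)]
      exact hij y hy x hx hy' hx'
    · exact hjj x hx y hy hx' hy'
  · rw [hDa]
    filter_upwards [Metric.ball_mem_nhds p hq0] with z hz
    rcases le_total (inner ℝ n z : ℝ) (inner ℝ n p) with hzn | hzn
    · have hzC : z ∈ S.C i := hC₁ z (Metric.ball_subset_ball
        ((min_le_right _ _).trans (min_le_left _ _)) hz) hzn
      refine ⟨toP S i z, ?_, ?_⟩
      · have := dist_toP_le hzC (coord_mem h.mem_left)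
        rw [toP_coord h.mem_left] at this
        exact this.trans_lt hz
      · rw [hD, unfold_of_mem (toP_mem hzC), coord_toP hzC]
    · have hdist : dist (A.symm z) (coord S j a) = dist z p := by
        rw [← A.dist_map, A.apply_symm_apply, hAp]
      have hzb : A.symm z ∈ Metric.ball (coord S j a) q := by
        rw [Metric.mem_ball, hdist]; exact hz
      have hzC : A.symm z ∈ S.C j := by
        refine hC₂ _ (Metric.ball_subset_ball ((min_le_right _ _).trans (min_le_right _ _)) hzb) ?_
        have e := h.inner_apply (A.symm z)
        rw [A.apply_symm_apply] at e
        linarith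
      have hmem : toP S j (A.symm z) ∈ Metric.ball a q := by
        have := dist_toP_le hzC (coord_mem h.mem_right)
        rw [toP_coord h.mem_right] at this
        exact this.trans_lt hzb
      refine ⟨_, hmem, ?_⟩
      rw [hDj _ (hballs hmem) (toP_mem hzC), coord_toP hzC, A.apply_symm_apply]

end Hinge

/-! ### Facets -/

section Facets

variable {m : ℕ} {P : Type*} [MetricSpace P] {ι : Type*} {S : ConvexSubdivision m P ι}
  {i j k : ι} {a b x y : P} {Z Z' : Set P}

local notation "E" => EuclideanSpace ℝ (Fin m)

variable (S) in
/-- Subdivisions of polyhedral spaces such that the cells meet at regular points only along facets.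
-/
structure IsTame : Prop where
  isPolyhedralSpace : IsPolyhedralSpace m P
  exists_smoothAt : ∀ a ∈ regularLocus m P, ∀ i j, i ≠ j → a ∈ S.Q i → a ∈ S.Q j →
    ∃ n, SmoothAt (S.C i) n (coord S i a)

/-- A point of two cells lies on the boundary of both, and a boundary point which is not smooth lies
on a face of codimension two, hence it is singular. -/
theorem isTame_of_singular (hP : IsPolyhedralSpace m P)
    (hS : ∀ (i : ι) (F : Set (EuclideanSpace ℝ (Fin m))), IsFace (S.C i) F → faceDim F + 2 = m →
      cellImage (S.chart i) F ⊆ singularLocus m P) : IsTame S where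
  isPolyhedralSpace := hP
  exists_smoothAt a ha i j hij hi hj := by
    rcases mem_interior_or_smoothAt_or_face (S.isConvexPolyhedron i) (S.interior_nonempty i)
      (coord_mem hi) with h | h | ⟨F, hF, hdim, hmem⟩
    · exact absurd h (coord_notMem_interior hij hi hj)
    · exact h
    · exact absurd ha (hS i F hF hdim ((mem_cellImage_iff (IsFace.subset hF)).2 ⟨hi, hmem⟩))

theorem IsTame.eq_or_eq (hS : IsTame S) (ha : a ∈ regularLocus m P) (hij : i ≠ j) (hi : a ∈ S.Q i)
    (hj : a ∈ S.Q j) (hk : a ∈ S.Q k) : k = i ∨ k = j :=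
  eq_or_eq_of_mem_regularLocus hS.isPolyhedralSpace ha (hS.exists_smoothAt a ha) hij hi hj hk

/-- The unfolding of two cells along a facet is the same at all regular points of the facet. -/
theorem IsTame.exists_isHinge (hS : IsTame S) (hij : i ≠ j) (hZ : CommonFace S i j Z) (haZ : a ∈ Z)
    (ha : a ∈ regularLocus m P) : ∃ n n' A, IsHinge S i j a Z n n' A ∧
      ∀ b ∈ Z, b ∈ regularLocus m P → IsHinge S i j b Z n n' A := by
  obtain ⟨n, hn⟩ := hS.exists_smoothAt a ha i j hij (hZ.subset_left haZ) (hZ.subset_right haZ)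
  obtain ⟨n', hn'⟩ := hS.exists_smoothAt a ha j i hij.symm (hZ.subset_right haZ)
    (hZ.subset_left haZ)
  obtain ⟨A, hA, hAn⟩ := hZ.exists_unfolding haZ hn hn'
  have key : ∀ b ∈ Z, b ∈ regularLocus m P → IsHinge S i j b Z n n' A := by
    intro b hbZ hb
    have hsm : ∀ {i j ν}, CommonFace S i j Z → i ≠ j → SmoothAt (S.C i) ν (coord S i a) →
        SmoothAt (S.C i) ν (coord S i b) := by
      intro i j ν hZ hij hν
      obtain ⟨ν', hν'⟩ := hS.exists_smoothAt b hb i j hij (hZ.subset_left hbZ) (hZ.subset_right hbZ)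
      have h₁ := ((hZ.mem_iff haZ hν).1 hbZ).2
      have : ν = ν' := hν'.normal_eq hν.norm_eq fun y hy => h₁ ▸ hν.le y hy
      rwa [this]
    exact ⟨hZ, hbZ, hsm hZ hij hn, hsm hZ.symm hij.symm hn',
      fun k hk => hS.eq_or_eq hb hij (hZ.subset_left hbZ) (hZ.subset_right hbZ) hk, hij, hA, hAn⟩
  exact ⟨n, n', A, key a haZ ha, key⟩

/-- The regular points of a facet form a convex set. -/
theorem IsTame.combo_mem_regularLocus (hS : IsTame S) (hij : i ≠ j) (hZ : CommonFace S i j Z)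
    (hxZ : x ∈ Z) (hx : x ∈ regularLocus m P) (hyZ : y ∈ Z) (hy : y ∈ regularLocus m P)
    {s t : ℝ} (hs : 0 ≤ s) (ht : 0 ≤ t) (hst : s + t = 1) :
    toP S i (s • coord S i x + t • coord S i y) ∈ regularLocus m P := by
  obtain ⟨n, n', A, hx', h⟩ := hS.exists_isHinge hij hZ hxZ hx
  have hy' := h y hyZ hy
  have hbZ := hZ.combo_mem hxZ hyZ hs ht hst
  set b := toP S i (s • coord S i x + t • coord S i y) with hb
  have hC := convex_C S i (coord_mem hx'.mem_left) (coord_mem hy'.mem_left) hs ht hst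
  have hbi : coord S i b = s • coord S i x + t • coord S i y := coord_toP hC
  have hcombo : ∀ (T : E ≃ᵃⁱ[ℝ] E) (p q : E), T (s • p + t • q) = s • T p + t • T q := by
    intro T p q
    obtain rfl : s = 1 - t := by linarith
    rw [← AffineMap.lineMap_apply_module, ← AffineMap.lineMap_apply_module]
    exact T.toAffineEquiv.toAffineMap.apply_lineMap p q t
  have hbj : coord S j b = s • coord S j x + t • coord S j y := by
    refine A.injective ?_
    rw [hcombo, hx'.apply_coord b hbZ, hx'.apply_coord x hxZ, hx'.apply_coord y hyZ, hbi]
  have hbl : SmoothAt (S.C i) n (coord S i b) := by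
    rw [hbi]
    refine hx'.left.combo (convex_C S i) hy'.left ?_ hs ht hst
    exact ((hZ.mem_iff hyZ hy'.left).1 hxZ).2
  have hbr : SmoothAt (S.C j) n' (coord S j b) := by
    rw [hbj]
    refine hx'.right.combo (convex_C S j) hy'.right ?_ hs ht hst
    exact ((hZ.symm.mem_iff hyZ hy'.right).1 hxZ).2
  -- a third cell at `b` would contain the whole facet, in particular the regular point `x`
  have hinge : IsHinge S i j b Z n n' A := by
    refine ⟨hZ, hbZ, hbl, hbr, fun k hk => ?_, hij, hx'.apply_coord, hx'.normal⟩
    by_contra hcon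
    push Not at hcon
    obtain ⟨Z', hZ', hbZ'⟩ := exists_commonFace hcon.1.symm (hZ.subset_left hbZ) hk
    have hZZ := hZ.eq_of_smoothAt hZ' hbZ hbZ' hbl
    have hxk : x ∈ S.Q k := hZ'.subset_right (hZZ ▸ hxZ)
    rcases hx'.eq_or_eq k hxk with h | h
    · exact hcon.1 h
    · exact hcon.2 h
  exact hinge.mem_regularLocus hS.isPolyhedralSpace

variable (S) in
/-- The facets along which two cells meet at regular points. -/
def Facet : Type _ :=
  {Z : Set P // ∃ p : ι × ι, p.1 ≠ p.2 ∧ CommonFace S p.1 p.2 Z ∧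
    ∃ a, a ∈ Z ∧ a ∈ regularLocus m P}

/-- The two cells on the sides of a facet, in a chosen order. -/
noncomputable def Facet.sides (f : Facet S) : ι × ι := f.2.choose

theorem Facet.sides_ne (f : Facet S) : f.sides.1 ≠ f.sides.2 := f.2.choose_spec.1

theorem Facet.commonFace (f : Facet S) : CommonFace S f.sides.1 f.sides.2 f.1 :=
  f.2.choose_spec.2.1

theorem Facet.exists_mem (f : Facet S) : ∃ a, a ∈ f.1 ∧ a ∈ regularLocus m P :=
  f.2.choose_spec.2.2

theorem Facet.sides_eq_or (hS : IsTame S) (f : Facet S) (ha : a ∈ regularLocus m P) (haf : a ∈ f.1)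
    (hij : i ≠ j) (hi : a ∈ S.Q i) (hj : a ∈ S.Q j) : f.sides = (i, j) ∨ f.sides = (j, i) := by
  have hf := f.sides_ne
  have h₁ := hS.eq_or_eq ha hij hi hj (f.commonFace.subset_left haf)
  have h₂ := hS.eq_or_eq ha hij hi hj (f.commonFace.subset_right haf)
  rcases h₁ with h₁ | h₁ <;> rcases h₂ with h₂ | h₂
  · exact absurd (h₁.trans h₂.symm) hf
  · exact Or.inl (Prod.ext h₁ h₂)
  · exact Or.inr (Prod.ext h₁ h₂)
  · exact absurd (h₁.trans h₂.symm) hf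

theorem exists_facet (ha : a ∈ regularLocus m P) (hij : i ≠ j)
    (hi : a ∈ S.Q i) (hj : a ∈ S.Q j) : ∃ f : Facet S, a ∈ f.1 := by
  obtain ⟨Z, hZ, haZ⟩ := exists_commonFace hij hi hj
  exact ⟨⟨Z, (i, j), hij, hZ, a, haZ, ha⟩, haZ⟩

theorem Facet.eq_of_mem (hS : IsTame S) {f g : Facet S} (ha : a ∈ regularLocus m P) (hf : a ∈ f.1)
    (hg : a ∈ g.1) : f = g := by
  have hfi := f.commonFace.subset_left hf
  have hfj := f.commonFace.subset_right hf
  obtain ⟨n, hn⟩ := hS.exists_smoothAt a ha _ _ f.sides_ne hfi hfj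
  rcases g.sides_eq_or hS ha hg f.sides_ne hfi hfj with h | h
  · have hc := g.commonFace
    rw [h] at hc
    exact Subtype.ext (f.commonFace.eq_of_smoothAt hc hf hg hn)
  · have hc := g.commonFace.symm
    rw [h] at hc
    exact Subtype.ext (f.commonFace.eq_of_smoothAt hc hf hg hn)

end Facets

/-! ### Labels of path classes -/

section Labels

variable {Y : Type*} [TopologicalSpace Y] {G : Type*} [Group G] {α : Type*}

/-- The bundle with discrete fiber `G` whose transition functions are the right multiplications by
the quotients of the functions `c`. -/
def cocycleCore [TopologicalSpace G] [DiscreteTopology G] (U : α → Set Y) (hU : ∀ i, IsOpen (U i))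
    (idx : Y → α) (hidx : ∀ y, y ∈ U (idx y)) (c : α → Y → G)
    (hc : ∀ i j, ∀ y ∈ U i ∩ U j, ∀ᶠ z in 𝓝 y, c i z * (c j z)⁻¹ = c i y * (c j y)⁻¹) :
    FiberBundleCore α Y G where
  baseSet := U
  isOpen_baseSet := hU
  indexAt := idx
  mem_baseSet_at := hidx
  coordChange i j y v := v * (c i y * (c j y)⁻¹)
  coordChange_self i y _ v := by group
  continuousOn_coordChange i j := by
    rintro ⟨y, v⟩ ⟨hy, -⟩
    refine ContinuousAt.continuousWithinAt ?_
    have h₁ : ∀ᶠ p : Y × G in 𝓝 (y, v), p.2 * (c i p.1 * (c j p.1)⁻¹) =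
        p.2 * (c i y * (c j y)⁻¹) := by
      have := (continuous_fst (X := Y) (Y := G)).tendsto (y, v)
      filter_upwards [this.eventually (hc i j y hy)] with p hp
      rw [hp]
    refine ContinuousAt.congr_of_eventuallyEq ?_ h₁
    exact (continuous_of_discreteTopology
      (f := fun g : G => g * (c i y * (c j y)⁻¹))).continuousAt.comp continuous_snd.continuousAt
  coordChange_comp i j k y _ v := by group

/-- A cocycle which is locally constant up to left multiplication can be integrated along path
classes: by the monodromy of the covering space which it defines. -/
theorem exists_label (U : α → Set Y) (hU : ∀ i, IsOpen (U i)) (hcov : ∀ y, ∃ i, y ∈ U i)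
    (c : α → Y → G)
    (hc : ∀ i j, ∀ y ∈ U i ∩ U j, ∀ᶠ z in 𝓝 y, c i z * (c j z)⁻¹ = c i y * (c j y)⁻¹) (x₀ : Y) :
    ∃ Λ : ∀ y, Path.Homotopic.Quotient x₀ y → G, ∀ (y z : Y) (κ : Path.Homotopic.Quotient x₀ y)
      (γ : Path y z) (i : α), (∀ t, γ t ∈ U i) →
        Λ z (κ.trans (Path.Homotopic.Quotient.mk γ)) = Λ y κ * (c i y)⁻¹ * c i z := by
  let _ : TopologicalSpace G := ⊥
  have : DiscreteTopology G := ⟨rfl⟩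
  choose idx hidx using hcov
  let Z := cocycleCore U hU idx hidx c hc
  have cov : IsCoveringMap Z.proj := FiberBundle.isCoveringMap (F := G) (E := Z.Fiber)
  let val : Z.TotalSpace → G := fun p => p.2
  -- the coordinate of the fiber, made independent of the choice of the trivialization
  let Ψ : Z.TotalSpace → G := fun p => val p * c (idx p.1) p.1
  let e₀ : Z.proj ⁻¹' {x₀} := ⟨⟨x₀, (1 : G)⟩, rfl⟩
  refine ⟨fun y κ => Ψ (cov.monodromy κ e₀).1, fun y z κ γ i hγ => ?_⟩
  simp only [cov.monodromy_trans_apply]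
  obtain ⟨q, hq⟩ := cov.monodromy κ e₀
  have hqy : q.1 = y := hq
  subst hqy
  set v : G := Ψ q * (c i q.1)⁻¹ with hv
  -- the lift of `γ` is constant in the trivialization over `U i`
  let Γ : C(unitInterval, Z.TotalSpace) :=
    { toFun := fun t => (Z.localTriv i).toOpenPartialHomeomorph.symm (γ t, v)
      continuous_toFun := by
        refine (Z.localTriv i).continuousOn_invFun.comp_continuous (by fun_prop) fun t => ?_
        rw [(Z.localTriv i).target_eq]
        exact ⟨hγ t, mem_univ _⟩ }
  have hΓ : ∀ t, Γ t = ⟨γ t, Z.coordChange i (idx (γ t)) (γ t) v⟩ := fun t => rfl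
  have hΓ0 : Γ 0 = q := by
    rw [hΓ, γ.source]
    have : Z.coordChange i (idx q.1) q.1 v = q.2 := by
      change v * (c i q.1 * (c (idx q.1) q.1)⁻¹) = val q
      rw [hv]
      change val q * c (idx q.1) q.1 * (c i q.1)⁻¹ * _ = val q
      group
    rw [this]
  have hlift := (cov.eq_liftPath_iff' (γ := (γ : C(unitInterval, Y))) (e := q)
    (by exact γ.source) (Γ := Γ)).2 ⟨?_, hΓ0⟩
  · have h1 : (cov.monodromy (Path.Homotopic.Quotient.mk γ) ⟨q, hq⟩).1 = Γ 1 := by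
      rw [hlift]; rfl
    rw [h1, hΓ, γ.target]
    change v * (c i z * (c (idx z) z)⁻¹) * c (idx z) z = _
    rw [hv]
    group
  · ext t
    rfl

end Labels

/-! ### Trees with labels in a free group -/

section FreeGroupLabels

variable {Φ : Type*}

/-- The inverse of a letter. -/
def letterInv (x : Φ × Bool) : Φ × Bool := (x.1, !x.2)

@[simp] theorem letterInv_letterInv (x : Φ × Bool) : letterInv (letterInv x) = x := by
  simp [letterInv]

theorem mk_letterInv (x : Φ × Bool) :
    FreeGroup.mk [letterInv x] = (FreeGroup.mk [x] : FreeGroup Φ)⁻¹ := by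
  simp [letterInv, FreeGroup.inv_mk, FreeGroup.invRev]

variable [DecidableEq Φ]

theorem toWord_letter_mul_of_eq {x : Φ × Bool} {g : FreeGroup Φ} {t : List (Φ × Bool)}
    (h : g.toWord = letterInv x :: t) : (FreeGroup.mk [x] * g).toWord = t := by
  have hred := FreeGroup.isReduced_toWord (x := g)
  rw [h] at hred
  have e : g = (FreeGroup.mk [x])⁻¹ * FreeGroup.mk t := by
    rw [← mk_letterInv, FreeGroup.mul_mk, List.singleton_append, ← h, FreeGroup.mk_toWord]
  rw [e, mul_inv_cancel_left, FreeGroup.toWord_mk]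
  exact (hred.infix (List.infix_cons List.infix_rfl)).reduce_eq

theorem toWord_letter_mul_of_ne {x : Φ × Bool} {g : FreeGroup Φ}
    (h : ∀ t, g.toWord ≠ letterInv x :: t) : (FreeGroup.mk [x] * g).toWord = x :: g.toWord := by
  have e : (FreeGroup.mk [x] * g).toWord = FreeGroup.reduce (x :: g.toWord) := by
    conv_lhs => rw [← FreeGroup.mk_toWord (x := g), FreeGroup.mul_mk, FreeGroup.toWord_mk]
    rfl
  rw [e, FreeGroup.reduce.cons, FreeGroup.reduce_toWord]
  cases hw : g.toWord with
  | nil => rfl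
  | cons y t =>
    have hy : ¬(x.1 = y.1 ∧ x.2 = !y.2) := by
      rintro ⟨h₁, h₂⟩
      refine h t ?_
      rw [hw]
      congr 1
      exact Prod.ext h₁.symm (by simp [letterInv, h₂])
    simp only [hy, if_false]

theorem norm_letter_mul (x : Φ × Bool) (g : FreeGroup Φ) :
    (FreeGroup.mk [x] * g).norm = g.norm + 1 ∨ g.norm = (FreeGroup.mk [x] * g).norm + 1 := by
  by_cases h : ∃ t, g.toWord = letterInv x :: t
  · obtain ⟨t, ht⟩ := h
    right
    rw [FreeGroup.norm, FreeGroup.norm, toWord_letter_mul_of_eq ht, ht]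
    rfl
  · push Not at h
    left
    rw [FreeGroup.norm, FreeGroup.norm, toWord_letter_mul_of_ne h]
    rfl

theorem norm_mul_letter (x : Φ × Bool) (g : FreeGroup Φ) :
    (g * FreeGroup.mk [x]).norm = g.norm + 1 ∨ g.norm = (g * FreeGroup.mk [x]).norm + 1 := by
  have h := norm_letter_mul (letterInv x) g⁻¹
  rwa [mk_letterInv, ← mul_inv_rev, FreeGroup.norm_inv_eq, FreeGroup.norm_inv_eq] at h

theorem toWord_mul_letter {x : Φ × Bool} {g : FreeGroup Φ}
    (h : (g * FreeGroup.mk [x]).norm = g.norm + 1) :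
    (g * FreeGroup.mk [x]).toWord = g.toWord ++ [x] := by
  have h₁ := FreeGroup.toWord_mul_sublist g (FreeGroup.mk [x])
  rw [FreeGroup.toWord_mk, FreeGroup.reduce_singleton] at h₁
  refine h₁.eq_of_length ?_
  rw [List.length_append]
  exact h

/-- A connected graph whose oriented edges carry letters, with compatible vertex labels in the free
group, such that at each vertex there is at most one edge with a given letter. -/
structure IsLabelledTree {T : Type*} (adj : T → T → Φ × Bool → Prop) (label : T → FreeGroup Φ) :
    Prop where
  label_eq : ∀ {c e x}, adj c e x → label e = label c * FreeGroup.mk [x]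
  symm : ∀ {c e x}, adj c e x → adj e c (letterInv x)
  unique : ∀ {c d e x}, adj c d x → adj c e x → d = e
  connected : ∀ p : T → Prop, (∀ c e x, adj c e x → p c → p e) → ∀ c e, p c → p e

variable {T : Type*} {adj : T → T → Φ × Bool → Prop} {label : T → FreeGroup Φ} {c c' e d : T}
  {x y : Φ × Bool}

/-- There is an edge path from `c` to `e` along which the labels form reduced words. -/
inductive IsGeodesicChain (adj : T → T → Φ × Bool → Prop) (label : T → FreeGroup Φ) (c : T) :
    T → Prop
  | refl : IsGeodesicChain adj label c c
  | step (d e : T) (x : Φ × Bool) (h : IsGeodesicChain adj label c d) (hx : adj d e x)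
      (hw : ((label e)⁻¹ * label c).toWord = letterInv x :: ((label d)⁻¹ * label c).toWord) :
      IsGeodesicChain adj label c e

/-- An edge from the end of a chain either returns along its last step, by uniqueness, or prolongs
the reduced word. -/
theorem IsLabelledTree.isGeodesicChain (h : IsLabelledTree adj label) (c e : T) :
    IsGeodesicChain adj label c e := by
  refine h.connected (IsGeodesicChain adj label c) (fun d e x hde hd => ?_) c e (.refl)
  have hlab : (label e)⁻¹ * label c = FreeGroup.mk [letterInv x] * ((label d)⁻¹ * label c) := by
    rw [h.label_eq hde, mk_letterInv]; group
  by_cases hw : ∃ t, ((label d)⁻¹ * label c).toWord = letterInv (letterInv x) :: t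
  · obtain ⟨t, ht⟩ := hw
    cases hd with
    | refl => simp at ht
    | step d' _ y h' hy hw =>
      rw [hw, letterInv_letterInv, List.cons.injEq] at ht
      have : adj d d' x := ht.1 ▸ h.symm hy
      rwa [h.unique hde this]
  · push Not at hw
    exact .step d e x hd hde (by rw [hlab, toWord_letter_mul_of_ne hw])

theorem IsLabelledTree.label_injective (h : IsLabelledTree adj label) (hce : label c = label e) :
    c = e := by
  cases h.isGeodesicChain c e with
  | refl => rfl
  | step d _ x _ _ hw => simp [hce] at hw

theorem IsLabelledTree.exists_nearer (h : IsLabelledTree adj label) (c e : T)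
    (hne : ((label c)⁻¹ * label e).norm ≠ 0) : ∃ d x, adj d e x ∧
      ((label c)⁻¹ * label e).norm = ((label c)⁻¹ * label d).norm + 1 := by
  cases h.isGeodesicChain c e with
  | refl => simp at hne
  | step d _ x _ hx hw =>
    refine ⟨d, x, hx, ?_⟩
    have hn : ∀ a b : FreeGroup Φ, (a⁻¹ * b).norm = (b⁻¹ * a).norm := fun a b => by
      rw [← FreeGroup.norm_inv_eq, mul_inv_rev, inv_inv]
    rw [hn, hn (label c) (label d), FreeGroup.norm, hw]
    rfl

theorem IsLabelledTree.alternative (h : IsLabelledTree adj label) (hx : adj c c' x) (e : T) :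
    ((label e)⁻¹ * label c').norm = ((label e)⁻¹ * label c).norm + 1 ∨
      ((label e)⁻¹ * label c).norm = ((label e)⁻¹ * label c').norm + 1 := by
  rw [h.label_eq hx, ← mul_assoc]
  exact norm_mul_letter x _

/-- An edge separates the vertices which are nearer to its origin from the other ones. -/
theorem IsLabelledTree.eq_of_separated (h : IsLabelledTree adj label) (hx : adj c c' x)
    (hy : adj d e y) (hd : ((label d)⁻¹ * label c').norm = ((label d)⁻¹ * label c).norm + 1)
    (he : ((label e)⁻¹ * label c).norm = ((label e)⁻¹ * label c').norm + 1) :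
    d = c ∧ e = c' := by
  set g := (label d)⁻¹ * label c with hg
  have h₁ : (label d)⁻¹ * label c' = g * FreeGroup.mk [x] := by rw [h.label_eq hx, ← mul_assoc]
  have h₂ : (label e)⁻¹ * label c = FreeGroup.mk [letterInv y] * g := by
    rw [h.label_eq hy, mk_letterInv, hg]; group
  have h₃ : (label e)⁻¹ * label c' = FreeGroup.mk [letterInv y] * (g * FreeGroup.mk [x]) := by
    rw [h.label_eq hy, h.label_eq hx, mk_letterInv, hg]; group
  rw [h₁] at hd
  rw [h₂, h₃] at he
  have hword := toWord_mul_letter hd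
  have hn₁ := norm_letter_mul (letterInv y) g
  have hn₂ := norm_letter_mul (letterInv y) (g * FreeGroup.mk [x])
  -- the letter `y` is the first one of the longer word, but not of the shorter one
  have hlt : (FreeGroup.mk [letterInv y] * g).norm = g.norm + 1 := by omega
  have hlt' : (FreeGroup.mk [letterInv y] * (g * FreeGroup.mk [x])).norm = g.norm := by omega
  have hex : ∃ t, (g * FreeGroup.mk [x]).toWord = letterInv (letterInv y) :: t := by
    by_contra hcon
    push Not at hcon
    have := congrArg List.length (toWord_letter_mul_of_ne hcon)
    rw [List.length_cons] at this
    change FreeGroup.norm _ = FreeGroup.norm _ + 1 at this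
    omega
  obtain ⟨t, ht⟩ := hex
  rw [hword, letterInv_letterInv] at ht
  cases hgw : g.toWord with
  | nil =>
    rw [hgw, List.nil_append, List.cons.injEq] at ht
    have hg1 := FreeGroup.toWord_eq_nil_iff.1 hgw
    rw [hg, inv_mul_eq_one] at hg1
    obtain rfl := h.label_injective hg1
    exact ⟨rfl, h.unique (ht.1 ▸ hy) hx⟩
  | cons z s =>
    rw [hgw, List.cons_append, List.cons.injEq] at ht
    have hz : g.toWord = letterInv (letterInv y) :: s := by rw [hgw, ht.1, letterInv_letterInv]
    have h₄ := congrArg List.length (toWord_letter_mul_of_eq hz)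
    change FreeGroup.norm _ = _ at h₄
    have h₅ : g.norm = s.length + 1 := by rw [FreeGroup.norm, hgw]; rfl
    omega

end FreeGroupLabels

/-! ### Homotopies in the regular locus -/

/-- Two paths in a subset which is a continuous image of a contractible set, with a continuous
section, are homotopic. -/
theorem homotopic_of_section {Y F : Type*} [TopologicalSpace Y] [TopologicalSpace F] {W : Set F}
    [ContractibleSpace W] {h : F → Y} (hh : ContinuousOn h W) {V : Set Y} {g : Y → F}
    (hg : ContinuousOn g V) (hgW : MapsTo g V W) (hhg : ∀ y ∈ V, h (g y) = y) {x y : Y}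
    (γ η : Path x y) (hγ : ∀ t, γ t ∈ V) (hη : ∀ t, η t ∈ V) : γ.Homotopic η := by
  have hx : x ∈ V := by simpa using hγ 0
  have hy : y ∈ V := by simpa using hγ 1
  let lift (σ : Path x y) (hσ : ∀ t, σ t ∈ V) : Path (⟨g x, hgW hx⟩ : W) ⟨g y, hgW hy⟩ :=
    { toFun := fun t => ⟨g (σ t), hgW (hσ t)⟩
      continuous_toFun := (hg.comp_continuous σ.continuous hσ).subtype_mk _
      source' := by simp
      target' := by simp }
  let H : C(W, Y) := ⟨fun w => h w, continuousOn_iff_continuous_domRestrict.1 hh⟩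
  have h₁ := (SimplyConnectedSpace.paths_homotopic (lift γ hγ) (lift η hη)).map H
  have h₂ := h₁.pathCast (hhg x hx).symm (hhg y hy).symm
  have e : ∀ (σ : Path x y) (hσ : ∀ t, σ t ∈ V),
      ((lift σ hσ).map H.continuous).cast (hhg x hx).symm (hhg y hy).symm = σ := by
    intro σ hσ
    ext t
    exact hhg _ (hσ t)
  rwa [e γ hγ, e η hη] at h₂

section Cover

variable {m : ℕ} {P : Type*} [MetricSpace P] {ι : Type*} {S : ConvexSubdivision m P ι}
  {i j k : ι} {x y z : regularLocus m P}

local notation "E" => EuclideanSpace ℝ (Fin m)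

variable (S) in
/-- The coordinates of the regular points of a cell. -/
def regDom (i : ι) : Set (EuclideanSpace ℝ (Fin m)) :=
  {c | c ∈ S.C i ∧ toP S i c ∈ regularLocus m P}

theorem coord_mem_regDom (hx : (x : P) ∈ S.Q i) : coord S i x ∈ regDom S i :=
  ⟨coord_mem hx, by rw [toP_coord hx]; exact x.2⟩

variable (S) in
/-- An interior point of a polyhedron. -/
noncomputable def centreCoord (i : ι) : EuclideanSpace ℝ (Fin m) := (S.interior_nonempty i).some

theorem centreCoord_mem_interior : centreCoord S i ∈ interior (S.C i) :=
  (S.interior_nonempty i).some_mem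

theorem IsTame.interior_subset_regDom (hS : IsTame S) : interior (S.C i) ⊆ regDom S i :=
  fun c hc => ⟨interior_subset hc, mem_regularLocus_of_mem_interior hS.isPolyhedralSpace
    (toP_mem (interior_subset hc)) (by rwa [coord_toP (interior_subset hc)])⟩

/-- All points except possibly the end point of the segment from the centre to a point of the cell
are interior points. -/
theorem lineMap_centreCoord_mem {c : E} (hc : c ∈ S.C i) {t : ℝ} (ht : 0 ≤ t) (ht1 : t < 1) :
    AffineMap.lineMap (centreCoord S i) c t ∈ interior (S.C i) := by
  rw [AffineMap.lineMap_apply_module]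
  exact (convex_C S i).combo_interior_closure_mem_interior centreCoord_mem_interior
    (subset_closure hc) (sub_pos.2 ht1) ht (by ring)

theorem IsTame.lineMap_mem_regDom (hS : IsTame S) {c : E} (hc : c ∈ regDom S i) {t : ℝ}
    (ht : t ∈ Icc (0 : ℝ) 1) : AffineMap.lineMap (centreCoord S i) c t ∈ regDom S i := by
  rcases ht.2.eq_or_lt with rfl | hlt
  · rwa [AffineMap.lineMap_apply_one]
  · exact hS.interior_subset_regDom (lineMap_centreCoord_mem hc.1 ht.1 hlt)

theorem IsTame.contractibleSpace_regDom (hS : IsTame S) (i : ι) :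
    ContractibleSpace (regDom S i) := by
  have : StarConvex ℝ (centreCoord S i) (regDom S i) := by
    intro c hc s t hs ht hst
    obtain rfl : s = 1 - t := by linarith
    rw [← AffineMap.lineMap_apply_module]
    exact hS.lineMap_mem_regDom hc ⟨ht, by linarith⟩
  exact this.contractibleSpace ⟨_, hS.interior_subset_regDom centreCoord_mem_interior⟩

theorem continuousOn_coord_regular (S : ConvexSubdivision m P ι) (i : ι) :
    ContinuousOn (fun y : regularLocus m P => coord S i y) {y | (y : P) ∈ S.Q i} :=
  (continuousOn_coord S i).comp continuous_subtype_val.continuousOn fun _ hy => hy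

/-- Paths of regular points in the same cell are homotopic. -/
theorem IsTame.homotopic_of_cell (hS : IsTame S) (γ η : Path x y) (hγ : ∀ t, (γ t : P) ∈ S.Q i)
    (hη : ∀ t, (η t : P) ∈ S.Q i) : γ.Homotopic η := by
  classical
  have := hS.contractibleSpace_regDom i
  let h : E → regularLocus m P := fun c => if hc : c ∈ regDom S i then ⟨toP S i c, hc.2⟩ else x
  have hval : ∀ c (hc : c ∈ regDom S i), h c = ⟨toP S i c, hc.2⟩ := fun c hc => dif_pos hc
  refine homotopic_of_section (W := regDom S i) (h := h) (V := {y | (y : P) ∈ S.Q i})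
    (g := fun y => coord S i y) ?_ (continuousOn_coord_regular S i)
    (fun y hy => coord_mem_regDom hy) (fun y hy => ?_) γ η hγ hη
  · rw [continuousOn_iff_continuous_domRestrict, continuous_induced_rng]
    refine Continuous.congr (f := fun c : regDom S i => toP S i c) ?_ fun c => ?_
    · exact (continuousOn_toP S i).comp_continuous continuous_subtype_val fun c => c.2.1
    · simp only [Function.comp_apply, domRestrict_apply, hval c c.2]
  · rw [hval _ (coord_mem_regDom hy)]
    exact Subtype.ext (toP_coord hy)

/-- A path which is given in the coordinates of a cell. -/
noncomputable def chartPath {p q : E} (c : Path p q) (hc : ∀ t, c t ∈ regDom S i)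
    (hp : toP S i p = x) (hq : toP S i q = y) : Path x y where
  toFun t := ⟨toP S i (c t), (hc t).2⟩
  continuous_toFun := Continuous.subtype_mk
    ((continuousOn_toP S i).comp_continuous c.continuous fun t => (hc t).1) _
  source' := Subtype.ext (by simpa using hp)
  target' := Subtype.ext (by simpa using hq)

theorem chartPath_mem {p q : E} (c : Path p q) (hc : ∀ t, c t ∈ regDom S i)
    (hp : toP S i p = x) (hq : toP S i q = y) (t) : (chartPath c hc hp hq t : P) ∈ S.Q i :=
  toP_mem (hc t).1

theorem chartPath_coe {p q : E} (c : Path p q) (hc : ∀ t, c t ∈ regDom S i)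
    (hp : toP S i p = x) (hq : toP S i q = y) (t) : (chartPath c hc hp hq t : P) = toP S i (c t) :=
  rfl

/-- The segment between two points. -/
noncomputable def segPath (p q : E) : Path p q where
  toFun t := AffineMap.lineMap p q (t : ℝ)
  continuous_toFun := by
    exact (AffineMap.lineMap_continuous (R := ℝ) (p := p) (q := q)).comp continuous_subtype_val
  source' := by simp
  target' := by simp

theorem segPath_apply (p q : E) (t : unitInterval) :
    segPath p q t = AffineMap.lineMap p q (t : ℝ) := rfl

/-- The centre of a cell. -/
noncomputable def IsTame.centre (hS : IsTame S) (i : ι) : regularLocus m P :=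
  ⟨toP S i (centreCoord S i), (hS.interior_subset_regDom centreCoord_mem_interior).2⟩

theorem IsTame.centre_mem (hS : IsTame S) (i : ι) : (hS.centre i : P) ∈ S.Q i :=
  toP_mem (interior_subset centreCoord_mem_interior)

/-- The segment from the centre of a cell to one of its regular points. -/
noncomputable def IsTame.spoke (hS : IsTame S) (hx : (x : P) ∈ S.Q i) : Path (hS.centre i) x :=
  chartPath (segPath (centreCoord S i) (coord S i x))
    (fun t => hS.lineMap_mem_regDom (coord_mem_regDom hx) t.2) rfl (toP_coord hx)

theorem IsTame.spoke_mem (hS : IsTame S) (hx : (x : P) ∈ S.Q i) (t) :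
    (hS.spoke hx t : P) ∈ S.Q i := chartPath_mem _ _ _ _ t

theorem IsTame.spoke_eq_or (hS : IsTame S) (hx : (x : P) ∈ S.Q i) (t) :
    coord S i (hS.spoke hx t) ∈ interior (S.C i) ∨ hS.spoke hx t = x := by
  rcases t.2.2.eq_or_lt with ht | ht
  · right
    have : t = 1 := Subtype.ext ht
    rw [this, Path.target]
  · left
    have h := lineMap_centreCoord_mem (coord_mem hx) t.2.1 ht
    change coord S i (toP S i (AffineMap.lineMap _ _ (t : ℝ))) ∈ _
    rwa [coord_toP (interior_subset h)]

open Path.Homotopic (Quotient)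

/-- The class of the paths in a cell from its centre to one of its points. -/
noncomputable def IsTame.spokeClass (hS : IsTame S) (hx : (x : P) ∈ S.Q i) :
    Path.Homotopic.Quotient (hS.centre i) x := .mk (hS.spoke hx)

theorem IsTame.spokeClass_eq (hS : IsTame S) (hx : (x : P) ∈ S.Q i) (γ : Path (hS.centre i) x)
    (hγ : ∀ t, (γ t : P) ∈ S.Q i) : hS.spokeClass hx = .mk γ :=
  Path.Homotopic.Quotient.eq.2 (hS.homotopic_of_cell _ _ (hS.spoke_mem hx) hγ)

theorem trans_mem {γ : Path x y} {η : Path y z} {V : Set P} (hγ : ∀ t, (γ t : P) ∈ V)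
    (hη : ∀ t, (η t : P) ∈ V) (t) : ((γ.trans η) t : P) ∈ V := by
  rw [Path.trans_apply]
  split_ifs
  · exact hγ _
  · exact hη _

theorem IsTame.spokeClass_trans (hS : IsTame S) (hx : (x : P) ∈ S.Q i) (hy : (y : P) ∈ S.Q i)
    (γ : Path x y) (hγ : ∀ t, (γ t : P) ∈ S.Q i) :
    (hS.spokeClass hx).trans (.mk γ) = hS.spokeClass hy := by
  rw [hS.spokeClass_eq hy ((hS.spoke hx).trans γ) (trans_mem (hS.spoke_mem hx) hγ)]
  rfl

theorem IsTame.spokeClass_centre (hS : IsTame S) (i : ι) :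
    hS.spokeClass (hS.centre_mem i) = .refl _ :=
  hS.spokeClass_eq _ (Path.refl _) fun _ => hS.centre_mem i

variable {x₀ : regularLocus m P}

variable (x₀) in
/-- The lifts of the cells to the universal cover. A lift is given by the class of the paths to the
lift of the centre. -/
abbrev IsTame.Lift (hS : IsTame S) : Type _ :=
  Σ i, Path.Homotopic.Quotient x₀ (hS.centre i)

/-- The point of the universal cover lies in the given lift of a cell. -/
def IsTame.MemLift (hS : IsTame S) (u : UniversalCover x₀) (e : hS.Lift x₀) : Prop :=
  ∃ h : (u.endpoint : P) ∈ S.Q e.1, u.pathClass = e.2.trans (hS.spokeClass h)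

/-- The point of the universal cover which is reached from the point `u` along the path `γ`. -/
noncomputable def UniversalCover.move (u : UniversalCover x₀) (γ : Path u.endpoint y) :
    UniversalCover x₀ :=
  ⟨y, u.pathClass.trans (.mk γ)⟩

theorem IsTame.exists_memLift (hS : IsTame S) (u : UniversalCover x₀)
    (h : (u.endpoint : P) ∈ S.Q i) : ∃ κ, hS.MemLift u ⟨i, κ⟩ := by
  refine ⟨u.pathClass.trans (hS.spokeClass h).symm, h, ?_⟩
  rw [Path.Homotopic.Quotient.trans_assoc, Path.Homotopic.Quotient.symm_trans,
    Path.Homotopic.Quotient.trans_refl]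

theorem IsTame.MemLift.eq (hS : IsTame S) {u : UniversalCover x₀} {e e' : hS.Lift x₀}
    (he : hS.MemLift u e) (he' : hS.MemLift u e') (h : e.1 = e'.1) : e = e' := by
  obtain ⟨i, κ⟩ := e
  obtain ⟨j, κ'⟩ := e'
  obtain rfl : i = j := h
  obtain ⟨h₁, h₂⟩ := he
  obtain ⟨h₃, h₄⟩ := he'
  rw [h₂] at h₄
  have := congrArg (fun q => Path.Homotopic.Quotient.trans q (hS.spokeClass h₁).symm) h₄
  simp only [Path.Homotopic.Quotient.trans_assoc, Path.Homotopic.Quotient.trans_symm,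
    Path.Homotopic.Quotient.trans_refl] at this
  rw [this]

/-- Lifts of cells are invariant under motion along curves in the cell. -/
theorem IsTame.memLift_move_iff (hS : IsTame S) {u : UniversalCover x₀} {e : hS.Lift x₀}
    (γ : Path u.endpoint y) (hγ : ∀ t, (γ t : P) ∈ S.Q e.1) :
    hS.MemLift (UniversalCover.move u γ) e ↔ hS.MemLift u e := by
  have hx : (u.endpoint : P) ∈ S.Q e.1 := by simpa using hγ 0
  have hy : (y : P) ∈ S.Q e.1 := by simpa using hγ 1
  have key := hS.spokeClass_trans hx hy γ hγ
  constructor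
  · rintro ⟨h₁, h₂⟩
    refine ⟨hx, ?_⟩
    change u.pathClass.trans (.mk γ) = e.2.trans (hS.spokeClass hy) at h₂
    rw [← key, ← Path.Homotopic.Quotient.trans_assoc] at h₂
    have := congrArg
      (fun q => Path.Homotopic.Quotient.trans q (Path.Homotopic.Quotient.mk γ).symm) h₂
    simpa only [Path.Homotopic.Quotient.trans_assoc, Path.Homotopic.Quotient.trans_symm,
      Path.Homotopic.Quotient.trans_refl] using this
  · rintro ⟨h₁, h₂⟩
    refine ⟨hy, ?_⟩
    change u.pathClass.trans (.mk γ) = e.2.trans (hS.spokeClass hy)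
    rw [h₂, ← key, Path.Homotopic.Quotient.trans_assoc]

/-- Near a point of the universal cover, there are no other lifts of cells than those which contain
the point. -/
theorem IsTame.exists_nhds_memLift (hS : IsTame S) (x : regularLocus m P) :
    ∃ U ∈ 𝓝 x, ∀ (u : UniversalCover x₀) (y : regularLocus m P) (γ : Path u.endpoint y),
      u.endpoint = x → (∀ t, γ t ∈ U) → ∀ e, hS.MemLift (UniversalCover.move u γ) e →
        hS.MemLift u e := by
  classical
  obtain ⟨φ, r, hφ⟩ := exists_isChartAt x.2
  have hcoord : ∀ᶠ y in 𝓝 (x : P), ∀ j, y ∈ S.Q j → (x : P) ∈ S.Q j ∧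
      dist (coord S j y) (coord S j x) < r := by
    have hfin : {j | (x : P) ∈ S.Q j}.Finite := S.locallyFinite.point_finite x
    have h₁ : ∀ᶠ y in 𝓝 (x : P), ∀ j ∈ {j | (x : P) ∈ S.Q j}, y ∈ S.Q j →
        dist (coord S j y) (coord S j x) < r := by
      rw [Filter.eventually_all_finite hfin]
      intro j hj
      have := (continuousOn_coord S j x hj).eventually (Metric.ball_mem_nhds _ hφ.pos)
      rwa [eventually_nhdsWithin_iff] at this
    filter_upwards [h₁, eventually_cells_subset S (x : P)] with y h h' j hj
    exact ⟨h' j hj, h j (h' j hj) hj⟩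
  refine ⟨Subtype.val ⁻¹' ({y | _} ∩ Metric.ball (x : P) r), continuous_subtype_val.continuousAt
    (inter_mem hcoord (Metric.ball_mem_nhds _ hφ.pos)), ?_⟩
  rintro u y γ rfl hγ e ⟨hy, he⟩
  change (y : P) ∈ S.Q e.1 at hy
  have hyU := hγ 1
  rw [γ.target] at hyU
  obtain ⟨hx, hd⟩ := hyU.1 e.1 hy
  -- the segment in the cell
  have hseg : ∀ t : unitInterval, segPath (coord S e.1 u.endpoint) (coord S e.1 y) t ∈ S.C e.1 ∧
      toP S e.1 (segPath (coord S e.1 u.endpoint) (coord S e.1 y) t) ∈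
        Metric.ball (u.endpoint : P) r := by
    intro t
    have hC : segPath (coord S e.1 u.endpoint) (coord S e.1 y) t ∈ S.C e.1 :=
      (convex_C S e.1).lineMap_mem (coord_mem hx) (coord_mem hy) t.2
    refine ⟨hC, ?_⟩
    have h₁ := dist_toP_le hC (coord_mem hx)
    rw [toP_coord hx, segPath_apply, dist_lineMap_left, Real.norm_of_nonneg t.2.1] at h₁
    rw [Metric.mem_ball]
    refine h₁.trans_lt (lt_of_le_of_lt ?_ (dist_comm (coord S e.1 y) _ ▸ hd))
    exact mul_le_of_le_one_left dist_nonneg t.2.2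
  let σ : Path u.endpoint y := chartPath (S := S) (i := e.1) (segPath _ _)
    (fun t => ⟨(hseg t).1, hφ.mem_regularLocus (hseg t).2⟩) (toP_coord hx) (toP_coord hy)
  -- both curves lie in a ball isometric to a Euclidean one
  have hhom : γ.Homotopic σ := by
    have : ContractibleSpace (Metric.ball (φ u.endpoint) r) :=
      Metric.contractibleSpace_ball hφ.pos
    have hinv : ∀ z : Metric.ball (φ u.endpoint) r, ∃ w : regularLocus m P,
        (w : P) ∈ Metric.ball (u.endpoint : P) r ∧ φ w = z := by
      rintro ⟨z, hz⟩
      obtain ⟨w, hw, hwz⟩ := hφ.surj z hz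
      exact ⟨⟨w, hφ.mem_regularLocus hw⟩, hw, hwz⟩
    choose h hball hh using hinv
    let h' : E → regularLocus m P := fun z =>
      if hz : z ∈ Metric.ball (φ u.endpoint) r then h ⟨z, hz⟩ else u.endpoint
    have hval : ∀ z : Metric.ball (φ u.endpoint) r, h' z = h z := fun z => dif_pos z.2
    have hisom : ∀ x ∈ Metric.ball (φ u.endpoint) r, ∀ y ∈ Metric.ball (φ u.endpoint) r,
        dist (h' x) (h' y) ≤ 1 * dist x y := by
      intro p hp q hq
      rw [hval ⟨p, hp⟩, hval ⟨q, hq⟩, Subtype.dist_eq, ← hφ.dist_eq _ (hball _) _ (hball _), hh, hh,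
        one_mul]
    have hφc : ContinuousOn φ (Metric.ball (u.endpoint : P) r) :=
      (LipschitzOnWith.of_dist_le_mul (K := 1) fun x hx y hy => by
        simpa using (hφ.dist_eq x hx y hy).le).continuousOn
    have hmaps : ∀ y : regularLocus m P, (y : P) ∈ Metric.ball (u.endpoint : P) r →
        φ y ∈ Metric.ball (φ u.endpoint) r := by
      intro y hy
      rw [Metric.mem_ball, hφ.dist_eq _ hy _ (Metric.mem_ball_self hφ.pos)]
      exact hy
    refine homotopic_of_section (W := Metric.ball (φ u.endpoint) r) (h := h')
      (V := {y | (y : P) ∈ Metric.ball (u.endpoint : P) r}) (g := fun y => φ y)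
      (LipschitzOnWith.of_dist_le_mul (K := 1) hisom).continuousOn
      (hφc.comp continuous_subtype_val.continuousOn fun _ hy => hy)
      (fun y hy => hmaps y hy) (fun y hy => ?_) γ σ (fun t => (hγ t).2) fun t => (hseg t).2
    rw [hval ⟨φ y, hmaps y hy⟩]
    apply Subtype.ext
    rw [← dist_eq_zero, ← hφ.dist_eq _ (hball _) _ hy, hh, dist_self]
  have hmove : UniversalCover.move u γ = UniversalCover.move u σ := by
    unfold UniversalCover.move
    rw [Path.Homotopic.Quotient.eq.2 hhom]
  have he' : hS.MemLift (UniversalCover.move u γ) e := ⟨hy, he⟩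
  rw [hmove] at he'
  exact (hS.memLift_move_iff σ (chartPath_mem _ _ _ _)).1 he'

end Cover

section Adjacency

variable {m : ℕ} {P : Type*} [MetricSpace P] {ι : Type*} {S : ConvexSubdivision m P ι}
  {i j k : ι} {x y z x₀ : regularLocus m P}

/-! ### Curves in the universal cover -/

theorem move_congr {u : UniversalCover x₀} {γ : Path u.endpoint y} {η : Path u.endpoint z}
    (h : ∀ t, γ t = η t) : UniversalCover.move u γ = UniversalCover.move u η := by
  obtain rfl : y = z := by rw [← γ.target, ← η.target, h]
  obtain rfl : γ = η := Path.ext (funext h)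
  rfl

/-- The point of the universal cover which is reached from `u` along the part of the path `γ` up to
the time `t`. -/
noncomputable def UniversalCover.moveTo (u : UniversalCover x₀) (γ : Path u.endpoint y)
    (t : unitInterval) : UniversalCover x₀ :=
  UniversalCover.move u ((γ.subpath 0 t).cast γ.source.symm rfl)

theorem moveTo_one (u : UniversalCover x₀) (γ : Path u.endpoint y) :
    UniversalCover.moveTo u γ 1 = UniversalCover.move u γ := by
  refine move_congr fun t => ?_
  have h : ∀ t, γ.subpath 0 1 t = γ t := fun t => by rw [Path.subpath_zero_one]; rfl
  exact h t

theorem moveTo_eq_move (u : UniversalCover x₀) (γ : Path u.endpoint y) (s t : unitInterval) :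
    UniversalCover.moveTo u γ t =
      UniversalCover.move (UniversalCover.moveTo u γ s) (γ.subpath s t) := by
  unfold UniversalCover.moveTo UniversalCover.move
  congr 1
  change _ = (u.pathClass.trans _).trans _
  rw [Path.Homotopic.Quotient.trans_assoc]
  congr 1
  refine (Path.Homotopic.Quotient.eq (p := (γ.subpath 0 t).cast γ.source.symm rfl)
    (q := ((γ.subpath 0 s).cast γ.source.symm rfl).trans (γ.subpath s t))).2 ?_
  have h : ((γ.subpath 0 s).trans (γ.subpath s t)).Homotopic (γ.subpath 0 t) :=
    ⟨Path.Homotopy.subpathTransSubpath γ 0 s t⟩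
  exact (h.pathCast γ.source.symm rfl).symm

theorem IsTame.memLift_moveTo_zero (hS : IsTame S) {u : UniversalCover x₀} {e : hS.Lift x₀}
    (γ : Path u.endpoint y) (h : hS.MemLift u e) :
    hS.MemLift (UniversalCover.moveTo u γ 0) e := by
  refine (hS.memLift_move_iff _ fun t => ?_).2 h
  have h₁ : ∀ t, γ.subpath 0 0 t = γ 0 := fun t => by rw [Path.subpath_self]; rfl
  have h₂ := h.1
  rw [← γ.source, ← h₁ t] at h₂
  exact h₂

/-- Along a curve in the universal cover, the lifts of cells at nearby times contain the point. -/
theorem IsTame.eventually_memLift_moveTo (hS : IsTame S) (u : UniversalCover x₀)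
    (γ : Path u.endpoint y) (s : unitInterval) : ∀ᶠ t in 𝓝 s, ∀ e : hS.Lift x₀,
      hS.MemLift (UniversalCover.moveTo u γ t) e → hS.MemLift (UniversalCover.moveTo u γ s) e := by
  obtain ⟨U, hU, h⟩ := hS.exists_nhds_memLift (x₀ := x₀) (γ s)
  obtain ⟨δ, hδ, hδU⟩ := Metric.mem_nhds_iff.1 (γ.continuous.continuousAt hU)
  filter_upwards [Metric.ball_mem_nhds s hδ] with t ht e he
  rw [moveTo_eq_move u γ s t] at he
  refine h _ _ _ rfl (fun q => ?_) e he
  have hq : γ.subpath s t q ∈ γ '' uIcc s t := by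
    rw [← Path.range_subpath]; exact mem_range_self q
  obtain ⟨w, hw, hwq⟩ := hq
  have hwU : γ w ∈ U := ?_
  · rwa [hwq] at hwU
  refine hδU (Metric.mem_ball.2 (lt_of_le_of_lt ?_ (Metric.mem_ball.1 ht)))
  have hw' : (w : ℝ) ∈ uIcc (s : ℝ) t := by
    rw [mem_uIcc] at hw ⊢
    exact hw
  rw [Subtype.dist_eq, Subtype.dist_eq, dist_comm, dist_comm (t : ℝ)]
  exact Real.dist_left_le_of_mem_uIcc hw'

/-- A curve from a lift of a cell with the property `p` to one without the property passes through
the intersection of two such lifts. -/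
theorem IsTame.exists_crossing (hS : IsTame S) (p : hS.Lift x₀ → Prop) (u : UniversalCover x₀)
    (γ : Path u.endpoint y) {e e' : hS.Lift x₀} (he : hS.MemLift u e) (hp : p e)
    (he' : hS.MemLift (UniversalCover.move u γ) e') (hp' : ¬ p e') :
    ∃ t d d', hS.MemLift (UniversalCover.moveTo u γ t) d ∧
      hS.MemLift (UniversalCover.moveTo u γ t) d' ∧ p d ∧ ¬ p d' := by
  -- the times spent in lifts with a given property form a closed set
  have hclosed : ∀ q : hS.Lift x₀ → Prop,
      IsClosed {t | ∃ d, hS.MemLift (UniversalCover.moveTo u γ t) d ∧ q d} := by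
    intro q
    refine isOpen_compl_iff.1 (isOpen_iff_mem_nhds.2 fun s hs => ?_)
    filter_upwards [hS.eventually_memLift_moveTo u γ s] with t ht
    rintro ⟨d, hd, hq⟩
    exact hs ⟨d, ht d hd, hq⟩
  have hpre := isPreconnected_closed_iff.1 (isPreconnected_univ (α := unitInterval)) _ _
    (hclosed p) (hclosed fun d => ¬ p d) ?_ ?_ ?_
  · obtain ⟨t, -, ⟨d, hd, hpd⟩, ⟨d', hd', hpd'⟩⟩ := hpre
    exact ⟨t, d, d', hd, hd', hpd, hpd'⟩
  · intro t _
    obtain ⟨i, hi⟩ := exists_cell S (γ t : P)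
    obtain ⟨κ, hκ⟩ := hS.exists_memLift (UniversalCover.moveTo u γ t) (i := i) hi
    by_cases h : p ⟨i, κ⟩
    · exact Or.inl ⟨_, hκ, h⟩
    · exact Or.inr ⟨_, hκ, h⟩
  · exact ⟨0, mem_univ _, e, hS.memLift_moveTo_zero γ he, hp⟩
  · refine ⟨1, mem_univ _, e', ?_, hp'⟩
    rwa [moveTo_one]

theorem IsTame.MemLift.eq_of_endpoint_eq {hS : IsTame S} {u v : UniversalCover x₀}
    {e : hS.Lift x₀} (hu : hS.MemLift u e) (hv : hS.MemLift v e) (h : u.endpoint = v.endpoint) :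
    u = v := by
  obtain ⟨a, κ⟩ := u
  obtain ⟨b, κ'⟩ := v
  obtain rfl : a = b := h
  obtain ⟨h₁, h₂⟩ := hu
  obtain ⟨h₃, h₄⟩ := hv
  congr 1
  exact h₂.trans h₄.symm

/-! ### Adjacent lifts -/

/-- The lifts `c` and `e` meet along a lift of the facet `x.1`; the letter `x` also records on which
sides of the facet the two cells lie. -/
def IsTame.Adjacent (hS : IsTame S) (c e : hS.Lift x₀) (x : Facet S × Bool) : Prop :=
  x.1.sides = (if x.2 then (c.1, e.1) else (e.1, c.1)) ∧
    ∃ u, hS.MemLift u c ∧ hS.MemLift u e ∧ (u.endpoint : P) ∈ x.1.1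

theorem IsTame.Adjacent.symm {hS : IsTame S} {c e : hS.Lift x₀} {x : Facet S × Bool}
    (h : hS.Adjacent c e x) : hS.Adjacent e c (letterInv x) := by
  obtain ⟨h₁, u, h₂, h₃, h₄⟩ := h
  refine ⟨?_, u, h₃, h₂, h₄⟩
  change x.1.sides = (if (!x.2) then (e.1, c.1) else (c.1, e.1))
  rw [h₁]
  cases x.2 <;> rfl

theorem IsTame.Adjacent.commonFace {hS : IsTame S} {c e : hS.Lift x₀} {x : Facet S × Bool}
    (h : hS.Adjacent c e x) : CommonFace S c.1 e.1 x.1.1 ∧ c.1 ≠ e.1 := by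
  have h₁ := x.1.commonFace
  have h₂ := x.1.sides_ne
  rw [h.1] at h₁ h₂
  rcases hx : x.2 with _ | _
  · rw [hx] at h₁ h₂
    exact ⟨h₁.symm, h₂.symm⟩
  · rw [hx] at h₁ h₂
    exact ⟨h₁, h₂⟩

theorem IsTame.exists_adjacent (hS : IsTame S) {u : UniversalCover x₀} {c e : hS.Lift x₀}
    (hc : hS.MemLift u c) (he : hS.MemLift u e) (hne : c ≠ e) : ∃ x, hS.Adjacent c e x ∧
      (u.endpoint : P) ∈ x.1.1 := by
  have hce : c.1 ≠ e.1 := fun h => hne (hc.eq hS he h)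
  obtain ⟨f, hf⟩ := exists_facet u.endpoint.2 hce hc.1 he.1
  rcases f.sides_eq_or hS u.endpoint.2 hf hce hc.1 he.1 with h | h
  · exact ⟨(f, true), ⟨h, u, hc, he, hf⟩, hf⟩
  · exact ⟨(f, false), ⟨h, u, hc, he, hf⟩, hf⟩

/-- Adjacent lifts share all the points of the lift of the facet. -/
theorem IsTame.Adjacent.memLift (hS : IsTame S) {c e : hS.Lift x₀} {x : Facet S × Bool}
    (h : hS.Adjacent c e x) {v : UniversalCover x₀} (hv : hS.MemLift v c)
    (hvx : (v.endpoint : P) ∈ x.1.1) : hS.MemLift v e := by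
  obtain ⟨hZ, hne⟩ := h.commonFace
  obtain ⟨-, u, huc, hue, hux⟩ := h
  -- move from `u` to `v` along a segment in the facet, which lies in both cells
  have hseg : ∀ t : unitInterval, segPath (coord S c.1 u.endpoint) (coord S c.1 v.endpoint) t ∈
      regDom S c.1 := by
    intro t
    rw [segPath_apply, AffineMap.lineMap_apply_module]
    exact ⟨convex_C S c.1 (coord_mem huc.1) (coord_mem hv.1) (sub_nonneg.2 t.2.2) t.2.1 (by ring),
      hS.combo_mem_regularLocus hne hZ hux u.endpoint.2 hvx v.endpoint.2 (sub_nonneg.2 t.2.2) t.2.1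
        (by ring)⟩
  let σ : Path u.endpoint v.endpoint := chartPath (segPath _ _) hseg (toP_coord huc.1)
    (toP_coord hv.1)
  have hσ : ∀ t, (σ t : P) ∈ S.Q e.1 := by
    intro t
    refine hZ.subset_right ?_
    rw [chartPath_coe, segPath_apply, AffineMap.lineMap_apply_module]
    exact hZ.combo_mem hux hvx (sub_nonneg.2 t.2.2) t.2.1 (by ring)
  have h₁ : hS.MemLift (UniversalCover.move u σ) e := (hS.memLift_move_iff σ hσ).2 hue
  have h₂ : hS.MemLift (UniversalCover.move u σ) c :=
    (hS.memLift_move_iff σ (chartPath_mem _ _ _ _)).2 huc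
  rwa [h₂.eq_of_endpoint_eq hv rfl] at h₁

theorem IsTame.Adjacent.unique (hS : IsTame S) {c d e : hS.Lift x₀} {x : Facet S × Bool}
    (hd : hS.Adjacent c d x) (he : hS.Adjacent c e x) : d = e := by
  obtain ⟨h₁, u, huc, hud, hux⟩ := id hd
  refine hud.eq hS (he.memLift hS huc hux) ?_
  have := h₁.symm.trans he.1
  rcases hx : x.2 with _ | _
  · rw [hx] at this
    exact (Prod.ext_iff.1 this).1
  · rw [hx] at this
    exact (Prod.ext_iff.1 this).2

theorem exists_move (u v : UniversalCover x₀) :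
    ∃ γ : Path u.endpoint v.endpoint, UniversalCover.move u γ = v := by
  obtain ⟨γ, hγ⟩ := Path.Homotopic.Quotient.mk_surjective (u.pathClass.symm.trans v.pathClass)
  refine ⟨γ, ?_⟩
  obtain ⟨b, κ⟩ := v
  unfold UniversalCover.move
  congr 1
  rw [hγ, ← Path.Homotopic.Quotient.trans_assoc, Path.Homotopic.Quotient.trans_symm,
    Path.Homotopic.Quotient.refl_trans]

theorem IsTame.memLift_centre (hS : IsTame S) (e : hS.Lift x₀) :
    hS.MemLift ⟨hS.centre e.1, e.2⟩ e :=
  ⟨hS.centre_mem e.1, by rw [hS.spokeClass_centre, Path.Homotopic.Quotient.trans_refl]⟩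

/-- A curve between the centres of two lifts passes from one lift to an adjacent one whenever it
changes the cell. -/
theorem IsTame.connected (hS : IsTame S) (p : hS.Lift x₀ → Prop)
    (hp : ∀ c e x, hS.Adjacent c e x → p c → p e) (c e : hS.Lift x₀) (hc : p c) : p e := by
  by_contra he
  obtain ⟨γ, hγ⟩ := exists_move (⟨hS.centre c.1, c.2⟩ : UniversalCover x₀)
    ⟨hS.centre e.1, e.2⟩
  obtain ⟨t, d, d', hd, hd', hpd, hpd'⟩ := hS.exists_crossing p _ γ (hS.memLift_centre c) hc
    (by rw [hγ]; exact hS.memLift_centre e) he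
  obtain ⟨x, hx, -⟩ := hS.exists_adjacent hd hd' (by rintro rfl; exact hpd' hpd)
  exact hpd' (hp d d' x hx hpd)

/-! ### Labels of the lifts -/

variable (S) in
/-- The open sets on which the labels are compared: the part of a cell which is disjoint from the
other ones, and the two cells at a facet, together with the facet. -/
def labelSet : ι ⊕ Facet S → Set (regularLocus m P)
  | .inl i => {y | ∀ j, (y : P) ∈ S.Q j → j = i}
  | .inr f => {y | (∀ j, (y : P) ∈ S.Q j → j = f.sides.1 ∨ j = f.sides.2) ∧
      ((y : P) ∈ S.Q f.sides.1 → (y : P) ∈ S.Q f.sides.2 → (y : P) ∈ f.1)}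

variable (S) in
open Classical in
/-- The label changes at a facet by the corresponding generator of the free group. -/
noncomputable def labelCocycle : ι ⊕ Facet S → regularLocus m P → FreeGroup (Facet S)
  | .inl _, _ => 1
  | .inr f, y => if (y : P) ∈ S.Q f.sides.1 then 1 else .of f

theorem labelCocycle_of_mem {f : Facet S} (h : (y : P) ∈ S.Q f.sides.1) :
    labelCocycle S (.inr f) y = 1 := if_pos h

theorem labelCocycle_of_notMem {f : Facet S} (h : (y : P) ∉ S.Q f.sides.1) :
    labelCocycle S (.inr f) y = .of f := if_neg h

theorem isOpen_labelSet_inl (i : ι) : IsOpen (labelSet S (.inl i)) := by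
  refine isOpen_iff_mem_nhds.2 fun y hy => ?_
  filter_upwards [continuous_subtype_val.continuousAt.eventually
    (eventually_cells_subset S (y : P))] with z hz j hj
  exact hy j (hz j hj)

theorem IsTame.isOpen_labelSet (hS : IsTame S) (α : ι ⊕ Facet S) : IsOpen (labelSet S α) := by
  rcases α with i | f
  · exact isOpen_labelSet_inl i
  refine isOpen_iff_mem_nhds.2 fun y hy => ?_
  have h₁ := continuous_subtype_val.continuousAt.eventually (eventually_cells_subset S (y : P))
  by_cases hyf : (y : P) ∈ S.Q f.sides.1 ∧ (y : P) ∈ S.Q f.sides.2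
  · obtain ⟨n, hn⟩ := hS.exists_smoothAt y y.2 _ _ f.sides_ne hyf.1 hyf.2
    have h₂ := continuous_subtype_val.continuousAt.eventually
      (eventually_inner_coord_eq hyf.1 hn)
    filter_upwards [h₁, h₂] with z hz hz'
    refine ⟨fun j hj => hy.1 j (hz j hj), fun hl hr => ?_⟩
    rw [f.commonFace.mem_iff (hy.2 hyf.1 hyf.2) hn]
    exact ⟨hl, hz' _ f.sides_ne.symm hl hr⟩
  · filter_upwards [h₁] with z hz
    exact ⟨fun j hj => hy.1 j (hz j hj), fun hl hr => absurd ⟨hz _ hl, hz _ hr⟩ hyf⟩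

theorem IsTame.mem_labelSet_of_mem_facet (hS : IsTame S) {f : Facet S} (hy : (y : P) ∈ f.1) :
    y ∈ labelSet S (.inr f) :=
  ⟨fun _ hj => hS.eq_or_eq y.2 f.sides_ne (f.commonFace.subset_left hy)
    (f.commonFace.subset_right hy) hj, fun _ _ => hy⟩

theorem IsTame.exists_labelSet (hS : IsTame S) (y : regularLocus m P) : ∃ α, y ∈ labelSet S α := by
  obtain ⟨i, hi⟩ := exists_cell S (y : P)
  by_cases h : ∃ j, (y : P) ∈ S.Q j ∧ j ≠ i
  · obtain ⟨j, hj, hji⟩ := h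
    obtain ⟨f, hf⟩ := exists_facet y.2 hji hj hi
    exact ⟨.inr f, hS.mem_labelSet_of_mem_facet hf⟩
  · push Not at h
    exact ⟨.inl i, h⟩

/-- The labels are constant on the points which lie in a single, given cell. -/
theorem labelCocycle_eq {α : ι ⊕ Facet S} (hy : y ∈ labelSet S (.inl i))
    (hz : z ∈ labelSet S (.inl i)) : labelCocycle S α y = labelCocycle S α z := by
  have key : ∀ {y : regularLocus m P}, y ∈ labelSet S (.inl i) → ∀ k, (y : P) ∈ S.Q k ↔ k = i := by
    intro y hy k
    refine ⟨hy k, ?_⟩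
    rintro rfl
    obtain ⟨j, hj⟩ := exists_cell S (y : P)
    rwa [hy j hj] at hj
  rcases α with j | f
  · rfl
  · by_cases h : f.sides.1 = i
    · rw [labelCocycle_of_mem ((key hy _).2 h), labelCocycle_of_mem ((key hz _).2 h)]
    · rw [labelCocycle_of_notMem fun h' => h ((key hy _).1 h'),
        labelCocycle_of_notMem fun h' => h ((key hz _).1 h')]

/-- Different sets of the cover overlap only in points of a single cell, and there the labels are
locally constant. -/
theorem IsTame.eventually_labelCocycle (hS : IsTame S) (α β : ι ⊕ Facet S)
    (hy : y ∈ labelSet S α ∩ labelSet S β) : ∀ᶠ z in 𝓝 y,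
      labelCocycle S α z * (labelCocycle S β z)⁻¹ =
        labelCocycle S α y * (labelCocycle S β y)⁻¹ := by
  by_cases hαβ : α = β
  · subst hαβ
    exact Eventually.of_forall fun z => by simp
  have hex : ∃ i, y ∈ labelSet S (.inl i) := by
    rcases α with i | f
    · exact ⟨i, hy.1⟩
    rcases β with i | g
    · exact ⟨i, hy.2⟩
    have hfg : f ≠ g := fun h => hαβ (h ▸ rfl)
    obtain ⟨i, hi⟩ := exists_cell S (y : P)
    refine ⟨i, fun j hj => ?_⟩
    by_contra hne
    have hmem : ∀ f : Facet S, y ∈ labelSet S (.inr f) → (y : P) ∈ f.1 := by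
      intro f hf
      rcases hf.1 i hi with h₁ | h₁ <;> rcases hf.1 j hj with h₂ | h₂
      · exact absurd (h₂.trans h₁.symm) hne
      · exact hf.2 (h₁ ▸ hi) (h₂ ▸ hj)
      · exact hf.2 (h₂ ▸ hj) (h₁ ▸ hi)
      · exact absurd (h₂.trans h₁.symm) hne
    exact hfg (Facet.eq_of_mem hS y.2 (hmem f hy.1) (hmem g hy.2))
  obtain ⟨i, hi⟩ := hex
  filter_upwards [(isOpen_labelSet_inl i).mem_nhds hi] with z hz
  rw [labelCocycle_eq hz hi, labelCocycle_eq hz hi]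

theorem IsTame.centre_mem_labelSet (hS : IsTame S) (i : ι) :
    hS.centre i ∈ labelSet S (.inl i) := by
  intro j hj
  by_contra hne
  refine coord_notMem_interior (Ne.symm hne) (hS.centre_mem i) hj ?_
  have := centreCoord_mem_interior (S := S) (i := i)
  change coord S i (toP S i (centreCoord S i)) ∈ _
  rwa [coord_toP (interior_subset this)]

theorem IsTame.spoke_mem_labelSet (hS : IsTame S) {f : Facet S} (hi : i = f.sides.1 ∨ i = f.sides.2)
    (hx : (x : P) ∈ S.Q i) (hxf : (x : P) ∈ f.1) (t) :
    hS.spoke hx t ∈ labelSet S (.inr f) := by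
  rcases hS.spoke_eq_or hx t with h | h
  · have hone : ∀ j, (hS.spoke hx t : P) ∈ S.Q j → j = i := by
      intro j hj
      by_contra hne
      exact coord_notMem_interior (Ne.symm hne) (hS.spoke_mem hx t) hj h
    refine ⟨fun j hj => hone j hj ▸ hi, fun h₁ h₂ => ?_⟩
    exact absurd ((hone _ h₁).trans (hone _ h₂).symm) f.sides_ne
  · rw [h]
    exact hS.mem_labelSet_of_mem_facet hxf

/-- The lifts of the cells form a tree. -/
theorem IsTame.exists_isLabelledTree (hS : IsTame S) (x₀ : regularLocus m P) :
    ∃ label : hS.Lift x₀ → FreeGroup (Facet S), IsLabelledTree hS.Adjacent label := by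
  obtain ⟨Λ, hΛ⟩ := exists_label (labelSet S) hS.isOpen_labelSet hS.exists_labelSet
    (labelCocycle S) (fun α β y hy => hS.eventually_labelCocycle α β hy) x₀
  refine ⟨fun e => Λ _ e.2, ?_, fun h => h.symm, fun h h' => h.unique hS h', hS.connected⟩
  rintro ⟨i, κ⟩ ⟨j, κ'⟩ x hx
  obtain ⟨hZ, hij⟩ := hx.commonFace
  obtain ⟨hsides, u, ⟨hi, hu⟩, ⟨hj, hu'⟩, hux⟩ := hx
  change x.1.sides = (if x.2 then (i, j) else (j, i)) at hsides
  change i ≠ j at hij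
  change (u.endpoint : P) ∈ S.Q i at hi
  change (u.endpoint : P) ∈ S.Q j at hj
  -- the centres of adjacent lifts are joined by two spokes, which meet on the facet
  have hκ' : κ' = κ.trans (.mk ((hS.spoke hi).trans (hS.spoke hj).symm)) := by
    have h₁ : κ.trans (hS.spokeClass hi) = κ'.trans (hS.spokeClass hj) := hu.symm.trans hu'
    have := congrArg (fun q => Path.Homotopic.Quotient.trans q (hS.spokeClass hj).symm) h₁
    simp only [Path.Homotopic.Quotient.trans_assoc, Path.Homotopic.Quotient.trans_symm,
      Path.Homotopic.Quotient.trans_refl] at this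
    exact this.symm
  have hmem : ∀ k, k = i ∨ k = j → k = x.1.sides.1 ∨ k = x.1.sides.2 := by
    rw [hsides]
    rcases x.2 with _ | _
    · exact fun k hk => hk.symm
    · exact fun k hk => hk
  have hpath : ∀ t, ((hS.spoke hi).trans (hS.spoke hj).symm) t ∈ labelSet S (.inr x.1) := by
    intro t
    rw [Path.trans_apply]
    split_ifs
    · exact hS.spoke_mem_labelSet (hmem i (.inl rfl)) hi hux _
    · rw [Path.symm_apply]
      exact hS.spoke_mem_labelSet (hmem j (.inr rfl)) hj hux _
  have hone : ∀ k l, (hS.centre k : P) ∈ S.Q l ↔ l = k := fun k l =>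
    ⟨hS.centre_mem_labelSet k l, fun h => h ▸ hS.centre_mem k⟩
  change Λ (hS.centre j) κ' = Λ (hS.centre i) κ * FreeGroup.mk [x]
  rw [hκ', hΛ _ _ κ _ (.inr x.1) hpath, mul_assoc]
  congr 1
  obtain ⟨f, b⟩ := x
  rcases b with _ | _
  · have h₁ : f.sides = (j, i) := hsides
    rw [labelCocycle_of_mem (y := hS.centre j) ((hone _ _).2 (by rw [h₁])),
      labelCocycle_of_notMem (y := hS.centre i) (fun h => hij.symm ?_), mul_one]
    · rfl
    · rw [hone, h₁] at h
      exact h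
  · have h₁ : f.sides = (i, j) := hsides
    rw [labelCocycle_of_mem (y := hS.centre i) ((hone _ _).2 (by rw [h₁])),
      labelCocycle_of_notMem (y := hS.centre j) (fun h => hij ?_), inv_one, one_mul]
    · rfl
    · rw [hone, h₁] at h
      exact h

end Adjacency

/-! ### Distances in the universal cover -/

/-- If short chords of `h` are no longer than the arcs of `g`, then so is the chord between the end
points. -/
theorem edist_le_of_locally {X F : Type*} [PseudoEMetricSpace X] [PseudoEMetricSpace F]
    {h : unitInterval → F} {g : unitInterval → X}
    (hloc : ∀ q, ∃ V ∈ 𝓝 q, ∀ s ∈ V, ∀ t ∈ V, s ≤ t →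
      edist (h s) (h t) ≤ eVariationOn g (Icc s t)) :
    edist (h 0) (h 1) ≤ eVariationOn g univ := by
  choose V hV hle using hloc
  obtain ⟨t, ht0, htm, ⟨n, hn⟩, ht⟩ := exists_monotone_Icc_subset_open_cover_unitInterval
    (c := fun q => interior (V q)) (fun q => isOpen_interior)
    (fun q _ => mem_iUnion.2 ⟨q, mem_interior_iff_mem_nhds.2 (hV q)⟩)
  have h₁ : edist (h (t 0)) (h (t n)) ≤ ∑ k ∈ Finset.range n, edist (h (t k)) (h (t (k + 1))) :=
    edist_le_range_sum_edist (fun k => h (t k)) n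
  rw [ht0, hn n le_rfl] at h₁
  calc edist (h 0) (h 1) ≤ ∑ k ∈ Finset.range n, edist (h (t k)) (h (t (k + 1))) := h₁
    _ ≤ ∑ k ∈ Finset.range n, eVariationOn g (Icc (t k) (t (k + 1))) := by
        refine Finset.sum_le_sum fun k _ => ?_
        obtain ⟨q, hq⟩ := ht k
        have hk := htm (Nat.le_succ k)
        exact hle q _ (interior_subset (hq (left_mem_Icc.2 hk))) _
          (interior_subset (hq (right_mem_Icc.2 hk))) hk
    _ = eVariationOn g (Icc (t 0) (t n)) := eVariationOn.sum' g htm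
    _ ≤ eVariationOn g univ := eVariationOn.mono g (subset_univ _)

section Distance

variable {m : ℕ} {P : Type*} [MetricSpace P] {ι : Type*} {S : ConvexSubdivision m P ι}
  {i j k : ι} {x y z x₀ : regularLocus m P}

local notation "E" => EuclideanSpace ℝ (Fin m)

theorem edist_move_le (u : UniversalCover x₀) (γ : Path u.endpoint y) :
    edist u (UniversalCover.move u γ) ≤ pathLength γ :=
  iInf₂_le_of_le (f := fun (η : Path u.endpoint (UniversalCover.move u γ).endpoint)
    (_ : u.pathClass.trans (.mk η) = (UniversalCover.move u γ).pathClass) => pathLength η)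
    γ rfl le_rfl

theorem exists_move_of_edist_lt {u v : UniversalCover x₀} {r : ℝ≥0∞} (h : edist u v < r) :
    ∃ γ : Path u.endpoint v.endpoint, UniversalCover.move u γ = v ∧ pathLength γ < r := by
  obtain ⟨γ, hγ⟩ := iInf_lt_iff.1 (show u.liftEDist v < r from h)
  obtain ⟨hγ', hlt⟩ := iInf_lt_iff.1 hγ
  refine ⟨γ, ?_, hlt⟩
  obtain ⟨b, κ⟩ := v
  unfold UniversalCover.move
  congr 1

theorem edist_moveTo_le (u : UniversalCover x₀) (γ : Path u.endpoint y) {s t : unitInterval}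
    (hst : s ≤ t) : edist (UniversalCover.moveTo u γ s) (UniversalCover.moveTo u γ t) ≤
      eVariationOn γ (Icc s t) := by
  rw [moveTo_eq_move u γ s t]
  exact (edist_move_le _ _).trans (eVariationOn_subpath_le γ hst)

/-- A curve passes at most its length on the way to and from a point on it. -/
theorem edist_add_edist_moveTo_le (u : UniversalCover x₀) (γ : Path u.endpoint y)
    (t : unitInterval) : edist u (UniversalCover.moveTo u γ t) +
      edist (UniversalCover.moveTo u γ t) (UniversalCover.move u γ) ≤ pathLength γ := by
  have h₁ := edist_moveTo_le u γ (s := t) (t := 1) t.2.2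
  rw [moveTo_one] at h₁
  have h₂ : edist u (UniversalCover.moveTo u γ t) ≤ eVariationOn γ (Icc 0 t) :=
    (edist_move_le _ _).trans (eVariationOn_subpath_le γ t.2.1)
  refine (add_le_add h₂ h₁).trans ?_
  have := eVariationOn.Icc_add_Icc γ (s := univ) (show 0 ≤ t from t.2.1) (show t ≤ 1 from t.2.2)
    (mem_univ _)
  simp only [univ_inter] at this
  exact this.le.trans (eVariationOn.mono _ (subset_univ _))

/-- The lift of a facet separates the lifts of cells on its two sides. -/
theorem IsTame.exists_mem_wall (hS : IsTame S) [DecidableEq (Facet S)]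
    {label : hS.Lift x₀ → FreeGroup (Facet S)} (hl : IsLabelledTree hS.Adjacent label)
    {c c' e e' : hS.Lift x₀} {f : Facet S × Bool} (hf : hS.Adjacent c c' f)
    (he : ((label e)⁻¹ * label c').norm = ((label e)⁻¹ * label c).norm + 1)
    (he' : ((label e')⁻¹ * label c).norm = ((label e')⁻¹ * label c').norm + 1)
    {u v : UniversalCover x₀} (hu : hS.MemLift u e) (hv : hS.MemLift v e') {r : ℝ≥0∞}
    (hr : edist u v < r) : ∃ w : UniversalCover x₀, hS.MemLift w c ∧ hS.MemLift w c' ∧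
      (w.endpoint : P) ∈ f.1.1 ∧ edist u w + edist w v < r := by
  obtain ⟨γ, hγv, hγ⟩ := exists_move_of_edist_lt hr
  rw [← hγv] at hv
  -- where the curve changes sides, it passes from `c` to `c'`
  obtain ⟨t, d, d', hd, hd', hpd, hpd'⟩ := hS.exists_crossing
    (fun e => ((label e)⁻¹ * label c').norm = ((label e)⁻¹ * label c).norm + 1) u γ hu he hv
    (by omega)
  replace hpd' := (hl.alternative hf d').resolve_left hpd'
  obtain ⟨g, hg, hgm⟩ := hS.exists_adjacent hd hd' (by rintro rfl; omega)
  obtain ⟨rfl, rfl⟩ := hl.eq_of_separated hf hg hpd hpd'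
  have hfg : f = g := by
    have h₁ := (hl.label_eq hf).symm.trans (hl.label_eq hg)
    have h₂ := congrArg FreeGroup.toWord (mul_left_cancel h₁)
    rw [FreeGroup.toWord_mk, FreeGroup.toWord_mk, FreeGroup.reduce_singleton,
      FreeGroup.reduce_singleton] at h₂
    exact List.head_eq_of_cons_eq h₂
  refine ⟨_, hd, hd', hfg ▸ hgm, ?_⟩
  have h₃ := edist_add_edist_moveTo_le u γ t
  rw [hγv] at h₃
  exact h₃.trans_lt hγ

theorem IsTame.edist_le_of_segment (hS : IsTame S) {u v : UniversalCover x₀} {e : hS.Lift x₀}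
    (hu : hS.MemLift u e) (hv : hS.MemLift v e)
    (hseg : ∀ t ∈ Icc (0 : ℝ) 1, AffineMap.lineMap (coord S e.1 u.endpoint)
      (coord S e.1 v.endpoint) t ∈ regDom S e.1) :
    edist u v ≤ edist (coord S e.1 u.endpoint) (coord S e.1 v.endpoint) := by
  let σ : Path u.endpoint v.endpoint := chartPath (S := S) (i := e.1) (segPath _ _)
    (fun t => hseg t t.2) (toP_coord hu.1) (toP_coord hv.1)
  have hσ : UniversalCover.move u σ = v :=
    ((hS.memLift_move_iff σ (chartPath_mem _ _ _ _)).2 hu).eq_of_endpoint_eq hv rfl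
  have h₁ := edist_move_le u σ
  rw [hσ] at h₁
  refine h₁.trans ?_
  rw [edist_nndist]
  refine pathLength_le_of_edist_le σ fun s t =>
    (edist_toP_le (hseg s s.2).1 (hseg t t.2).1).trans (le_of_eq ?_)
  rw [edist_nndist, nndist_lineMap_lineMap, edist_nndist s t, mul_comm]
  norm_cast

/-- The points of the lift of a cell. -/
theorem IsTame.exists_memLift_coord (hS : IsTame S) (e : hS.Lift x₀) {c : E}
    (hc : c ∈ regDom S e.1) :
    ∃ u : UniversalCover x₀, hS.MemLift u e ∧ coord S e.1 u.endpoint = c := by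
  have hx : ((⟨toP S e.1 c, hc.2⟩ : regularLocus m P) : P) ∈ S.Q e.1 := toP_mem hc.1
  exact ⟨⟨⟨toP S e.1 c, hc.2⟩, e.2.trans (hS.spokeClass hx)⟩, ⟨hx, rfl⟩, coord_toP hc.1⟩

/-- The segment between two points of a lift may pass through singular points of the boundary, hence
it is pushed into the interior of the cell first. -/
theorem IsTame.edist_le (hS : IsTame S) {u v : UniversalCover x₀} {e : hS.Lift x₀}
    (hu : hS.MemLift u e) (hv : hS.MemLift v e) :
    edist u v ≤ edist (coord S e.1 u.endpoint) (coord S e.1 v.endpoint) := by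
  set p := coord S e.1 u.endpoint with hp
  set q := coord S e.1 v.endpoint with hq
  set o := centreCoord S e.1 with ho
  have hpC : p ∈ regDom S e.1 := coord_mem_regDom hu.1
  have hqC : q ∈ regDom S e.1 := coord_mem_regDom hv.1
  have key : ∀ ε ∈ Ioo (0 : ℝ) 1,
      edist u v ≤ ENNReal.ofReal (ε * dist p o + dist p q + ε * dist q o) := by
    intro ε hε
    have hint : ∀ c ∈ regDom S e.1, AffineMap.lineMap c o ε ∈ interior (S.C e.1) := by
      intro c hc
      rw [← AffineMap.lineMap_apply_one_sub]
      exact lineMap_centreCoord_mem hc.1 (by linarith [hε.2]) (by linarith [hε.1])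
    obtain ⟨u', hu', hup⟩ := hS.exists_memLift_coord e (hS.interior_subset_regDom (hint p hpC))
    obtain ⟨v', hv', hvq⟩ := hS.exists_memLift_coord e (hS.interior_subset_regDom (hint q hqC))
    have hspoke : ∀ {w w' : UniversalCover x₀}, hS.MemLift w e → hS.MemLift w' e →
        coord S e.1 w'.endpoint = AffineMap.lineMap (coord S e.1 w.endpoint) o ε →
        edist w w' ≤ ENNReal.ofReal (ε * dist (coord S e.1 w.endpoint) o) := by
      intro w w' hw hw' hww
      refine (hS.edist_le_of_segment hw hw' fun t ht => ?_).trans (le_of_eq ?_)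
      · rw [hww, AffineMap.lineMap_lineMap_right, ← AffineMap.lineMap_apply_one_sub]
        exact hS.lineMap_mem_regDom (coord_mem_regDom hw.1)
          ⟨by nlinarith [ht.1, ht.2, hε.1, hε.2], by nlinarith [ht.1, ht.2, hε.1, hε.2]⟩
      · rw [hww, edist_dist, dist_left_lineMap, Real.norm_of_nonneg hε.1.le]
    have h₁ := hspoke hu hu' hup
    have h₂ := hspoke hv hv' hvq
    have h₃ : edist u' v' ≤ ENNReal.ofReal (dist p q) := by
      refine (hS.edist_le_of_segment hu' hv' fun t ht => ?_).trans ?_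
      · rw [hup, hvq]
        exact hS.interior_subset_regDom ((convex_C S e.1).interior.lineMap_mem (hint p hpC)
          (hint q hqC) ht)
      · rw [hup, hvq, edist_dist]
        refine ENNReal.ofReal_le_ofReal ?_
        rw [dist_eq_norm, dist_eq_norm, AffineMap.lineMap_apply_module,
          AffineMap.lineMap_apply_module, add_sub_add_right_eq_sub, ← smul_sub, norm_smul,
          Real.norm_of_nonneg (by linarith [hε.2])]
        exact mul_le_of_le_one_left (norm_nonneg _) (by linarith [hε.1])
    rw [edist_comm] at h₂
    have hε0 := hε.1.le
    rw [ENNReal.ofReal_add (by positivity) (by positivity),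
      ENNReal.ofReal_add (by positivity) (by positivity)]
    exact (edist_triangle4 u u' v' v).trans (add_le_add (add_le_add h₁ h₃) h₂)
  rw [edist_dist p q]
  refine ge_of_tendsto (x := 𝓝[>] (0 : ℝ))
    (f := fun ε => ENNReal.ofReal (ε * dist p o + dist p q + ε * dist q o)) ?_ ?_
  · have hc : Continuous fun ε : ℝ => ENNReal.ofReal (ε * dist p o + dist p q + ε * dist q o) :=
      ENNReal.continuous_ofReal.comp (by fun_prop)
    have := hc.tendsto 0
    simp only [zero_mul, zero_add, add_zero] at this
    exact this.mono_left nhdsWithin_le_nhds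
  · filter_upwards [Ioo_mem_nhdsGT (zero_lt_one (α := ℝ))] with ε hε using key ε hε

end Distance

/-! ### The developing map -/

section Develop

variable {m : ℕ} {P : Type*} [MetricSpace P] {ι : Type*} {S : ConvexSubdivision m P ι}
  {i j k : ι} {x y z x₀ : regularLocus m P}

local notation "E" => EuclideanSpace ℝ (Fin m)

theorem IsTame.exists_motion (hS : IsTame S) (f : Facet S) :
    ∃ A : E ≃ᵃⁱ[ℝ] E, ∀ a ∈ f.1, a ∈ regularLocus m P →
      ∃ n n', IsHinge S f.sides.1 f.sides.2 a f.1 n n' A := by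
  obtain ⟨a, haf, ha⟩ := f.exists_mem
  obtain ⟨n, n', A, -, h⟩ := hS.exists_isHinge f.sides_ne f.commonFace haf ha
  exact ⟨A, fun b hb hb' => ⟨n, n', h b hb hb'⟩⟩

/-- The motion which unfolds the second cell at a facet, next to the first one. -/
noncomputable def IsTame.motion (hS : IsTame S) (f : Facet S) :
    EuclideanSpace ℝ (Fin m) ≃ᵃⁱ[ℝ] EuclideanSpace ℝ (Fin m) := (hS.exists_motion f).choose

theorem IsTame.exists_isHinge_motion (hS : IsTame S) {f : Facet S} (hx : (x : P) ∈ f.1) :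
    ∃ n n', IsHinge S f.sides.1 f.sides.2 x f.1 n n' (hS.motion f) :=
  (hS.exists_motion f).choose_spec _ hx x.2

/-- The placement of a lift of a cell in Euclidean space: the product of the motions along a chain
of adjacent lifts. -/
noncomputable def IsTame.placement (hS : IsTame S) :
    FreeGroup (Facet S) →* (EuclideanSpace ℝ (Fin m) ≃ᵃⁱ[ℝ] EuclideanSpace ℝ (Fin m)) :=
  FreeGroup.lift hS.motion

theorem IsTame.placement_letter (hS : IsTame S) (f : Facet S) :
    hS.placement (FreeGroup.mk [(f, true)]) = hS.motion f := by
  change FreeGroup.lift hS.motion (.of f) = _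
  rw [FreeGroup.lift_apply_of]

variable {hS : IsTame S} {label : hS.Lift x₀ → FreeGroup (Facet S)}

/-- The placements of the lifts of cells agree at common points. -/
theorem placement_coord_eq [DecidableEq (Facet S)] (hl : IsLabelledTree hS.Adjacent label)
    {u : UniversalCover x₀} {c e : hS.Lift x₀} (hc : hS.MemLift u c) (he : hS.MemLift u e) :
    hS.placement (label c) (coord S c.1 u.endpoint) =
      hS.placement (label e) (coord S e.1 u.endpoint) := by
  by_cases hce : c = e
  · rw [hce]
  obtain ⟨⟨f, b⟩, hf, hfu⟩ := hS.exists_adjacent hc he hce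
  -- it suffices to consider one orientation of the facet
  wlog hb : b = true generalizing c e b
  · obtain rfl : b = false := by simpa using hb
    exact (this he hc (Ne.symm hce) true hf.symm hfu rfl).symm
  subst hb
  obtain ⟨n, n', hh⟩ := hS.exists_isHinge_motion hfu
  have h₁ := hh.apply_coord _ hfu
  have h₂ : f.sides = (c.1, e.1) := hf.1
  rw [h₂] at h₁
  rw [hl.label_eq hf, map_mul, hS.placement_letter, AffineIsometryEquiv.coe_mul,
    Function.comp_apply]
  exact congrArg _ h₁.symm

/-- The developing map of the universal cover into Euclidean space: it is the placement on each of
the lifts. -/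
theorem exists_develop [DecidableEq (Facet S)] (hl : IsLabelledTree hS.Adjacent label) :
    ∃ dev : UniversalCover x₀ → EuclideanSpace ℝ (Fin m), ∀ u e, hS.MemLift u e →
      dev u = hS.placement (label e) (coord S e.1 u.endpoint) := by
  have h : ∀ u : UniversalCover x₀, ∃ p : EuclideanSpace ℝ (Fin m), ∀ e, hS.MemLift u e →
      p = hS.placement (label e) (coord S e.1 u.endpoint) := by
    intro u
    obtain ⟨i, hi⟩ := exists_cell S (u.endpoint : P)
    obtain ⟨κ, hκ⟩ := hS.exists_memLift u hi
    exact ⟨_, fun e he => placement_coord_eq hl hκ he⟩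
  choose dev hdev using h
  exact ⟨dev, hdev⟩

/-- The developing map does not increase the length of arcs: locally it is the unfolding of one or
two cells. -/
theorem exists_nhds_edist_develop_le [DecidableEq (Facet S)]
    (hl : IsLabelledTree hS.Adjacent label) {dev : UniversalCover x₀ → EuclideanSpace ℝ (Fin m)}
    (hdev : ∀ u e, hS.MemLift u e → dev u = hS.placement (label e) (coord S e.1 u.endpoint))
    (u : UniversalCover x₀) (γ : Path u.endpoint y) (q : unitInterval) :
    ∃ V ∈ 𝓝 q, ∀ s ∈ V, ∀ t ∈ V, s ≤ t →
      edist (dev (UniversalCover.moveTo u γ s)) (dev (UniversalCover.moveTo u γ t)) ≤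
        eVariationOn γ (Icc s t) := by
  have hq := hS.eventually_memLift_moveTo u γ q
  -- it suffices to find a map of a neighborhood of the point which does not increase lengths
  suffices h : ∃ D : P → E, ∃ T : E ≃ᵃⁱ[ℝ] E, ∃ U ∈ 𝓝 (γ q : P),
      (∀ τ : unitInterval → P, Continuous τ → (∀ w, τ w ∈ U) →
        edist (D (τ 0)) (D (τ 1)) ≤ eVariationOn τ (uIcc 0 1)) ∧
      ∀ᶠ t in 𝓝 q, dev (UniversalCover.moveTo u γ t) = T (D (γ t)) by
    obtain ⟨D, T, U, hU, hD, hT⟩ := h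
    have hγ : Continuous fun t => (γ t : P) := continuous_subtype_val.comp γ.continuous
    obtain ⟨δ, hδ, hδU⟩ := Metric.mem_nhds_iff.1 (inter_mem (hγ.continuousAt hU) hT)
    refine ⟨_, Metric.ball_mem_nhds q hδ, fun s hs t ht hst => ?_⟩
    rw [(hδU hs).2, (hδU ht).2, T.edist_map]
    have h₁ := hD (fun w => (γ.subpath s t w : P))
      (continuous_subtype_val.comp (γ.subpath s t).continuous) fun w => ?_
    · have h₂ := eVariationOn_subpath_le γ hst
      have h₃ : eVariationOn (fun w => (γ.subpath s t w : P)) (uIcc 0 1) ≤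
          pathLength (γ.subpath s t) := eVariationOn.mono _ (subset_univ _)
      simp only [Path.source, Path.target] at h₁
      exact h₁.trans (h₃.trans h₂)
    · have hw : γ.subpath s t w ∈ γ '' Icc s t := by
        rw [← Path.range_subpath_of_le γ s t hst]; exact mem_range_self w
      obtain ⟨v, hv, hvw⟩ := hw
      have hvU : (γ v : P) ∈ U := by
        refine (hδU (Metric.mem_ball.2 ?_)).1
        have h₁ := Metric.mem_ball.1 hs
        have h₂ := Metric.mem_ball.1 ht
        rw [Subtype.dist_eq, Real.dist_eq, abs_lt] at h₁ h₂ ⊢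
        have h₃ : (s : ℝ) ≤ v := hv.1
        have h₄ : (v : ℝ) ≤ t := hv.2
        exact ⟨by linarith, by linarith⟩
      rwa [hvw] at hvU
  have hγq : ∀ᶠ t in 𝓝 q, ∀ i, (γ t : P) ∈ S.Q i → (γ q : P) ∈ S.Q i :=
    (continuous_subtype_val.comp γ.continuous).continuousAt.eventually
      (eventually_cells_subset S (γ q : P))
  -- the value of the developing map, in terms of the lifts at the time `q`
  have hval : ∀ᶠ t in 𝓝 q, ∀ e : hS.Lift x₀, hS.MemLift (UniversalCover.moveTo u γ q) e →
      (γ t : P) ∈ S.Q e.1 → dev (UniversalCover.moveTo u γ t) =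
        hS.placement (label e) (coord S e.1 (γ t)) := by
    filter_upwards [hq] with t ht e he hte
    obtain ⟨κ, hκ⟩ := hS.exists_memLift (UniversalCover.moveTo u γ t) (i := e.1) hte
    rw [(ht _ hκ).eq hS he rfl] at hκ
    exact hdev _ _ hκ
  obtain ⟨i, hi⟩ := exists_cell S (γ q : P)
  obtain ⟨κ, hκ⟩ := hS.exists_memLift (UniversalCover.moveTo u γ q) (i := i) hi
  by_cases hone : ∀ j, (γ q : P) ∈ S.Q j → j = i
  · refine ⟨coord S i, hS.placement (label ⟨i, κ⟩), S.Q i, ?_, fun τ hτ hτU =>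
      edist_coord_le hτ fun w _ => hτU w, ?_⟩
    · filter_upwards [eventually_cells_subset S (γ q : P)] with z hz
      obtain ⟨j, hj⟩ := exists_cell S z
      rwa [hone j (hz j hj)] at hj
    · filter_upwards [hγq, hval] with t ht ht'
      obtain ⟨j, hj⟩ := exists_cell S (γ t : P)
      rw [hone j (ht j hj)] at hj
      exact ht' _ hκ hj
  · push Not at hone
    obtain ⟨j, hj, hji⟩ := hone
    obtain ⟨f, hf⟩ := exists_facet (γ q).2 hji hj hi
    have hl' := f.commonFace.subset_left hf
    have hr' := f.commonFace.subset_right hf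
    obtain ⟨κ₁, hκ₁⟩ := hS.exists_memLift (UniversalCover.moveTo u γ q) (i := f.sides.1) hl'
    obtain ⟨κ₂, hκ₂⟩ := hS.exists_memLift (UniversalCover.moveTo u γ q) (i := f.sides.2) hr'
    have hadj : hS.Adjacent ⟨f.sides.1, κ₁⟩ ⟨f.sides.2, κ₂⟩ (f, true) := ⟨rfl, _, hκ₁, hκ₂, hf⟩
    obtain ⟨n, n', hh⟩ := hS.exists_isHinge_motion hf
    obtain ⟨U, hU, hUc, hUτ⟩ := hh.exists_unfold_le
    refine ⟨unfold S f.sides.1 f.sides.2 (hS.motion f), hS.placement (label ⟨f.sides.1, κ₁⟩), U,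
      hU, fun τ hτ hτU => hUτ τ hτ hτU 0 1, ?_⟩
    have hUt : ∀ᶠ t in 𝓝 q, (γ t : P) ∈ U :=
      (continuous_subtype_val.comp γ.continuous).continuousAt.eventually hU
    filter_upwards [hval, hUt] with t ht htU
    rcases (hUc _ htU).1 with h | h
    · rw [unfold_of_mem h]
      exact ht _ hκ₁ h
    · rw [unfold_of_mem_right (Z := f.1) (fun h' => (hUc _ htU).2 h' h) hh.apply_coord,
        ht _ hκ₂ h, hl.label_eq hadj, map_mul, hS.placement_letter]
      rfl

/-- The lifts of the cells are isometrically embedded in the universal cover. -/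
theorem edist_eq_edist_coord [DecidableEq (Facet S)] (hl : IsLabelledTree hS.Adjacent label)
    {u v : UniversalCover x₀} {e : hS.Lift x₀} (hu : hS.MemLift u e) (hv : hS.MemLift v e) :
    edist u v = edist (coord S e.1 u.endpoint) (coord S e.1 v.endpoint) := by
  refine le_antisymm (hS.edist_le hu hv) (le_of_forall_gt fun r hr => ?_)
  obtain ⟨γ, hγv, hγ⟩ := exists_move_of_edist_lt hr
  obtain ⟨dev, hdev⟩ := exists_develop hl
  have h₁ := edist_le_of_locally (h := fun t => dev (UniversalCover.moveTo u γ t)) (g := γ)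
    (exists_nhds_edist_develop_le hl hdev u γ)
  have hv' : hS.MemLift (UniversalCover.moveTo u γ 1) e := by rwa [moveTo_one, hγv]
  have h₂ : ∀ t, (UniversalCover.moveTo u γ t).endpoint = γ t := fun t => rfl
  rw [hdev _ e (hS.memLift_moveTo_zero γ hu), hdev _ e hv', AffineIsometryEquiv.edist_map, h₂, h₂,
    γ.source, γ.target] at h₁
  exact h₁.trans_lt hγ

end Develop

/-! ### The ramification -/

section Ram

variable {m : ℕ} {P : Type*} [MetricSpace P] {ι : Type*} {S : ConvexSubdivision m P ι}
  {i j k : ι} {x y z x₀ : regularLocus m P}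

local notation "E" => EuclideanSpace ℝ (Fin m)

/-- Neighboring lifts share a point, and they have finite distances inside, so all distances in the
universal cover are finite. -/
theorem IsTame.edist_ne_top (hS : IsTame S) (u v : UniversalCover x₀) : edist u v ≠ ⊤ := by
  have hcell : ∀ {e : hS.Lift x₀} {v w : UniversalCover x₀}, hS.MemLift v e → hS.MemLift w e →
      edist v w ≠ ⊤ := fun hv hw =>
    ne_top_of_le_ne_top (_root_.edist_ne_top _ _) (hS.edist_le hv hw)
  have hlift : ∀ w : UniversalCover x₀, ∃ e : hS.Lift x₀, hS.MemLift w e := fun w => by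
    obtain ⟨i, hi⟩ := exists_cell S (w.endpoint : P)
    obtain ⟨κ, hκ⟩ := hS.exists_memLift w hi
    exact ⟨_, hκ⟩
  obtain ⟨e, he⟩ := hlift u
  obtain ⟨e', he'⟩ := hlift v
  refine hS.connected (fun d => ∀ w, hS.MemLift w d → edist u w ≠ ⊤) ?_ e e'
    (fun w hw => hcell he hw) v he'
  rintro c d f ⟨-, w, hwc, hwd, -⟩ hc w' hw'
  exact ne_top_of_le_ne_top (ENNReal.add_ne_top.2 ⟨hc w hwc, hcell hwd hw'⟩)
    (edist_triangle u w w')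

theorem IsTame.edist_completion_ne_top (hS : IsTame S) (p q : Ram m P x₀) : edist p q ≠ ⊤ := by
  have happ : ∀ p : Ram m P x₀, ∃ u : UniversalCover x₀, edist p (toCompletion u) < 1 := by
    intro p
    obtain ⟨_, h, u, rfl⟩ := denseRange_toCompletion.inter_open_nonempty (Metric.eball p 1)
      Metric.isOpen_eball ⟨p, Metric.mem_eball_self one_pos⟩
    exact ⟨u, by rw [edist_comm]; exact h⟩
  obtain ⟨u, hu⟩ := happ p
  obtain ⟨v, hv⟩ := happ q
  refine ne_top_of_le_ne_top ?_ (edist_triangle4 p (toCompletion u) (toCompletion v) q)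
  rw [edist_toCompletion, edist_comm _ q]
  exact ENNReal.add_ne_top.2 ⟨ENNReal.add_ne_top.2 ⟨hu.ne_top, hS.edist_ne_top u v⟩, hv.ne_top⟩

/-- The metric of the ramification, with real values. -/
noncomputable abbrev IsTame.metricSpaceRam (hS : IsTame S) (x₀ : regularLocus m P) :
    MetricSpace (Ram m P x₀) :=
  EMetricSpace.toMetricSpace hS.edist_completion_ne_top

theorem IsTame.closure_regDom (hS : IsTame S) (i : ι) : closure (regDom S i) = S.C i := by
  refine subset_antisymm ?_ ?_
  · exact closure_minimal (fun c hc => hc.1) (IsConvexPolyhedron.isClosed (S.isConvexPolyhedron i))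
  · refine subset_trans ?_ (closure_mono hS.interior_subset_regDom)
    rw [(convex_C S i).closure_interior_eq_closure_of_nonempty_interior (S.interior_nonempty i)]
    exact subset_closure

/-- The polyhedra embed isometrically into the ramification. -/
theorem exists_cellMap [DecidableEq (Facet S)] {hS : IsTame S}
    {label : hS.Lift x₀ → FreeGroup (Facet S)} (hl : IsLabelledTree hS.Adjacent label)
    (e : hS.Lift x₀) : ∃ g : EuclideanSpace ℝ (Fin m) → Ram m P x₀,
      (∀ u, hS.MemLift u e → g (coord S e.1 u.endpoint) = toCompletion u) ∧
        ∀ c ∈ S.C e.1, ∀ d ∈ S.C e.1, edist (g c) (g d) = edist c d := by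
  let _ := hS.metricSpaceRam x₀
  classical
  let f : E → Ram m P x₀ := fun c => if hc : c ∈ regDom S e.1 then
    toCompletion (hS.exists_memLift_coord e hc).choose else toCompletion ⟨x₀, .refl x₀⟩
  have hf : ∀ u, hS.MemLift u e → f (coord S e.1 u.endpoint) = toCompletion u := by
    intro u hu
    have hc := coord_mem_regDom hu.1
    have h := (hS.exists_memLift_coord e hc).choose_spec
    have he : (hS.exists_memLift_coord e hc).choose = u := by
      refine h.1.eq_of_endpoint_eq hu (Subtype.ext ?_)
      rw [← toP_coord h.1.1, h.2, toP_coord hu.1]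
    calc f (coord S e.1 u.endpoint) = toCompletion (hS.exists_memLift_coord e hc).choose :=
          dif_pos hc
      _ = toCompletion u := by rw [he]
  obtain ⟨g, hg, hg'⟩ := exists_isometric_extension (S := regDom S e.1) (f := f) (by
    intro c hc d hd
    obtain ⟨u, hu, rfl⟩ := hS.exists_memLift_coord e hc
    obtain ⟨v, hv, rfl⟩ := hS.exists_memLift_coord e hd
    rw [hf u hu, hf v hv, dist_edist, dist_edist, edist_toCompletion,
      edist_eq_edist_coord hl hu hv])
  rw [hS.closure_regDom] at hg'
  refine ⟨g, fun u hu => ?_, fun c hc d hd => ?_⟩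
  · rw [hg _ (coord_mem_regDom hu.1), hf u hu]
  · rw [edist_dist, edist_dist, hg' c hc d hd]

/-- The ramification of a polyhedral space with a subdivision into convex polyhedra whose faces of
codimension two are singular is a CAT(0) space. -/
theorem IsTame.isCAT0_ram (hS : IsTame S) (x₀ : regularLocus m P) : IsCAT0 (Ram m P x₀) := by
  classical
  obtain ⟨label, hl⟩ := hS.exists_isLabelledTree x₀
  let _ := hS.metricSpaceRam x₀
  choose g hg hgd using exists_cellMap hl
  have hgdist : ∀ e : hS.Lift x₀, ∀ c ∈ S.C e.1, ∀ d ∈ S.C e.1,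
      dist (g e c) (g e d) = dist c d := by
    intro e c hc d hd
    rw [dist_edist, dist_edist, hgd e c hc d hd]
  have hgcont : ∀ e : hS.Lift x₀, ContinuousOn (g e) (S.C e.1) := fun e =>
    (LipschitzOnWith.of_dist_le_mul (K := 1) fun c hc d hd => by
      simpa using (hgdist e c hc d hd).le).continuousOn
  have hclosed : ∀ i, IsClosed (S.C i) := fun i =>
    IsConvexPolyhedron.isClosed (S.isConvexPolyhedron i)
  -- the distance of two cells is the word length of the quotient of their labels
  let T : Cells E (Ram m P x₀) :=
    { Cell := hS.Lift x₀
      dom := fun e => S.C e.1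
      map := g
      N := fun e c => ((label e)⁻¹ * label c).norm
      convex := fun e => convex_C S e.1
      dist_map := fun e c hc d hd => by rw [hgdist e c hc d hd, dist_eq_norm]
      N_self := fun e => by simp
      eq_of_N_eq_zero := fun c e h => hl.label_injective
        (inv_mul_eq_one.1 (FreeGroup.norm_eq_zero.1 h)) }
  have hwall : ∀ (c c' : hS.Lift x₀) (f : Facet S × Bool), hS.Adjacent c c' f →
      ∃ F A, T.IsWall c c' F A := by
    intro c c' f hf
    obtain ⟨hZ, hne⟩ := hf.commonFace
    obtain ⟨a, haf, ha⟩ := f.1.exists_mem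
    obtain ⟨n, n', A, hinge, -⟩ := hS.exists_isHinge hne hZ haf ha
    -- the regular points of the facet; the wall is the closure of this set
    let W : Set E := {p | ∃ b ∈ f.1.1, b ∈ regularLocus m P ∧ coord S c'.1 b = p}
    have hWC : W ⊆ S.C c'.1 := by
      rintro _ ⟨b, hb, -, rfl⟩
      exact coord_mem (hZ.subset_right hb)
    have hFC : closure W ⊆ S.C c'.1 := closure_minimal hWC (hclosed _)
    have hAC : MapsTo A (closure W) (S.C c.1) := by
      have : MapsTo A W (S.C c.1) := by
        rintro _ ⟨b, hb, -, rfl⟩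
        rw [hinge.apply_coord b hb]
        exact coord_mem (hZ.subset_left hb)
      have h := this.closure A.continuous
      rwa [(hclosed c.1).closure_eq] at h
    refine ⟨closure W, A.toAffineEquiv.toAffineMap, ?_, hFC, hAC, ?_, hl.alternative hf, ?_⟩
    · refine Convex.closure ?_
      rintro _ ⟨b, hb, hb', rfl⟩ _ ⟨d, hd, hd', rfl⟩ s t hs ht hst
      refine ⟨_, hZ.symm.combo_mem hb hd hs ht hst,
        hS.combo_mem_regularLocus hne.symm hZ.symm hb hb' hd hd' hs ht hst, coord_toP ?_⟩
      exact convex_C S c'.1 (coord_mem (hZ.subset_right hb)) (coord_mem (hZ.subset_right hd)) hs ht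
        hst
    · have hEq : EqOn (fun p => g c (A p)) (g c') W := by
        rintro _ ⟨b, hb, hb', rfl⟩
        have hbC := coord_mem (hZ.subset_left hb)
        obtain ⟨w, hw, hwb⟩ := hS.exists_memLift_coord c
          (coord_mem_regDom (x := ⟨b, hb'⟩) (hZ.subset_left hb))
        have hwb' : (w.endpoint : P) = b := by
          rw [← toP_coord hw.1, hwb, toP_coord (hZ.subset_left hb)]
        have hw' : hS.MemLift w c' := hf.memLift hS hw (by rwa [hwb'])
        have h₁ := hg c w hw
        have h₂ := hg c' w hw'
        rw [hwb'] at h₁ h₂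
        change g c (A (coord S c'.1 b)) = _
        rw [hinge.apply_coord b hb, h₁, h₂]
      have := hEq.of_subset_closure ((hgcont c).comp A.continuous.continuousOn hAC)
        ((hgcont c').mono hFC) subset_closure subset_rfl
      exact fun p hp => this hp
    · intro e e' he he' p hp q hq
      change p ∈ S.C e.1 at hp
      change q ∈ S.C e'.1 at hq
      change ∃ a ∈ closure W, dist (g e p) (g e' q) =
        dist (g e p) (g c' a) + dist (g c' a) (g e' q)
      set d := dist (g e p) (g e' q) with hd
      -- almost shortest curves meet the wall
      have happ : ∀ ε > 0, ∃ w ∈ W, dist (g e p) (g c' w) + dist (g c' w) (g e' q) < d + ε := by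
        intro ε hε
        have hpt : ∀ (e : hS.Lift x₀) (p : E), p ∈ S.C e.1 → ∃ u, hS.MemLift u e ∧
            dist (g e p) (toCompletion u) < ε / 5 := by
          intro e p hp
          rw [← hS.closure_regDom] at hp
          obtain ⟨p', hp', hpp⟩ := Metric.mem_closure_iff.1 hp (ε / 5) (by positivity)
          obtain ⟨u, hu, rfl⟩ := hS.exists_memLift_coord e hp'
          rw [hS.closure_regDom] at hp
          refine ⟨u, hu, ?_⟩
          rwa [← hg e u hu, hgdist e p hp _ (coord_mem hu.1)]
        obtain ⟨u, hu, hpu⟩ := hpt e p hp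
        obtain ⟨v, hv, hqv⟩ := hpt e' q hq
        have huv : edist u v < ENNReal.ofReal (d + 3 * (ε / 5)) := by
          rw [← edist_toCompletion, edist_dist]
          refine (ENNReal.ofReal_lt_ofReal_iff_of_nonneg dist_nonneg).2 ?_
          have h₁ := dist_triangle4 (toCompletion u) (g e p) (g e' q) (toCompletion v)
          rw [dist_comm (toCompletion u) (g e p)] at h₁
          linarith
        obtain ⟨w, hwc, hwc', hwf, hlt⟩ := hS.exists_mem_wall hl hf he he' hu hv huv
        refine ⟨coord S c'.1 w.endpoint, ⟨_, hwf, w.endpoint.2, rfl⟩, ?_⟩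
        rw [hg c' w hwc']
        rw [← edist_toCompletion, ← edist_toCompletion w v, edist_dist, edist_dist,
          ← ENNReal.ofReal_add dist_nonneg dist_nonneg,
          ENNReal.ofReal_lt_ofReal_iff_of_nonneg (by positivity)] at hlt
        have h₁ := dist_triangle (g e p) (toCompletion u) (toCompletion w)
        have h₂ := dist_triangle (toCompletion w) (toCompletion v) (g e' q)
        rw [dist_comm (toCompletion v)] at h₂
        linarith
      let φ : E → ℝ := fun w => dist (g e p) (g c' w) + dist (g c' w) (g e' q)
      have hφ : ContinuousOn φ (closure W) := by
        have := (hgcont c').mono hFC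
        exact (continuous_dist.comp_continuousOn (continuousOn_const.prodMk this)).add
          (continuous_dist.comp_continuousOn (this.prodMk continuousOn_const))
      -- a shortest detour to the wall exists by compactness
      let K : Set E := closure W ∩ φ ⁻¹' Iic (d + 1)
      obtain ⟨w₀, hw₀, hw₀'⟩ := happ 1 one_pos
      have hK : IsCompact K := by
        refine Metric.isCompact_of_isClosed_isBounded
          (hφ.preimage_isClosed_of_isClosed isClosed_closure isClosed_Iic) ?_
        refine (Metric.isBounded_closedBall (x := w₀) (r := 2 * (d + 1))).subset fun w hw => ?_
        have hw' : dist (g e p) (g c' w) + dist (g c' w) (g e' q) ≤ d + 1 := hw.2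
        rw [Metric.mem_closedBall, ← hgdist c' w (hFC hw.1) w₀ (hWC hw₀)]
        have h₁ := dist_triangle (g c' w) (g e p) (g c' w₀)
        rw [dist_comm (g c' w) (g e p)] at h₁
        linarith [dist_nonneg (x := g c' w) (y := g e' q),
          dist_nonneg (x := g c' w₀) (y := g e' q)]
      obtain ⟨w, hw, hmin⟩ := hK.exists_isMinOn ⟨w₀, subset_closure hw₀, hw₀'.le⟩
        (hφ.mono inter_subset_left)
      refine ⟨w, hw.1, le_antisymm (dist_triangle _ _ _) (le_of_forall_pos_le_add fun ε hε => ?_)⟩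
      obtain ⟨w', hw', hlt⟩ := happ (min ε 1) (lt_min hε one_pos)
      have h₁ : φ w ≤ φ w' := hmin ⟨subset_closure hw',
        show φ w' ≤ d + 1 from hlt.le.trans (by linarith [min_le_right ε 1])⟩
      have h₂ : φ w' < d + min ε 1 := hlt
      have h₃ : φ w = dist (g e p) (g c' w) + dist (g c' w) (g e' q) := rfl
      linarith [min_le_left ε 1]
  refine Cells.isCAT0 T (fun e c' hne => ?_) ?_
  · obtain ⟨c, f, hf, hN⟩ := hl.exists_nearer e c' hne
    obtain ⟨F, A, hFA⟩ := hwall c c' f hf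
    exact ⟨c, F, A, hFA, hN⟩
  · refine denseRange_toCompletion.mono ?_
    rintro _ ⟨u, rfl⟩
    obtain ⟨i, hi⟩ := exists_cell S (u.endpoint : P)
    obtain ⟨κ, hκ⟩ := hS.exists_memLift u hi
    exact mem_iUnion.2 ⟨⟨i, κ⟩, coord S i u.endpoint, coord_mem hi, hg ⟨i, κ⟩ u hκ⟩

end Ram

end Ramification

theorem mainTheorem10 (m : ℕ) (P : Type*) [MetricSpace P] (hP : IsPolyhedralSpace m P)
    (ι : Type*) (S : ConvexSubdivision m P ι)
    (hS : ∀ (i : ι) (F : Set (EuclideanSpace ℝ (Fin m))), IsFace (S.C i) F → faceDim F + 2 = m →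
      cellImage (S.chart i) F ⊆ singularLocus m P)
    (hconn : IsConnected (regularLocus m P)) (x₀ : regularLocus m P) :
    IsCAT0 (Ram m P x₀) :=
  (Ramification.isTame_of_singular hP hS).isCAT0_ram x₀
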